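/- Let $\mathbb S^1=\mathbb R/\mathbb Z$ with coordinate $\theta$ and its positive orientation (for a bounded simply connected planar domain $\Omega$ with smooth boundary, $\partial\Omega$ is identified with $\mathbb S^1$ by a positively oriented smooth parametrization). Let $b:\mathbb S^1\to\mathbb S^1$ be an orientation preserving $C^\infty$ diffeomorphism which is Morse--Smale: the set $\Sigma$ of periodic points of $b$ is nonempty, and $\partial_\theta (b^n)(x)\neq 1$ for every $x\in\Sigma$, where $n$ is the minimal period of $x$. Let $$\Sigma^+:=\{x\in\Sigma\mid \partial_\theta (b^n)(x)<1\},\qquad \Sigma^-:=\{x\in\Sigma\mid \partial_\theta (b^n)(x)>1\}$$ be the sets of attractive, respectively repulsive, periodic points, and put $$N^*_+\Sigma^+:=\{(x,\xi)\in T^*\mathbb S^1\mid x\in\Sigma^+,\ \xi>0\},\qquad N^*_-\Sigma^-:=\{(x,\xi)\in T^*\mathbb S^1\mid x\in\Sigma^-,\ \xi<0\},$$ where the covector $\xi\,d\theta$ at $x$ is written $(x,\xi)$. Suppose that a complex valued distribution $u\in\mathcal D'(\mathbb S^1)$ satisfies $$b^*u=u,\qquad \operatorname{WF}(u)\subset N^*_+\Sigma^+\sqcup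 N^*_-\Sigma^-,$$ where $b^*$ is the pullback of distributions extending $v\mapsto v\circ b$ from functions. Then $u$ is constant. -/

import Mathlib

open scoped ContDiff Topology

noncomputable section

/-! The oriented circle `ℝ / ℤ` (`UnitAddCircle`), with coordinate `θ` modulo `1`, its smooth maps,
its distributions and their wavefront sets.  The cotangent bundle is trivialized by `dθ`,
so that a covector is a pair `(x, ξ)` with `x` in the circle and `ξ` real. -/

namespace CircleDynamics

/-- The representative in `[-1/2, 1/2)` of a point of the circle `ℝ / ℤ`. -/
def coord (y : UnitAddCircle) : ℝ := (AddCircle.equivIco (1 : ℝ) (-1 / 2) y : ℝ)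

lemma coe_coord (y : UnitAddCircle) : ((coord y : ℝ) : UnitAddCircle) = y :=
  AddCircle.coe_equivIco (p := (1 : ℝ)) (a := (-1 / 2 : ℝ))

lemma coord_coe {t : ℝ} (ht : |t| < 1 / 2) : coord (t : UnitAddCircle) = t := by
  have h := abs_lt.1 ht
  unfold coord
  rw [AddCircle.equivIco_coe_of_mem]
  constructor <;> linarith [h.1, h.2]

lemma abs_coord (y : UnitAddCircle) : |coord y| = ‖y‖ := by
  have h := (AddCircle.equivIco (1 : ℝ) (-1 / 2) y).2
  have h2 : ‖((coord y : ℝ) : UnitAddCircle)‖ = |coord y| := by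
    rw [AddCircle.norm_coe_eq_abs_iff (p := (1 : ℝ)) one_ne_zero, abs_one, abs_le]
    unfold coord
    constructor <;> linarith [h.1, h.2]
  rw [← h2, coe_coord]

/-! ### Smooth maps of the circle -/

/-- A map of the circle is `C^∞` when it is covered by a `C^∞` map of the line. -/
def IsSmoothMap (f : UnitAddCircle → UnitAddCircle) : Prop :=
  ∃ F : ℝ → ℝ, ContDiff ℝ ∞ F ∧ ∀ t : ℝ, ((F t : ℝ) : UnitAddCircle) = f t

/-- The derivative `∂_θ f (x)` of a map of the circle, in the coordinate `θ`. -/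
def circleDeriv (f : UnitAddCircle → UnitAddCircle) (x : UnitAddCircle) : ℝ :=
  deriv (fun t : ℝ => coord (f (x + (t : UnitAddCircle)) - f x)) 0

/-- The derivative of a map of the circle is the derivative of any lift. -/
lemma circleDeriv_eq {f : UnitAddCircle → UnitAddCircle} {F : ℝ → ℝ}
    (hF : ∀ t : ℝ, ((F t : ℝ) : UnitAddCircle) = f t) {x : ℝ} (hc : ContinuousAt F x) :
    circleDeriv f (x : UnitAddCircle) = deriv F x := by
  have h1 : ContinuousAt (fun t : ℝ => F (x + t) - F x) 0 := by
    have : ContinuousAt (fun t : ℝ => F (x + t)) 0 := by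
      apply ContinuousAt.comp (g := F)
      · simpa using hc
      · fun_prop
    exact this.sub continuousAt_const
  have h2 : ∀ᶠ t : ℝ in 𝓝 0, |F (x + t) - F x| < 1 / 2 := by
    have h3 := h1.abs
    have h4 : (fun t : ℝ => |F (x + t) - F x|) 0 < 1 / 2 := by simp
    exact h3.eventually (Iio_mem_nhds h4)
  have h5 : (fun t : ℝ => coord (f ((x : UnitAddCircle) + (t : UnitAddCircle))
      - f (x : UnitAddCircle))) =ᶠ[𝓝 0] fun t => F (x + t) - F x := by
    filter_upwards [h2] with t ht
    rw [← AddCircle.coe_add, ← hF, ← hF, ← AddCircle.coe_sub, coord_coe ht]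
  unfold circleDeriv
  rw [h5.deriv_eq, deriv_sub_const, deriv_comp_const_add, add_zero]

/-- An orientation preserving `C^∞` diffeomorphism of the circle. -/
structure CircleDiffeo extends UnitAddCircle ≃ UnitAddCircle where
  smooth_toFun : IsSmoothMap toFun
  smooth_invFun : IsSmoothMap invFun
  deriv_pos : ∀ x, 0 < circleDeriv toFun x

namespace CircleDiffeo

/-- The set of periodic points. -/
def periodicSet (b : CircleDiffeo) : Set UnitAddCircle := Function.periodicPts b.toEquiv

/-- The derivative at `x` of `b^n`, where `n` is the minimal period of `x`. -/
def multiplier (b : CircleDiffeo) (x : UnitAddCircle) : ℝ :=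
  circleDeriv (b.toEquiv^[Function.minimalPeriod b.toEquiv x]) x

/-- Morse–Smale: there are periodic points, and all of them are hyperbolic. -/
def IsMorseSmale (b : CircleDiffeo) : Prop :=
  b.periodicSet.Nonempty ∧ ∀ x ∈ b.periodicSet, b.multiplier x ≠ 1

/-- The set `Σ⁺` of attractive periodic points. -/
def attracting (b : CircleDiffeo) : Set UnitAddCircle :=
  {x | x ∈ b.periodicSet ∧ b.multiplier x < 1}

/-- The set `Σ⁻` of repulsive periodic points. -/
def repelling (b : CircleDiffeo) : Set UnitAddCircle :=
  {x | x ∈ b.periodicSet ∧ 1 < b.multiplier x}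

end CircleDiffeo

/-! ### Smooth functions and distributions -/

/-- The space `C^∞(ℝ / ℤ; ℂ)`. -/
def SmoothFun : Submodule ℂ (UnitAddCircle → ℂ) where
  carrier := {φ | ContDiff ℝ ∞ fun t : ℝ => φ (t : UnitAddCircle)}
  add_mem' := fun {φ ψ} (hφ : ContDiff ℝ ∞ fun t : ℝ => φ (t : UnitAddCircle))
    (hψ : ContDiff ℝ ∞ fun t : ℝ => ψ (t : UnitAddCircle)) => hφ.add hψ
  zero_mem' := (contDiff_const : ContDiff ℝ ∞ fun _ : ℝ => (0 : ℂ))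
  smul_mem' := fun c φ (hφ : ContDiff ℝ ∞ fun t : ℝ => φ (t : UnitAddCircle)) =>
    (contDiff_const (c := c)).mul hφ

/-- All derivatives of `φ` of order at most `N` are bounded by `M`. -/
def DerivBound (φ : UnitAddCircle → ℂ) (N : ℕ) (M : ℝ) : Prop :=
  ∀ k ≤ N, ∀ x : ℝ, ‖iteratedDeriv k (fun t : ℝ => φ (t : UnitAddCircle)) x‖ ≤ M

/-- A (complex valued) distribution on the circle: a linear form on `C^∞(ℝ / ℤ; ℂ)` which is
continuous for the `C^∞` topology.  A function `v` is the distribution `φ ↦ ∫ v φ dθ`. -/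
@[ext]
structure CircleDistribution where
  toLin : SmoothFun →ₗ[ℂ] ℂ
  bounded : ∃ (N : ℕ) (C : ℝ), ∀ (φ : SmoothFun) (M : ℝ),
    DerivBound (φ : UnitAddCircle → ℂ) N M → ‖toLin φ‖ ≤ C * M

/-- `u` is a constant `c`, that is, `⟨u, φ⟩ = ∫ c φ dθ`. -/
def CircleDistribution.IsConstant (u : CircleDistribution) : Prop :=
  ∃ c : ℂ, ∀ φ : SmoothFun,
    u.toLin φ = ∫ t in (0 : ℝ)..1, c * (φ : UnitAddCircle → ℂ) (t : UnitAddCircle)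

/-! ### Pullback of distributions -/

lemma smooth_comp_mul {g : UnitAddCircle → UnitAddCircle} (hg : IsSmoothMap g)
    {φ : UnitAddCircle → ℂ} (hφ : φ ∈ SmoothFun) :
    (fun y => φ (g y) * (circleDeriv g y : ℂ)) ∈ SmoothFun := by
  obtain ⟨G, hG, hl⟩ := hg
  have h : (fun t : ℝ => φ (g (t : UnitAddCircle)) * (circleDeriv g (t : UnitAddCircle) : ℂ))
      = fun t : ℝ => φ ((G t : ℝ) : UnitAddCircle) * ((deriv G t : ℝ) : ℂ) := by
    funext t
    rw [circleDeriv_eq hl hG.continuous.continuousAt, hl]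
  have hφ' : ContDiff ℝ ∞ fun t : ℝ => φ (t : UnitAddCircle) := hφ
  have hd : ContDiff ℝ ∞ (deriv G) := (contDiff_infty_iff_deriv.1 hG).2
  show ContDiff ℝ ∞ _
  rw [h]
  exact (hφ'.comp hG).mul (Complex.ofRealCLM.contDiff.comp hd)

lemma bound_comp_mul {G : ℝ → ℝ} (hG : ContDiff ℝ ∞ G) (hGp : Function.Periodic (deriv G) 1)
    (k : ℕ) : ∀ h : ℝ → ℂ, ContDiff ℝ ∞ h → Function.Periodic h 1 →
      ∃ C : ℝ, ∀ (φ : ℝ → ℂ) (M : ℝ), ContDiff ℝ ∞ φ →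
        (∀ j ≤ k, ∀ x, ‖iteratedDeriv j φ x‖ ≤ M) →
        ∀ x, ‖iteratedDeriv k (fun t => φ (G t) * h t) x‖ ≤ C * M := by
  induction k with
  | zero =>
    intro h hh hp
    obtain ⟨C, hC⟩ := (hp.isBounded_of_continuous one_ne_zero hh.continuous).exists_norm_le
    refine ⟨C, fun φ M _ hM x => ?_⟩
    have h1 := hM 0 le_rfl (G x)
    have h2 := hC (h x) ⟨x, rfl⟩
    simp only [iteratedDeriv_zero] at h1 ⊢
    rw [norm_mul, mul_comm]
    exact mul_le_mul h2 h1 (norm_nonneg _) ((norm_nonneg _).trans h2)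
  | succ k ih =>
    intro h hh hp
    have hdG : ContDiff ℝ ∞ (deriv G) := (contDiff_infty_iff_deriv.1 hG).2
    have hdh : ContDiff ℝ ∞ (deriv h) := (contDiff_infty_iff_deriv.1 hh).2
    have hdGC : ContDiff ℝ ∞ fun t => ((deriv G t : ℝ) : ℂ) :=
      Complex.ofRealCLM.contDiff.comp hdG
    have hp' : Function.Periodic (deriv h) 1 := by
      intro x
      rw [← deriv_comp_add_const, show (fun y => h (y + 1)) = h from funext hp]
    obtain ⟨C₁, h₁⟩ := ih (fun t => ((deriv G t : ℝ) : ℂ) * h t) (hdGC.mul hh)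
      (fun x => by simp only [hGp x, hp x])
    obtain ⟨C₂, h₂⟩ := ih (deriv h) hdh hp'
    refine ⟨C₁ + C₂, fun φ M hφ hM x => ?_⟩
    have hdφ : ContDiff ℝ ∞ (deriv φ) := (contDiff_infty_iff_deriv.1 hφ).2
    have hder : deriv (fun t => φ (G t) * h t)
        = (fun t => deriv φ (G t) * (((deriv G t : ℝ) : ℂ) * h t))
          + fun t => φ (G t) * deriv h t := by
      funext t
      have e1 : HasDerivAt φ (deriv φ (G t)) (G t) :=
        (hφ.differentiable (by simp) _).hasDerivAt
      have e2 : HasDerivAt G (deriv G t) t := (hG.differentiable (by simp) _).hasDerivAt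
      have e3 : HasDerivAt h (deriv h t) t := (hh.differentiable (by simp) _).hasDerivAt
      have e4 := ((e1.scomp t e2).mul e3).deriv
      simp only [Pi.add_apply]
      refine e4.trans ?_
      simp only [Complex.real_smul, Function.comp_apply]
      ring
    have hs1 : ContDiff ℝ ∞ fun t => deriv φ (G t) * (((deriv G t : ℝ) : ℂ) * h t) :=
      (hdφ.comp hG).mul (hdGC.mul hh)
    have hs2 : ContDiff ℝ ∞ fun t => φ (G t) * deriv h t := (hφ.comp hG).mul hdh
    rw [iteratedDeriv_succ', hder, iteratedDeriv_add
      (hs1.contDiffAt.of_le (by exact_mod_cast le_top))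
      (hs2.contDiffAt.of_le (by exact_mod_cast le_top)), add_mul]
    refine (norm_add_le _ _).trans (add_le_add ?_ ?_)
    · refine h₁ (deriv φ) M hdφ (fun j hj y => ?_) x
      rw [← iteratedDeriv_succ']
      exact hM (j + 1) (by omega) y
    · exact h₂ φ M hφ (fun j hj y => hM j (by omega) y) x

lemma derivBound_comp_mul {g : UnitAddCircle → UnitAddCircle} (hg : IsSmoothMap g) (N : ℕ) :
    ∃ C : ℝ, ∀ φ ∈ SmoothFun, ∀ M : ℝ, DerivBound φ N M →
      DerivBound (fun y => φ (g y) * (circleDeriv g y : ℂ)) N (C * M) := by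
  obtain ⟨G, hG, hl⟩ := hg
  have hcd : ∀ t : ℝ, circleDeriv g (t : UnitAddCircle) = deriv G t := fun t =>
    circleDeriv_eq hl hG.continuous.continuousAt
  have hGp : Function.Periodic (deriv G) 1 := by
    intro x
    rw [← hcd, ← hcd, AddCircle.coe_add_period]
  have hdG : ContDiff ℝ ∞ (deriv G) := (contDiff_infty_iff_deriv.1 hG).2
  have hdGC : ContDiff ℝ ∞ fun t => ((deriv G t : ℝ) : ℂ) :=
    Complex.ofRealCLM.contDiff.comp hdG
  choose C hC using fun k => bound_comp_mul hG hGp k (fun t => ((deriv G t : ℝ) : ℂ)) hdGC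
    (fun x => by simp only [hGp x])
  refine ⟨∑ k ∈ Finset.range (N + 1), |C k|, fun φ hφ M hM k hk x => ?_⟩
  have hM0 : 0 ≤ M := (norm_nonneg _).trans (hM 0 (Nat.zero_le _) 0)
  have h1 := hC k (fun t : ℝ => φ (t : UnitAddCircle)) M hφ (fun j hj => hM j (hj.trans hk)) x
  have h2 : (fun t : ℝ => φ (g (t : UnitAddCircle)) * (circleDeriv g (t : UnitAddCircle) : ℂ))
      = fun t : ℝ => φ ((G t : ℝ) : UnitAddCircle) * ((deriv G t : ℝ) : ℂ) := by
    funext t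
    rw [hcd, hl]
  rw [h2]
  refine h1.trans (mul_le_mul_of_nonneg_right ((le_abs_self _).trans ?_) hM0)
  exact Finset.single_le_sum (f := fun k => |C k|) (fun i _ => abs_nonneg _)
    (Finset.mem_range.2 (by omega))

/-- The pullback `b^* u`, which extends `v ↦ v ∘ b` from functions to distributions:
`⟨b^* u, φ⟩ = ⟨u, (φ ∘ b⁻¹) · (b⁻¹)'⟩`. -/
def CircleDiffeo.pullback (b : CircleDiffeo) (u : CircleDistribution) : CircleDistribution where
  toLin :=
    { toFun := fun φ => u.toLin ⟨fun y => (φ : UnitAddCircle → ℂ) (b.toEquiv.symm y)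
        * (circleDeriv b.toEquiv.symm y : ℂ), smooth_comp_mul b.smooth_invFun φ.2⟩
      map_add' := fun φ ψ => by
        rw [← map_add]
        congr 1
        ext y
        simp [add_mul]
      map_smul' := fun c φ => by
        rw [RingHom.id_apply, ← map_smul]
        congr 1
        ext y
        simp [mul_assoc] }
  bounded := by
    obtain ⟨N, C, hC⟩ := u.bounded
    obtain ⟨D, hD⟩ := derivBound_comp_mul b.smooth_invFun N
    refine ⟨N, C * D, fun φ M hM => ?_⟩
    rw [mul_assoc]
    exact hC _ _ (hD φ φ.2 M hM)

/-! ### Wavefront sets -/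

/-- For a cutoff `χ` supported in the coordinate arc `|θ - x| < 1/2` around `x`, the smooth function
`χ(θ) exp(- i η (θ - x))`, extended by zero. -/
def localExp (χ : SmoothFun) (x : UnitAddCircle)
    (hχ : tsupport (χ : UnitAddCircle → ℂ) ⊆ Metric.ball x (1 / 2)) (η : ℝ) : SmoothFun :=
  ⟨fun y => (χ : UnitAddCircle → ℂ) y * Complex.exp (-(Complex.I * η * coord (y - x))), by
    show ContDiff ℝ ∞ _
    have hχs : ContDiff ℝ ∞ fun t : ℝ => (χ : UnitAddCircle → ℂ) (t : UnitAddCircle) := χ.2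
    have hcoe : Continuous fun t : ℝ => (t : UnitAddCircle) := AddCircle.continuous_mk' 1
    rw [contDiff_iff_contDiffAt]
    intro t
    by_cases ht : (t : UnitAddCircle) ∈ tsupport (χ : UnitAddCircle → ℂ)
    · have hb := hχ ht
      rw [Metric.mem_ball, dist_eq_norm, ← abs_coord] at hb
      have hev : ∀ᶠ r : ℝ in 𝓝 t, |coord ((t : UnitAddCircle) - x) + (r - t)| < 1 / 2 := by
        have hc : ContinuousAt (fun r : ℝ => |coord ((t : UnitAddCircle) - x) + (r - t)|) t := by
          fun_prop
        exact hc.eventually (Iio_mem_nhds (by simpa using hb))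
      have hsm : ContDiffAt ℝ ∞ (fun r : ℝ => (χ : UnitAddCircle → ℂ) (r : UnitAddCircle)
          * Complex.exp (-(Complex.I * η *
            ((coord ((t : UnitAddCircle) - x) + (r - t) : ℝ) : ℂ)))) t := by
        refine hχs.contDiffAt.mul (ContDiff.contDiffAt ?_)
        refine ContDiff.cexp (ContDiff.neg (contDiff_const.mul ?_))
        exact Complex.ofRealCLM.contDiff.comp
          (contDiff_const.add (contDiff_id.sub contDiff_const))
      refine hsm.congr_of_eventuallyEq ?_
      filter_upwards [hev] with r hr
      have he : (r : UnitAddCircle) - x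
          = ((coord ((t : UnitAddCircle) - x) + (r - t) : ℝ) : UnitAddCircle) := by
        rw [AddCircle.coe_add, coe_coord, AddCircle.coe_sub]
        abel
      rw [he, coord_coe hr]
    · have hev : ∀ᶠ r : ℝ in 𝓝 t, (r : UnitAddCircle) ∉ tsupport (χ : UnitAddCircle → ℂ) :=
        hcoe.continuousAt.eventually ((isClosed_tsupport _).isOpen_compl.mem_nhds ht)
      refine (contDiffAt_const (c := (0 : ℂ))).congr_of_eventuallyEq ?_
      filter_upwards [hev] with r hr
      rw [image_eq_zero_of_notMem_tsupport hr, zero_mul]⟩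

/-- The wavefront set.  A covector `(x, ξ)`, `ξ ≠ 0`, is not in `WF(u)` when there is a smooth
cutoff `χ` supported in the coordinate arc around `x`, with `χ(x) ≠ 0`, such that the Fourier
transform of `χ u` in the coordinate `θ - x` decays faster than any power in a conic neighborhood
of `ξ`; in dimension one such a neighborhood is the half line of all `η` with the sign of `ξ`. -/
def CircleDistribution.WF (u : CircleDistribution) : Set (UnitAddCircle × ℝ) :=
  {p | p.2 ≠ 0 ∧ ¬ ∃ (χ : SmoothFun)
    (hχ : tsupport (χ : UnitAddCircle → ℂ) ⊆ Metric.ball p.1 (1 / 2)),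
    (χ : UnitAddCircle → ℂ) p.1 ≠ 0 ∧
    ∀ N : ℕ, ∃ C : ℝ, ∀ η : ℝ, 0 < η * p.2 →
      (1 + |η|) ^ N * ‖u.toLin (localExp χ p.1 hχ η)‖ ≤ C}

/-- The positive part `N^*_+ S` of the conormal bundle of a discrete set `S` of the circle. -/
def conormalPos (S : Set UnitAddCircle) : Set (UnitAddCircle × ℝ) := {p | p.1 ∈ S ∧ 0 < p.2}

/-- The negative part `N^*_- S` of the conormal bundle of a discrete set `S` of the circle. -/
def conormalNeg (S : Set UnitAddCircle) : Set (UnitAddCircle × ℝ) := {p | p.1 ∈ S ∧ p.2 < 0}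

end CircleDynamics

end

open scoped ContDiff Topology

noncomputable section

namespace CircleDynamics

/-! ### Lifts of circle diffeomorphisms to the line -/

/-! Some iterate `c` of the diffeomorphism has a fixed point. A lift with a fixed point is an
increasing map of the line with trapped orbits, so every orbit of `c` converges to a fixed point
(`exists_tendsto_iterate`) and every periodic point is fixed (`fixed_of_periodic`). Multipliers
become powers of themselves, so it suffices to treat hyperbolic fixed points of `c`
(`isConstant_of_fixed`).

Square integrability. Off the fixed points the wavefront set is empty. At an attracting fixed point
of multiplier `λ`, invariance expands `⟨u, χ φ⟩` as the sum over `n` of `⟨u, ψ (φ ∘ cⁿ) (cⁿ)'⟩`,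
where `ψ = χ - χ ∘ c⁻¹` is supported away from the fixed points. On the support of `ψ` the densities
have `L²` norm `O(λ^(n/2) ‖φ‖)`, so the series is bounded by a geometric one
(`sqIntegrableNear_of_attracting`); at a repelling point `c⁻¹` is used. Hence `u` is a function `f`
in `L²` with `f ∘ c = f`.

Flux. The form `∫ conj w dv` is invariant under changes of variables, and in Fourier coefficients it
has the multiplier `k = sign(k) |k|`. Since `f` is only in `L²`, `|k|` is replaced by `(1 - r^|k|) /
(1 - r)`, which up to a constant is the difference form with kernel `1 / (sin² π(X - Y) + δ)`, where
`δ = (1 - r)² / (4 r)`. Pulling this kernel back by `c` changes it by a kernel bounded uniformly in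
`δ` and by `resKernel`, which is `1 - c'(X) c'(Y)` times a positive kernel concentrating on the
diagonal. The commutator of composition with the sign of the frequency is smoothing, by
nonstationary phase. A uniform bound together with convergence on characters then shows that, for
invariant `f`, the form of `resKernel` between `f` and the pullback of its Hilbert transform tends
to `0` (`tendsto_form_of_invariant`).

Positivity. Let `p` and `q` be the pullbacks by `c` of the parts of `f` of frequencies `≥ 0` and `<
0`, so that `p + q = f`. The real part of that form is the integral of `resKernel` against `|p(X) -
p(Y)|² - |q(X) - q(Y)|²`. The wavefront condition makes `p` Lipschitz off the attracting points and
`q` Lipschitz off the repelling ones, and Lipschitz functions contribute nothing in the limit. Near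
attracting points `1 - c'(X) c'(Y)` is positive and only `p` is rough; near repelling points both
signs are reversed. All surviving terms are therefore nonnegative, and each of them tends to `0`
(`tendsto_concentration`). This is where the signs in the wavefront hypothesis matter.

Rescaling. Pulling back by `cⁿ`, or by `c⁻ⁿ` at repelling points, turns the concentration of `f` at
scale `λⁿ` into the integral of `|f(X) - f(Y)|²` over a fixed neighborhood of the fixed point. So
this integral vanishes and `f` is constant near each fixed point
(`exists_ae_const_of_concentration`). Orbits carry this to all points, and the circle is connected.
-/

lemma exists_int_of_coe_eq_zero {h : ℝ → ℝ} (hc : Continuous h)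
    (h0 : ∀ t, ((h t : ℝ) : UnitAddCircle) = 0) : ∃ m : ℤ, ∀ t, h t = m := by
  have h1 : ∀ t, ∃ m : ℤ, (m : ℝ) = h t := fun t => by
    obtain ⟨n, hn⟩ := (AddCircle.coe_eq_zero_iff (1 : ℝ)).1 (h0 t)
    exact ⟨n, by simpa using hn⟩
  choose m hm using h1
  have hmc : Continuous m := by
    rw [Int.isClosedEmbedding_coe_real.isEmbedding.continuous_iff]
    exact hc.congr fun t => (hm t).symm
  refine ⟨m 0, fun t => ?_⟩
  rw [← hm t, PreconnectedSpace.constant inferInstance hmc (x := t) (y := 0)]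

/-- `F` and `G` are inverse diffeomorphisms of the line which cover `b` and its inverse. -/
structure IsLift (b : CircleDiffeo) (F G : ℝ → ℝ) : Prop where
  smooth : ContDiff ℝ ∞ F
  smooth_inv : ContDiff ℝ ∞ G
  left_inv : ∀ t, G (F t) = t
  right_inv : ∀ t, F (G t) = t
  add_one : ∀ t, F (t + 1) = F t + 1
  coe_eq : ∀ t : ℝ, ((F t : ℝ) : UnitAddCircle) = b.toEquiv t
  coe_inv_eq : ∀ t : ℝ, ((G t : ℝ) : UnitAddCircle) = b.toEquiv.symm t
  deriv_pos : ∀ t, 0 < deriv F t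

/-- A lift of an orientation preserving diffeomorphism is increasing, and `F (t + 1) - F t` is a
constant integer, the degree, which has to be `1`. Such an `F` is onto the line. -/
lemma exists_isLift (b : CircleDiffeo) : ∃ F G : ℝ → ℝ, IsLift b F G := by
  obtain ⟨F, hF, hFl⟩ := b.smooth_toFun
  obtain ⟨G₀, hG, hGl⟩ := b.smooth_invFun
  have hFl' : ∀ t : ℝ, ((F t : ℝ) : UnitAddCircle) = b.toEquiv t := hFl
  have hGl' : ∀ t : ℝ, ((G₀ t : ℝ) : UnitAddCircle) = b.toEquiv.symm t := hGl
  have hpos : ∀ t, 0 < deriv F t := fun t => by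
    rw [← circleDeriv_eq hFl hF.continuous.continuousAt]
    exact b.deriv_pos t
  have hmono : StrictMono F := strictMono_of_deriv_pos hpos
  obtain ⟨m, hm⟩ := exists_int_of_coe_eq_zero (h := fun t => F (t + 1) - F t)
    ((hF.continuous.comp (continuous_id.add continuous_const)).sub hF.continuous) (fun t => by
      rw [AddCircle.coe_sub, hFl', hFl', AddCircle.coe_add_period, sub_self])
  have hm1 : m = 1 := by
    have h0 : 0 < m := by
      have := hmono (show (0 : ℝ) < 0 + 1 by norm_num)
      have h2 := hm 0
      have : (0 : ℝ) < m := by linarith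
      exact_mod_cast this
    -- If the degree were at least `2`, the lift would take the value `F 0 + 1` strictly between `0`
    -- and `1`, against injectivity on the circle.
    by_contra hne
    have h2 : (2 : ℝ) ≤ m := by exact_mod_cast (by omega : 2 ≤ m)
    have h3 : F 0 + 1 ∈ Set.Ioo (F 0) (F 1) := by
      have := hm 0
      rw [zero_add] at this
      constructor <;> linarith
    obtain ⟨s, hs, hs'⟩ := intermediate_value_Ioo zero_le_one hF.continuous.continuousOn h3
    have h4 : b.toEquiv (s : UnitAddCircle) = b.toEquiv ((0 : ℝ) : UnitAddCircle) := by
      rw [← hFl', ← hFl', hs', AddCircle.coe_add_period]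
    have h5 := b.toEquiv.injective h4
    obtain ⟨n, hn⟩ := (AddCircle.coe_eq_zero_iff (1 : ℝ)).1 h5
    have hn' : (n : ℝ) = s := by simpa using hn
    have h6 : (0 : ℝ) < n := by rw [hn']; exact hs.1
    have h7 : (n : ℝ) < 1 := by rw [hn']; exact hs.2
    have h8 : 0 < n := by exact_mod_cast h6
    have h9 : n < 1 := by exact_mod_cast h7
    omega
  have hadd : ∀ t, F (t + 1) = F t + 1 := fun t => by
    have := hm t
    rw [hm1, Int.cast_one] at this
    linarith
  -- An arbitrary lift of the inverse differs from the inverse of `F` by a constant integer `k`,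
  -- which is subtracted below.
  obtain ⟨k, hk⟩ := exists_int_of_coe_eq_zero (h := fun t => G₀ (F t) - t)
    ((hG.continuous.comp hF.continuous).sub continuous_id) (fun t => by
      rw [AddCircle.coe_sub, hGl', hFl', Equiv.symm_apply_apply, sub_self])
  have hgrow : ∀ n : ℕ, F n = F 0 + n ∧ F (-n) = F 0 - n := by
    intro n
    induction n with
    | zero => simp
    | succ n ih =>
      refine ⟨by push_cast; rw [hadd, ih.1]; ring, ?_⟩
      have := hadd (-((n : ℝ) + 1))
      rw [show -((n : ℝ) + 1) + 1 = -n by ring, ih.2] at this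
      push_cast
      linarith
  have hsurj : Function.Surjective F := by
    intro y
    obtain ⟨n, hn⟩ := exists_nat_gt |y - F 0|
    have h1 := abs_lt.1 hn
    have h2 : y ∈ Set.Icc (F (-n)) (F n) := by
      rw [(hgrow n).1, (hgrow n).2]
      constructor <;> linarith [h1.1, h1.2]
    have h3 : (-(n : ℝ)) ≤ n := by linarith [(Nat.cast_nonneg n : (0 : ℝ) ≤ n)]
    obtain ⟨s, -, hs⟩ := intermediate_value_Icc h3 hF.continuous.continuousOn h2
    exact ⟨s, hs⟩
  have hleft : ∀ t, G₀ (F t) - k = t := fun t => by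
    have : G₀ (F t) - t = k := hk t
    linarith
  refine ⟨F, fun t => G₀ t - k, hF, hG.sub contDiff_const, hleft, fun t => ?_, hadd, hFl',
    fun t => ?_, hpos⟩
  · obtain ⟨s, rfl⟩ := hsurj t
    rw [hleft]
  · rw [AddCircle.coe_sub, hGl']
    have : ((k : ℝ) : UnitAddCircle) = 0 := (AddCircle.coe_eq_zero_iff (1 : ℝ)).2 ⟨k, by simp⟩
    rw [this, sub_zero]

namespace IsLift

variable {b : CircleDiffeo} {F G : ℝ → ℝ}

lemma strictMono (h : IsLift b F G) : StrictMono F := strictMono_of_deriv_pos h.deriv_pos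

lemma hasDerivAt (h : IsLift b F G) (t : ℝ) : HasDerivAt F (deriv F t) t :=
  (h.smooth.differentiable (by simp) t).hasDerivAt

lemma hasDerivAt_inv (h : IsLift b F G) (t : ℝ) : HasDerivAt G (deriv G t) t :=
  (h.smooth_inv.differentiable (by simp) t).hasDerivAt

lemma deriv_inv_mul (h : IsLift b F G) (t : ℝ) : deriv G (F t) * deriv F t = 1 := by
  have h1 := (h.hasDerivAt_inv (F t)).comp t (h.hasDerivAt t)
  rw [show G ∘ F = id from funext h.left_inv] at h1
  exact h1.unique (hasDerivAt_id t)

lemma deriv_inv_pos (h : IsLift b F G) (t : ℝ) : 0 < deriv G t := by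
  have h1 := h.deriv_inv_mul (G t)
  rw [h.right_inv] at h1
  have h2 := h.deriv_pos (G t)
  by_contra hc
  nlinarith [mul_nonneg (neg_nonneg.2 (not_lt.1 hc)) h2.le]

lemma inv_add_one (h : IsLift b F G) (t : ℝ) : G (t + 1) = G t + 1 := by
  apply h.strictMono.injective
  rw [h.right_inv, h.add_one, h.right_inv]

lemma circleDeriv_coe (h : IsLift b F G) (t : ℝ) :
    circleDeriv b.toEquiv (t : UnitAddCircle) = deriv F t :=
  circleDeriv_eq h.coe_eq h.smooth.continuous.continuousAt

lemma circleDeriv_symm_coe (h : IsLift b F G) (t : ℝ) :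
    circleDeriv b.toEquiv.symm (t : UnitAddCircle) = deriv G t :=
  circleDeriv_eq h.coe_inv_eq h.smooth_inv.continuous.continuousAt

lemma contDiff_deriv (h : IsLift b F G) : ContDiff ℝ ∞ (deriv F) :=
  (contDiff_infty_iff_deriv.1 h.smooth).2

lemma deriv_periodic (h : IsLift b F G) : Function.Periodic (deriv F) 1 := fun t => by
  rw [← h.circleDeriv_coe, ← h.circleDeriv_coe, AddCircle.coe_add_period]

lemma add_int (h : IsLift b F G) (t : ℝ) (n : ℤ) : F (t + n) = F t + n := by
  have hp : Function.Periodic (fun t => F t - t) 1 := fun t => by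
    simp only [h.add_one]
    ring
  have := hp.int_mul n t
  simp only [mul_one] at this
  linarith

end IsLift

/-! ### Topology of the circle and composition of diffeomorphisms -/

lemma continuous_coe : Continuous fun t : ℝ => (t : UnitAddCircle) := AddCircle.continuous_mk' 1

lemma exists_coe (x : UnitAddCircle) : ∃ t : ℝ, (t : UnitAddCircle) = x := ⟨coord x, coe_coord x⟩

lemma continuous_of_comp_coe {X : Type*} [TopologicalSpace X] {f : UnitAddCircle → X}
    (h : Continuous fun t : ℝ => f (t : UnitAddCircle)) : Continuous f :=
  (QuotientAddGroup.isQuotientMap_mk (N := AddSubgroup.zmultiples (1 : ℝ))).continuous_iff.2 h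

namespace CircleDiffeo

/-- The inverse diffeomorphism. -/
def symm (b : CircleDiffeo) : CircleDiffeo where
  toEquiv := b.toEquiv.symm
  smooth_toFun := b.smooth_invFun
  smooth_invFun := b.smooth_toFun
  deriv_pos := fun x => by
    obtain ⟨F, G, h⟩ := exists_isLift b
    obtain ⟨t, rfl⟩ := exists_coe x
    exact (h.circleDeriv_symm_coe t).symm ▸ h.deriv_inv_pos t

/-- Composition of diffeomorphisms. -/
def trans (b c : CircleDiffeo) : CircleDiffeo where
  toEquiv := b.toEquiv.trans c.toEquiv
  smooth_toFun := by
    obtain ⟨F, G, h⟩ := exists_isLift b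
    obtain ⟨F', G', h'⟩ := exists_isLift c
    exact ⟨F' ∘ F, h'.smooth.comp h.smooth, fun t => by simp [h'.coe_eq, h.coe_eq]⟩
  smooth_invFun := by
    obtain ⟨F, G, h⟩ := exists_isLift b
    obtain ⟨F', G', h'⟩ := exists_isLift c
    exact ⟨G ∘ G', h.smooth_inv.comp h'.smooth_inv, fun t => by simp [h'.coe_inv_eq, h.coe_inv_eq]⟩
  deriv_pos := fun x => by
    obtain ⟨F, G, h⟩ := exists_isLift b
    obtain ⟨F', G', h'⟩ := exists_isLift c
    obtain ⟨t, rfl⟩ := exists_coe x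
    rw [circleDeriv_eq (F := F' ∘ F) (fun t => by simp [h'.coe_eq, h.coe_eq])
      (h'.smooth.comp h.smooth).continuous.continuousAt,
      ((h'.hasDerivAt (F t)).comp t (h.hasDerivAt t)).deriv]
    exact mul_pos (h'.deriv_pos _) (h.deriv_pos _)

/-- The identity diffeomorphism. -/
def refl : CircleDiffeo where
  toEquiv := Equiv.refl _
  smooth_toFun := ⟨id, contDiff_id, fun _ => rfl⟩
  smooth_invFun := ⟨id, contDiff_id, fun _ => rfl⟩
  deriv_pos := fun x => by
    obtain ⟨t, rfl⟩ := exists_coe x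
    rw [circleDeriv_eq (F := id) (fun t => rfl) continuous_id.continuousAt]
    simp

/-- The iterates of a diffeomorphism. -/
def iter (b : CircleDiffeo) : ℕ → CircleDiffeo
  | 0 => refl
  | n + 1 => b.trans (b.iter n)

lemma iter_apply (b : CircleDiffeo) (n : ℕ) (x : UnitAddCircle) :
    (b.iter n).toEquiv x = b.toEquiv^[n] x := by
  induction n generalizing x with
  | zero => rfl
  | succ n ih => exact ih _

lemma continuous (b : CircleDiffeo) : Continuous b.toEquiv := by
  obtain ⟨F, G, h⟩ := exists_isLift b
  apply continuous_of_comp_coe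
  simp only [← h.coe_eq]
  exact continuous_coe.comp h.smooth.continuous

lemma continuous_circleDeriv (b : CircleDiffeo) : Continuous (circleDeriv b.toEquiv) := by
  obtain ⟨F, G, h⟩ := exists_isLift b
  apply continuous_of_comp_coe
  simp only [h.circleDeriv_coe]
  exact h.contDiff_deriv.continuous

end CircleDiffeo

lemma IsLift.symm {b : CircleDiffeo} {F G : ℝ → ℝ} (h : IsLift b F G) : IsLift b.symm G F :=
  ⟨h.smooth_inv, h.smooth, h.right_inv, h.left_inv, h.inv_add_one, h.coe_inv_eq, h.coe_eq,
    h.deriv_inv_pos⟩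

lemma IsLift.add_const {b : CircleDiffeo} {F G : ℝ → ℝ} (h : IsLift b F G) (n : ℤ) :
    IsLift b (fun t => F t + n) (fun t => G (t - n)) := by
  have hn : ((n : ℝ) : UnitAddCircle) = 0 := (AddCircle.coe_eq_zero_iff (1 : ℝ)).2 ⟨n, by simp⟩
  refine ⟨h.smooth.add contDiff_const, h.smooth_inv.comp (contDiff_id.sub contDiff_const),
    fun t => by simp [h.left_inv], fun t => by simp [h.right_inv], fun t => ?_, fun t => ?_,
    fun t => ?_, fun t => ?_⟩
  · rw [h.add_one]; ring
  · rw [AddCircle.coe_add, hn, add_zero, h.coe_eq]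
  · rw [h.coe_inv_eq, AddCircle.coe_sub, hn, sub_zero]
  · rw [deriv_add_const]; exact h.deriv_pos t

lemma exists_isLift_fixed (b : CircleDiffeo) {x : ℝ}
    (hx : b.toEquiv (x : UnitAddCircle) = (x : UnitAddCircle)) :
    ∃ F G : ℝ → ℝ, IsLift b F G ∧ F x = x := by
  obtain ⟨F, G, h⟩ := exists_isLift b
  have h1 : ((F x - x : ℝ) : UnitAddCircle) = 0 := by
    rw [AddCircle.coe_sub, h.coe_eq, hx, sub_self]
  obtain ⟨n, hn⟩ := (AddCircle.coe_eq_zero_iff (1 : ℝ)).1 h1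
  refine ⟨_, _, h.add_const (-n), ?_⟩
  have : (n : ℝ) = F x - x := by simpa using hn
  push_cast
  linarith

/-! ### Change of variables and composition operators -/

open MeasureTheory

/-- The invariant probability measure of the circle. -/
abbrev mu : Measure UnitAddCircle := AddCircle.haarAddCircle

/-- Square integrable functions on the circle. -/
abbrev L2 := Lp ℂ 2 mu

lemma CircleDiffeo.circleDeriv_pos (b : CircleDiffeo) (x : UnitAddCircle) :
    0 < circleDeriv b.toEquiv x := b.deriv_pos x

lemma volume_eq_mu : (volume : Measure UnitAddCircle) = mu := by
  rw [AddCircle.volume_eq_smul_haarAddCircle, ENNReal.ofReal_one, one_smul]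

lemma integral_mu {E : Type*} [NormedAddCommGroup E] [NormedSpace ℝ E] (f : UnitAddCircle → E) :
    ∫ x, f x ∂mu = ∫ t in (0 : ℝ)..1, f (t : UnitAddCircle) := by
  rw [← volume_eq_mu, ← UnitAddCircle.intervalIntegral_preimage 0 f, zero_add]

lemma exists_circleDeriv_bounds (b : CircleDiffeo) :
    ∃ c C : ℝ, 0 < c ∧ ∀ x, c ≤ circleDeriv b.toEquiv x ∧ circleDeriv b.toEquiv x ≤ C := by
  obtain ⟨x, -, hx⟩ := isCompact_univ.exists_isMinOn Set.univ_nonempty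
    b.continuous_circleDeriv.continuousOn
  obtain ⟨y, -, hy⟩ := isCompact_univ.exists_isMaxOn Set.univ_nonempty
    b.continuous_circleDeriv.continuousOn
  exact ⟨_, _, b.deriv_pos x, fun z => ⟨hx (Set.mem_univ z), hy (Set.mem_univ z)⟩⟩

/-- The measure `b' dθ`. -/
def jacobianMeasure (b : CircleDiffeo) : Measure UnitAddCircle :=
  mu.withDensity fun x => ENNReal.ofReal (circleDeriv b.toEquiv x)

lemma measurable_jacobian (b : CircleDiffeo) :
    Measurable fun x => ENNReal.ofReal (circleDeriv b.toEquiv x) :=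
  (b.continuous_circleDeriv.measurable).ennreal_ofReal

lemma integral_jacobianMeasure {E : Type*} [NormedAddCommGroup E] [NormedSpace ℝ E]
    (b : CircleDiffeo) (f : UnitAddCircle → E) :
    ∫ x, f x ∂(jacobianMeasure b) = ∫ x, circleDeriv b.toEquiv x • f x ∂mu := by
  unfold jacobianMeasure
  rw [integral_withDensity_eq_integral_toReal_smul (measurable_jacobian b)
    (Filter.Eventually.of_forall fun _ => ENNReal.ofReal_lt_top)]
  exact integral_congr_ae (Filter.Eventually.of_forall fun x => by
    simp only [ENNReal.toReal_ofReal (b.circleDeriv_pos x).le])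

instance (b : CircleDiffeo) : IsFiniteMeasure (jacobianMeasure b) := by
  obtain ⟨c, C, -, h⟩ := exists_circleDeriv_bounds b
  refine isFiniteMeasure_withDensity (ne_of_lt (lt_of_le_of_lt
    (lintegral_mono (g := fun _ => ENNReal.ofReal C) fun x => ENNReal.ofReal_le_ofReal (h x).2) ?_))
  simp

lemma integral_comp_mul_deriv_circle {E : Type*} [NormedAddCommGroup E] [NormedSpace ℝ E]
    (b : CircleDiffeo) {f : UnitAddCircle → E} (hf : Continuous f) :
    ∫ x, circleDeriv b.toEquiv x • f (b.toEquiv x) ∂mu = ∫ x, f x ∂mu := by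
  obtain ⟨F, G, h⟩ := exists_isLift b
  have h1 := intervalIntegral.integral_deriv_smul_comp (a := 0) (b := 1)
    (g := fun t : ℝ => f (t : UnitAddCircle)) (fun x _ => h.hasDerivAt x)
    h.contDiff_deriv.continuous.continuousOn (hf.comp continuous_coe)
  have hp : Function.Periodic (fun t : ℝ => f (t : UnitAddCircle)) 1 := fun t => by
    simp only [AddCircle.coe_add_period]
  rw [integral_mu, integral_mu]
  simp only [h.circleDeriv_coe, ← h.coe_eq]
  refine h1.trans ?_
  have h2 := h.add_one 0
  rw [zero_add] at h2
  rw [h2, hp.intervalIntegral_add_eq (F 0) 0, zero_add]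

/-- Finite measures on the circle are determined by the integrals of continuous functions, so the
classical change of variables is an identity of measures, and thus applies to all measurable
functions. -/
lemma map_jacobianMeasure (b : CircleDiffeo) : (jacobianMeasure b).map b.toEquiv = mu := by
  apply ext_of_forall_integral_eq_of_IsFiniteMeasure
  intro f
  rw [integral_map b.continuous.measurable.aemeasurable f.continuous.aestronglyMeasurable,
    integral_jacobianMeasure]
  exact integral_comp_mul_deriv_circle b f.continuous

/-- If `c` is a lower bound of `b'`, then `dθ ≤ c⁻¹ b' dθ`, and `b` pushes `b' dθ` to `dθ`. This
makes composition with `b` well defined and bounded on `L²`. -/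
lemma exists_map_le (b : CircleDiffeo) :
    ∃ c : NNReal, Measure.map b.toEquiv mu ≤ c • mu := by
  obtain ⟨c, C, hc, h⟩ := exists_circleDeriv_bounds b
  have h1 : mu ≤ ENNReal.ofReal c⁻¹ • jacobianMeasure b := by
    unfold jacobianMeasure
    rw [← withDensity_smul _ (measurable_jacobian b)]
    conv_lhs => rw [← withDensity_one (μ := mu)]
    apply withDensity_mono
    refine Filter.Eventually.of_forall fun x => ?_
    simp only [Pi.one_apply, Pi.smul_apply, smul_eq_mul]
    rw [← ENNReal.ofReal_mul (by positivity), ← ENNReal.ofReal_one]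
    apply ENNReal.ofReal_le_ofReal
    rw [inv_mul_eq_div, one_le_div hc]
    exact (h x).1
  refine ⟨(c⁻¹).toNNReal, ?_⟩
  calc Measure.map b.toEquiv mu
      ≤ Measure.map b.toEquiv (ENNReal.ofReal c⁻¹ • jacobianMeasure b) :=
        Measure.map_mono h1 b.continuous.measurable
    _ = ENNReal.ofReal c⁻¹ • mu := by rw [Measure.map_smul, map_jacobianMeasure]
    _ = _ := rfl

lemma quasiMeasurePreserving (b : CircleDiffeo) :
    Measure.QuasiMeasurePreserving b.toEquiv mu mu := by
  obtain ⟨c, hc⟩ := exists_map_le b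
  exact ⟨b.continuous.measurable,
    (Measure.absolutelyContinuous_of_le hc).trans (Measure.smul_absolutelyContinuous)⟩

lemma exists_eLpNorm_comp_le (b : CircleDiffeo) : ∃ C : NNReal, ∀ f : UnitAddCircle → ℂ,
    AEStronglyMeasurable f mu → eLpNorm (f ∘ b.toEquiv) 2 mu ≤ C * eLpNorm f 2 mu := by
  obtain ⟨c, hc⟩ := exists_map_le b
  refine ⟨c ^ (1 / 2 : ℝ), fun f hf => ?_⟩
  have hf' : AEStronglyMeasurable f (Measure.map b.toEquiv mu) :=
    hf.mono_ac (quasiMeasurePreserving b).absolutelyContinuous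
  rw [← eLpNorm_map_measure hf' b.continuous.measurable.aemeasurable]
  refine (eLpNorm_mono_measure f hc).trans ?_
  have h := eLpNorm_smul_measure_of_ne_top (μ := mu) (p := 2) (by simp) f (c : ENNReal)
  have h2 : (c • mu : Measure UnitAddCircle) = (c : ENNReal) • mu := rfl
  rw [h2, h, smul_eq_mul, ENNReal.coe_rpow_of_nonneg _ (by norm_num)]
  simp

lemma memLp_comp (b : CircleDiffeo) {f : UnitAddCircle → ℂ} (hf : MemLp f 2 mu) :
    MemLp (f ∘ b.toEquiv) 2 mu := by
  obtain ⟨C, hC⟩ := exists_eLpNorm_comp_le b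
  refine ⟨hf.1.comp_quasiMeasurePreserving (quasiMeasurePreserving b), ?_⟩
  exact (hC f hf.1).trans_lt (ENNReal.mul_lt_top ENNReal.coe_lt_top hf.2)

/-- Composition with `b` of a square integrable function. -/
def compFun (b : CircleDiffeo) (f : L2) : L2 := (memLp_comp b (Lp.memLp f)).toLp _

lemma coeFn_compFun (b : CircleDiffeo) (f : L2) : compFun b f =ᵐ[mu] f ∘ b.toEquiv :=
  MemLp.coeFn_toLp _

lemma compFun_add (b : CircleDiffeo) (f g : L2) :
    compFun b (f + g) = compFun b f + compFun b g := by
  apply Lp.ext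
  filter_upwards [coeFn_compFun b (f + g), coeFn_compFun b f, coeFn_compFun b g,
    Lp.coeFn_add (compFun b f) (compFun b g),
    (quasiMeasurePreserving b).ae_eq_comp (Lp.coeFn_add f g)] with x h1 h2 h3 h4 h5
  rw [h1, h4, Pi.add_apply, h2, h3, h5]
  rfl

lemma compFun_smul (b : CircleDiffeo) (c : ℂ) (f : L2) :
    compFun b (c • f) = c • compFun b f := by
  apply Lp.ext
  filter_upwards [coeFn_compFun b (c • f), coeFn_compFun b f,
    Lp.coeFn_smul c (compFun b f),
    (quasiMeasurePreserving b).ae_eq_comp (Lp.coeFn_smul c f)] with x h1 h2 h4 h5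
  rw [h1, h4, Pi.smul_apply, h2, h5]
  rfl

lemma exists_norm_compFun_le (b : CircleDiffeo) : ∃ C : ℝ, ∀ f, ‖compFun b f‖ ≤ C * ‖f‖ := by
  obtain ⟨C, hC⟩ := exists_eLpNorm_comp_le b
  refine ⟨C, fun f => ?_⟩
  have h := ENNReal.toReal_mono (ENNReal.mul_ne_top ENNReal.coe_ne_top (Lp.eLpNorm_ne_top f))
    (hC f (Lp.aestronglyMeasurable f))
  rw [ENNReal.toReal_mul] at h
  rw [compFun, Lp.norm_toLp, Lp.norm_def]
  exact h

/-- Composition with `b` on square integrable functions. -/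
def compL2 (b : CircleDiffeo) : L2 →L[ℂ] L2 :=
  LinearMap.mkContinuousOfExistsBound
    { toFun := compFun b, map_add' := compFun_add b, map_smul' := compFun_smul b }
    (exists_norm_compFun_le b)

lemma coeFn_compL2 (b : CircleDiffeo) (f : L2) : compL2 b f =ᵐ[mu] f ∘ b.toEquiv :=
  coeFn_compFun b f

lemma integral_comp_mul_deriv_prod (b : CircleDiffeo)
    {f : UnitAddCircle × UnitAddCircle → ℂ} (hf : AEStronglyMeasurable f (mu.prod mu)) :
    ∫ z, (circleDeriv b.toEquiv z.1 * circleDeriv b.toEquiv z.2) •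
      f (b.toEquiv z.1, b.toEquiv z.2) ∂(mu.prod mu) = ∫ z, f z ∂(mu.prod mu) := by
  have hm := b.continuous.measurable
  have h1 : mu.prod mu = Measure.map (Prod.map b.toEquiv b.toEquiv)
      ((jacobianMeasure b).prod (jacobianMeasure b)) := by
    rw [← Measure.map_prod_map _ _ hm hm, map_jacobianMeasure]
  conv_rhs => rw [h1]
  rw [integral_map (hm.prodMap hm).aemeasurable (by rw [← h1]; exact hf)]
  unfold jacobianMeasure
  rw [prod_withDensity (measurable_jacobian b) (measurable_jacobian b),
    integral_withDensity_eq_integral_toReal_smul (by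
      exact ((measurable_jacobian b).comp measurable_fst).mul
        ((measurable_jacobian b).comp measurable_snd))
    (Filter.Eventually.of_forall fun _ => ENNReal.mul_lt_top ENNReal.ofReal_lt_top
      ENNReal.ofReal_lt_top)]
  refine integral_congr_ae (Filter.Eventually.of_forall fun z => ?_)
  simp only [ENNReal.toReal_mul, ENNReal.toReal_ofReal (b.circleDeriv_pos _).le, Prod.map]

/-! ### The Fourier basis and difference kernels -/

open scoped InnerProductSpace ComplexConjugate

/-- The character `θ ↦ exp (2 π i n θ)`. -/
def expo (n : ℤ) (x : UnitAddCircle) : ℂ := fourier n x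

lemma continuous_expo (n : ℤ) : Continuous (expo n) := (fourier n).continuous

lemma expo_coe (n : ℤ) (t : ℝ) :
    expo n (t : UnitAddCircle) = Complex.exp (2 * Real.pi * Complex.I * n * t) := by
  rw [expo, fourier_coe_apply, Complex.ofReal_one, div_one]

lemma expo_add_index (m n : ℤ) (x : UnitAddCircle) : expo (m + n) x = expo m x * expo n x :=
  fourier_add

lemma conj_expo (n : ℤ) (x : UnitAddCircle) : conj (expo n x) = expo (-n) x := fourier_neg.symm

lemma expo_zero_index (x : UnitAddCircle) : expo 0 x = 1 := fourier_zero

lemma norm_expo (n : ℤ) (x : UnitAddCircle) : ‖expo n x‖ = 1 := Circle.norm_coe _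

lemma expo_add (n : ℤ) (x y : UnitAddCircle) : expo n (x + y) = expo n x * expo n y := by
  simp only [expo, fourier_apply, smul_add, AddCircle.toCircle_add, Circle.coe_mul]

lemma expo_neg (n : ℤ) (x : UnitAddCircle) : expo n (-x) = conj (expo n x) := by
  rw [conj_expo]
  simp only [expo, fourier_apply, smul_neg, neg_smul]

lemma expo_mul_conj (n : ℤ) (x : UnitAddCircle) : expo n x * conj (expo n x) = 1 := by
  rw [conj_expo, ← expo_add_index, add_neg_cancel, expo_zero_index]

lemma expo_sub (n : ℤ) (x y : UnitAddCircle) : expo n (x - y) = expo n x * conj (expo n y) := by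
  rw [sub_eq_add_neg, expo_add, expo_neg]

/-- The Fourier basis. -/
def basis : HilbertBasis ℤ ℂ L2 := fourierBasis

lemma coeFn_basis (n : ℤ) : basis n =ᵐ[mu] expo n := by
  rw [basis, coe_fourierBasis]
  exact coeFn_fourierLp 2 n

lemma inner_basis (n : ℤ) (f : L2) : ⟪basis n, f⟫_ℂ = ∫ x, f x * conj (expo n x) ∂mu := by
  rw [L2.inner_def]
  apply integral_congr_ae
  filter_upwards [coeFn_basis n] with x hx
  rw [hx]
  rfl

lemma integral_expo (n : ℤ) : ∫ x, expo n x ∂mu = if n = 0 then 1 else 0 := by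
  have h := orthonormal_iff_ite.1 basis.orthonormal 0 n
  rw [inner_basis] at h
  simp only [eq_comm (a := n), ← h]
  apply integral_congr_ae
  filter_upwards [coeFn_basis n] with x hx
  rw [hx, expo_zero_index]
  simp

/-- The difference `v(X) - v(Y)`. -/
def diff (v : UnitAddCircle → ℂ) (z : UnitAddCircle × UnitAddCircle) : ℂ := v z.1 - v z.2

/-- The sesquilinear form with kernel `k`. -/
def form (k : UnitAddCircle × UnitAddCircle → ℝ) (v w : UnitAddCircle → ℂ) : ℂ :=
  ∫ z, (k z : ℂ) * (diff v z * conj (diff w z)) ∂(mu.prod mu)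

lemma measurePreserving_fst' : MeasurePreserving Prod.fst (mu.prod mu) mu := measurePreserving_fst

lemma measurePreserving_snd' : MeasurePreserving Prod.snd (mu.prod mu) mu := measurePreserving_snd

lemma diff_congr {v w : UnitAddCircle → ℂ} (h : v =ᵐ[mu] w) : diff v =ᵐ[mu.prod mu] diff w := by
  filter_upwards [measurePreserving_fst'.quasiMeasurePreserving.ae_eq_comp h,
    measurePreserving_snd'.quasiMeasurePreserving.ae_eq_comp h] with z h1 h2
  simp only [Function.comp_apply] at h1 h2
  rw [diff, diff, h1, h2]

lemma form_congr {k : UnitAddCircle × UnitAddCircle → ℝ} {v w v' w' : UnitAddCircle → ℂ}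
    (h : v =ᵐ[mu] v') (h' : w =ᵐ[mu] w') : form k v w = form k v' w' := by
  apply integral_congr_ae
  filter_upwards [diff_congr h, diff_congr h'] with z h1 h2
  rw [h1, h2]

lemma form_swap (k : UnitAddCircle × UnitAddCircle → ℝ) (v w : UnitAddCircle → ℂ) :
    form k w v = conj (form k v w) := by
  rw [form, form, ← integral_conj]
  congr 1
  ext z
  simp only [map_mul, Complex.conj_conj, Complex.conj_ofReal]
  ring

/-- The difference operator. -/
def diffL2 : L2 →L[ℂ] Lp ℂ 2 (mu.prod mu) :=
  (Lp.compMeasurePreservingₗᵢ ℂ Prod.fst measurePreserving_fst').toContinuousLinearMap -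
    (Lp.compMeasurePreservingₗᵢ ℂ Prod.snd measurePreserving_snd').toContinuousLinearMap

lemma coeFn_diffL2 (v : L2) : diffL2 v =ᵐ[mu.prod mu] diff v := by
  have h1 := Lp.coeFn_compMeasurePreserving v measurePreserving_fst'
  have h2 := Lp.coeFn_compMeasurePreserving v measurePreserving_snd'
  have h3 := Lp.coeFn_sub (Lp.compMeasurePreserving Prod.fst measurePreserving_fst' v)
    (Lp.compMeasurePreserving Prod.snd measurePreserving_snd' v)
  filter_upwards [h1, h2, h3] with z e1 e2 e3
  refine e3.trans ?_
  rw [Pi.sub_apply, e1, e2]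
  rfl

lemma norm_diffL2_le (v : L2) : ‖diffL2 v‖ ≤ 2 * ‖v‖ := by
  have : diffL2 v = Lp.compMeasurePreserving Prod.fst measurePreserving_fst' v -
    Lp.compMeasurePreserving Prod.snd measurePreserving_snd' v := rfl
  rw [this, two_mul]
  refine (norm_sub_le _ _).trans ?_
  rw [Lp.norm_compMeasurePreserving, Lp.norm_compMeasurePreserving]

lemma exists_mulL2 {α : Type*} [MeasurableSpace α] {ν : Measure α} {k : α → ℂ}
    (hk : AEStronglyMeasurable k ν) {M : ℝ} (hM : ∀ z, ‖k z‖ ≤ M) :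
    ∃ T : Lp ℂ 2 ν →L[ℂ] Lp ℂ 2 ν, (∀ g, T g =ᵐ[ν] fun z => k z * g z) ∧
      ∀ g, ‖T g‖ ≤ M * ‖g‖ := by
  have hb : ∀ g : Lp ℂ 2 ν, ∀ᵐ z ∂ν, ‖k z * g z‖ ≤ M * ‖g z‖ := fun g =>
    Filter.Eventually.of_forall fun z => by
      rw [norm_mul]
      exact mul_le_mul_of_nonneg_right (hM z) (norm_nonneg _)
  have hmem : ∀ g : Lp ℂ 2 ν, MemLp (fun z => k z * g z) 2 ν := fun g =>
    MemLp.of_le_mul (Lp.memLp g) (hk.mul (Lp.aestronglyMeasurable g)) (hb g)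
  have hc : ∀ g, (hmem g).toLp _ =ᵐ[ν] fun z => k z * g z := fun g => MemLp.coeFn_toLp _
  have hn : ∀ g, ‖(hmem g).toLp _‖ ≤ M * ‖g‖ := fun g => by
    apply Lp.norm_le_mul_norm_of_ae_le_mul
    filter_upwards [hc g, hb g] with z h1 h2
    rw [h1]
    exact h2
  let T : Lp ℂ 2 ν →ₗ[ℂ] Lp ℂ 2 ν :=
    { toFun := fun g => (hmem g).toLp _
      map_add' := fun f g => by
        apply Lp.ext
        filter_upwards [hc (f + g), hc f, hc g, Lp.coeFn_add ((hmem f).toLp _) ((hmem g).toLp _),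
          Lp.coeFn_add f g] with z h1 h2 h3 h4 h5
        rw [h1, h4, Pi.add_apply, h2, h3, h5, Pi.add_apply, mul_add]
      map_smul' := fun c f => by
        apply Lp.ext
        filter_upwards [hc (c • f), hc f, Lp.coeFn_smul c ((hmem f).toLp _),
          Lp.coeFn_smul c f] with z h1 h2 h4 h5
        rw [h1, RingHom.id_apply, h4, Pi.smul_apply, h2, h5, Pi.smul_apply, smul_eq_mul,
          smul_eq_mul, mul_left_comm] }
  exact ⟨T.mkContinuous M hn, hc, hn⟩

/-- The operator is `D^* m D`, with `D` the difference operator, of norm at most `2`, and `m` the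
multiplication by the kernel; hence the constant `4 M`. -/
lemma exists_formL2 {k : UnitAddCircle × UnitAddCircle → ℝ} (hk : Measurable k) {M : ℝ}
    (hM : ∀ z, |k z| ≤ M) :
    ∃ T : L2 →L[ℂ] L2, (∀ v w : L2, ⟪w, T v⟫_ℂ = form k v w) ∧
      ∀ v w : L2, ‖⟪w, T v⟫_ℂ‖ ≤ 4 * M * ‖v‖ * ‖w‖ := by
  obtain ⟨S, hS, hS'⟩ := exists_mulL2 (ν := mu.prod mu) (k := fun z => (k z : ℂ)) (M := M)
    (Complex.measurable_ofReal.comp hk).aestronglyMeasurable (fun z => by simpa using hM z)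
  refine ⟨(ContinuousLinearMap.adjoint diffL2).comp (S.comp diffL2), fun v w => ?_, fun v w => ?_⟩
  · simp only [ContinuousLinearMap.comp_apply, ContinuousLinearMap.adjoint_inner_right]
    rw [L2.inner_def]
    apply integral_congr_ae
    filter_upwards [hS (diffL2 v), coeFn_diffL2 v, coeFn_diffL2 w] with z h1 h2 h3
    rw [h1, h2, h3, RCLike.inner_apply]
    ring
  · simp only [ContinuousLinearMap.comp_apply, ContinuousLinearMap.adjoint_inner_right]
    have hM0 : 0 ≤ M := (abs_nonneg _).trans (hM 0)
    calc ‖⟪diffL2 w, S (diffL2 v)⟫_ℂ‖ ≤ ‖diffL2 w‖ * ‖S (diffL2 v)‖ := norm_inner_le_norm _ _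
      _ ≤ (2 * ‖w‖) * (M * (2 * ‖v‖)) := by
        refine mul_le_mul (norm_diffL2_le w) ((hS' _).trans ?_) (norm_nonneg _) (by positivity)
        exact mul_le_mul_of_nonneg_left (norm_diffL2_le v) hM0
      _ = _ := by ring

lemma aestronglyMeasurable_diff (v : L2) : AEStronglyMeasurable (diff v) (mu.prod mu) :=
  (Lp.aestronglyMeasurable (diffL2 v)).congr (coeFn_diffL2 v)

lemma integrable_form {k : UnitAddCircle × UnitAddCircle → ℝ} (hk : Measurable k) {M : ℝ}
    (hM : ∀ z, |k z| ≤ M) (v w : L2) :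
    Integrable (fun z => (k z : ℂ) * (diff v z * conj (diff w z))) (mu.prod mu) := by
  have h : Integrable (fun z => diff v z * conj (diff w z)) (mu.prod mu) := by
    refine (L2.integrable_inner (𝕜 := ℂ) (diffL2 w) (diffL2 v)).congr ?_
    filter_upwards [coeFn_diffL2 v, coeFn_diffL2 w] with z h2 h3
    rw [h2, h3, RCLike.inner_apply]
  exact h.bdd_mul (c := M) (Complex.measurable_ofReal.comp hk).aestronglyMeasurable
    (Filter.Eventually.of_forall fun z => by simpa using hM z)

lemma form_compL2 (b : CircleDiffeo) {k : UnitAddCircle × UnitAddCircle → ℝ} (hk : Measurable k)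
    (v w : L2) :
    form (fun z => circleDeriv b.toEquiv z.1 * circleDeriv b.toEquiv z.2 *
      k (b.toEquiv z.1, b.toEquiv z.2)) (compL2 b v) (compL2 b w) = form k v w := by
  have h := integral_comp_mul_deriv_prod b
    (f := fun z => (k z : ℂ) * (diff v z * conj (diff w z)))
    ((Complex.measurable_ofReal.comp hk).aestronglyMeasurable.mul
      ((aestronglyMeasurable_diff v).mul
        (Complex.continuous_conj.comp_aestronglyMeasurable (aestronglyMeasurable_diff w))))
  refine Eq.trans ?_ h
  apply integral_congr_ae
  filter_upwards [diff_congr (coeFn_compL2 b v), diff_congr (coeFn_compL2 b w)] with z h1 h2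
  rw [h1, h2, Complex.real_smul]
  simp only [diff, Function.comp_apply]
  push_cast
  ring

lemma form_sub_kernel {k l : UnitAddCircle × UnitAddCircle → ℝ} (hk : Measurable k)
    (hl : Measurable l) {M : ℝ} (hM : ∀ z, |k z| ≤ M) {M' : ℝ} (hM' : ∀ z, |l z| ≤ M') (v w : L2) :
    form (fun z => k z - l z) v w = form k v w - form l v w := by
  rw [form, form, form, ← integral_sub (integrable_form hk hM v w) (integrable_form hl hM' v w)]
  congr 1
  ext z
  push_cast
  ring

/-! ### The regularized energy -/

/-- The function `sin² (π θ)`. -/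
def sinSq (x : UnitAddCircle) : ℝ := (1 - (expo 1 x).re) / 2

lemma continuous_sinSq : Continuous sinSq :=
  (continuous_const.sub (Complex.continuous_re.comp (continuous_expo 1))).div_const 2

lemma sinSq_coe (t : ℝ) : sinSq (t : UnitAddCircle) = Real.sin (Real.pi * t) ^ 2 := by
  rw [sinSq, expo_coe, Real.sin_sq_eq_half_sub]
  have : (2 * Real.pi * Complex.I * (1 : ℤ) * t : ℂ)
      = ((2 * (Real.pi * t) : ℝ) : ℂ) * Complex.I := by
    push_cast
    ring
  rw [this, Complex.exp_ofReal_mul_I_re]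
  ring

lemma sinSq_nonneg (x : UnitAddCircle) : 0 ≤ sinSq x := by
  obtain ⟨t, rfl⟩ := exists_coe x
  rw [sinSq_coe]
  positivity

/-- The regularization parameter `(1 - r)² / (4 r)`. -/
def regParam (r : ℝ) : ℝ := (1 - r) ^ 2 / (4 * r)

lemma regParam_pos {r : ℝ} (h0 : 0 < r) (h1 : r < 1) : 0 < regParam r :=
  div_pos (pow_pos (by linarith) 2) (by linarith)

/-- With `z = exp (2 π i x)` one has `4 r (sin² π x + (1 - r)² / (4 r)) = |1 - r z|²`. This explains
`regParam`: the kernel is a multiple of the Poisson kernel, a sum of two geometric series. -/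
lemma hasSum_poisson {r : ℝ} (h0 : 0 < r) (h1 : r < 1) (x : UnitAddCircle) :
    HasSum (fun n : ℤ => ((4 * r / (1 - r ^ 2) * r ^ n.natAbs : ℝ) : ℂ) * expo n x)
      ((1 / (sinSq x + regParam r) : ℝ) : ℂ) := by
  have hz : ∀ n : ℤ, expo n x = (expo 1 x) ^ n := by
    intro n
    obtain ⟨t, rfl⟩ := exists_coe x
    rw [expo_coe, expo_coe, ← Complex.exp_int_mul]
    congr 1
    push_cast
    ring
  set z := expo 1 x with hzdef
  have hzn : ‖z‖ = 1 := norm_expo 1 x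
  have hz0 : z ≠ 0 := by
    intro h
    rw [h, norm_zero] at hzn
    exact zero_ne_one hzn
  have hzc : z⁻¹ = conj z := by
    rw [hzdef]
    exact inv_eq_of_mul_eq_one_right (expo_mul_conj 1 x)
  have hn1 : ‖(r : ℂ) * z‖ < 1 := by
    rw [norm_mul, hzn, mul_one, Complex.norm_real, Real.norm_eq_abs, abs_of_pos h0]
    exact h1
  have hn2 : ‖(r : ℂ) * conj z‖ < 1 := by
    rw [norm_mul, RCLike.norm_conj, hzn, mul_one, Complex.norm_real, Real.norm_eq_abs,
      abs_of_pos h0]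
    exact h1
  have s1 := hasSum_geometric_of_norm_lt_one hn1
  have s2 := (hasSum_geometric_of_norm_lt_one hn2).mul_left ((r : ℂ) * conj z)
  have s3 : HasSum (fun n : ℤ => ((r ^ n.natAbs : ℝ) : ℂ) * expo n x)
      ((1 - r * z)⁻¹ + r * conj z * (1 - r * conj z)⁻¹) := by
    apply HasSum.of_nat_of_neg_add_one
    · refine s1.congr_fun ?_ |> id
      intro n
      rw [hz, Int.natAbs_natCast, zpow_natCast, mul_pow]
      push_cast
      rfl
    · refine s2.congr_fun ?_ |> id
      intro n
      rw [hz, show (-((n : ℤ) + 1)).natAbs = n + 1 by omega, zpow_neg, ← inv_zpow, hzc,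
        show ((n : ℤ) + 1) = ((n + 1 : ℕ) : ℤ) by push_cast; ring, zpow_natCast]
      push_cast
      ring
  have s4 := s3.mul_left ((4 * r / (1 - r ^ 2) : ℝ) : ℂ)
  have e1 : (1 - r * z) ≠ 0 := fun h => by
    rw [← sub_eq_zero.1 h, norm_one] at hn1
    exact lt_irrefl _ hn1
  have e2 : (1 - r * conj z) ≠ 0 := fun h => by
    rw [← sub_eq_zero.1 h, norm_one] at hn2
    exact lt_irrefl _ hn2
  have e3 : z * conj z = 1 := expo_mul_conj 1 x
  have e4 : (sinSq x : ℂ) = (2 - z - conj z) / 4 := by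
    have : (z + conj z) = ((2 * z.re : ℝ) : ℂ) := Complex.add_conj z
    have h5 : (2 - z - conj z) = 2 - (z + conj z) := by ring
    rw [h5, this, sinSq]
    push_cast
    ring
  have e5 : (1 - r * z) * (1 - r * conj z) = 4 * r * ((sinSq x : ℂ) + (regParam r : ℝ)) := by
    have hr : (r : ℂ) ≠ 0 := by exact_mod_cast h0.ne'
    rw [e4, regParam]
    push_cast
    field_simp
    linear_combination (r : ℂ) ^ 2 * e3
  have e6 : ((sinSq x : ℂ) + (regParam r : ℝ)) ≠ 0 := by
    have : 0 < sinSq x + regParam r := add_pos_of_nonneg_of_pos (sinSq_nonneg x) (regParam_pos h0 h1)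
    exact_mod_cast this.ne'
  have e7 : ((1 : ℂ) - r ^ 2) ≠ 0 := by
    have : 0 < 1 - r ^ 2 := by nlinarith
    exact_mod_cast this.ne'
  have e8 : ((1 - r * z)⁻¹ + r * conj z * (1 - r * conj z)⁻¹)
      = (1 - r ^ 2) / ((1 - r * z) * (1 - r * conj z)) := by
    field_simp
    linear_combination -(r : ℂ) ^ 2 * e3
  rw [e8, e5] at s4
  have hr : (r : ℂ) ≠ 0 := by exact_mod_cast h0.ne'
  have e9 : ((1 / (sinSq x + regParam r) : ℝ) : ℂ) = ((4 * r / (1 - r ^ 2) : ℝ) : ℂ) *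
      ((1 - r ^ 2) / (4 * r * ((sinSq x : ℂ) + (regParam r : ℝ)))) := by
    push_cast
    field_simp
  rw [e9]
  simpa only [Complex.ofReal_mul, mul_assoc] using s4

/-- The kernel `1 / (sin² π(X - Y) + δ²)`. -/
def regKernel (d : ℝ) (z : UnitAddCircle × UnitAddCircle) : ℝ := 1 / (sinSq (z.1 - z.2) + d)

lemma continuous_regKernel {d : ℝ} (hd : 0 < d) : Continuous (regKernel d) := by
  refine continuous_const.div ((continuous_sinSq.comp
    (continuous_fst.sub continuous_snd)).add continuous_const) fun z => ?_
  have := sinSq_nonneg (z.1 - z.2)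
  positivity

lemma abs_regKernel_le {d : ℝ} (hd : 0 < d) (z : UnitAddCircle × UnitAddCircle) :
    |regKernel d z| ≤ 1 / d := by
  have := sinSq_nonneg (z.1 - z.2)
  rw [regKernel, abs_of_nonneg (by positivity)]
  exact one_div_le_one_div_of_le hd (by linarith)

/-- The Fourier multiplier `(1 - r^|n|) / (1 - r)`. -/
def energyMult (r : ℝ) (n : ℤ) : ℝ := (1 - r ^ n.natAbs) / (1 - r)

lemma energyMult_nonneg {r : ℝ} (h0 : 0 < r) (h1 : r < 1) (n : ℤ) : 0 ≤ energyMult r n :=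
  div_nonneg (sub_nonneg.2 (pow_le_one₀ h0.le h1.le)) (by linarith)

lemma energyMult_le {r : ℝ} (h0 : 0 < r) (h1 : r < 1) (n : ℤ) : energyMult r n ≤ n.natAbs := by
  rw [energyMult, div_le_iff₀ (by linarith)]
  have := one_add_mul_le_pow (show (-2 : ℝ) ≤ r - 1 by linarith) n.natAbs
  rw [add_sub_cancel] at this
  linarith

lemma tendsto_energyMult (n : ℤ) :
    Filter.Tendsto (fun r => energyMult r n) (𝓝[<] 1) (𝓝 n.natAbs) := by
  have h : Filter.Tendsto (fun r : ℝ => ∑ i ∈ Finset.range n.natAbs, r ^ i) (𝓝[<] 1)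
      (𝓝 (∑ i ∈ Finset.range n.natAbs, (1 : ℝ) ^ i)) :=
    (Continuous.tendsto (by fun_prop) 1).mono_left nhdsWithin_le_nhds
  simp only [one_pow, Finset.sum_const, Finset.card_range, nsmul_eq_mul, mul_one] at h
  refine h.congr' ?_
  filter_upwards [self_mem_nhdsWithin] with r hr
  have hr' : 1 - r ≠ 0 := (sub_pos.2 hr).ne'
  rw [energyMult, eq_div_iff hr', geom_sum_mul_neg]

lemma integral_regKernel_mul_expo {r : ℝ} (h0 : 0 < r) (h1 : r < 1) (n : ℤ) :
    ∫ x, ((1 / (sinSq x + regParam r) : ℝ) : ℂ) * expo n x ∂mu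
      = ((4 * r / (1 - r ^ 2) * r ^ n.natAbs : ℝ) : ℂ) := by
  set c := 4 * r / (1 - r ^ 2) with hc
  have hc0 : 0 ≤ c := div_nonneg (by linarith) (by nlinarith)
  have hn : ∀ m : ℤ, ∀ x, ‖((c * r ^ m.natAbs : ℝ) : ℂ) * expo m x * expo n x‖
      = c * r ^ m.natAbs := fun m x => by
    rw [norm_mul, norm_mul, norm_expo, norm_expo, Complex.norm_real, Real.norm_eq_abs,
      abs_of_nonneg (by positivity)]
    ring
  have hsum : Summable fun m : ℤ => c * r ^ m.natAbs := by
    apply Summable.mul_left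
    apply Summable.of_nat_of_neg <;> simpa using summable_geometric_of_lt_one h0.le h1
  have h2 := hasSum_integral_of_summable_integral_norm (μ := mu)
    (F := fun (m : ℤ) x => ((c * r ^ m.natAbs : ℝ) : ℂ) * expo m x * expo n x)
    (fun m => (((continuous_const.mul (continuous_expo m)).mul
      (continuous_expo n)).integrable_of_hasCompactSupport
        (HasCompactSupport.of_compactSpace _)))
    (by simp only [hn, integral_const]; simpa using hsum)
  have h3 : ∀ m : ℤ, ∫ x, ((c * r ^ m.natAbs : ℝ) : ℂ) * expo m x * expo n x ∂mu
      = if m = -n then ((c * r ^ n.natAbs : ℝ) : ℂ) else 0 := by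
    intro m
    simp only [mul_assoc, ← expo_add_index]
    rw [integral_const_mul, integral_expo]
    by_cases hm : m = -n
    · subst hm
      simp
    · rw [if_neg (by omega), if_neg hm, mul_zero]
  simp only [h3] at h2
  have h4 := h2.unique (hasSum_ite_eq (-n) ((c * r ^ n.natAbs : ℝ) : ℂ))
  rw [← h4]
  congr 1
  ext x
  exact (((hasSum_poisson h0 h1 x).mul_right (expo n x)).tsum_eq).symm

/-- The kernel depends on `X - Y` only, so translating `X` by `Y` splits off the factor `∫ e_{i-j}`.
For `i = j`, the identity `|e_i - 1|² = 2 - e_i - e_{-i}` leaves twice the difference of the Poisson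
coefficients of index `0` and `i`. -/
lemma form_regKernel_expo {r : ℝ} (h0 : 0 < r) (h1 : r < 1) (i j : ℤ) :
    form (regKernel (regParam r)) (expo i) (expo j)
      = if i = j then ((8 * r / (1 + r) * energyMult r i : ℝ) : ℂ) else 0 := by
  have hd := regParam_pos h0 h1
  have hcont : Continuous fun z : UnitAddCircle × UnitAddCircle =>
      (regKernel (regParam r) z : ℂ) * (diff (expo i) z * conj (diff (expo j) z)) := by
    unfold diff
    have h1 := Complex.continuous_ofReal.comp (continuous_regKernel hd)
    have h2 := continuous_expo i
    have h3 := continuous_expo j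
    exact h1.mul (((h2.comp continuous_fst).sub (h2.comp continuous_snd)).mul
      (Complex.continuous_conj.comp ((h3.comp continuous_fst).sub (h3.comp continuous_snd))))
  have hint : Integrable (fun z : UnitAddCircle × UnitAddCircle =>
      (regKernel (regParam r) z : ℂ) * (diff (expo i) z * conj (diff (expo j) z))) (mu.prod mu) :=
    hcont.integrable_of_hasCompactSupport (HasCompactSupport.of_compactSpace _)
  rw [form, integral_prod_symm _ hint]
  have hk : ∀ n : ℤ, Continuous fun x =>
      ((1 / (sinSq x + regParam r) : ℝ) : ℂ) * expo n x := fun n => by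
    refine (Complex.continuous_ofReal.comp (continuous_const.div (continuous_sinSq.add
      continuous_const) fun x => ?_)).mul (continuous_expo n)
    exact (add_pos_of_nonneg_of_pos (sinSq_nonneg x) hd).ne'
  have hki : ∀ n : ℤ, Integrable (fun x =>
      ((1 / (sinSq x + regParam r) : ℝ) : ℂ) * expo n x) mu := fun n =>
    (hk n).integrable_of_hasCompactSupport (HasCompactSupport.of_compactSpace _)
  have hinner : ∀ y : UnitAddCircle, ∫ x, (regKernel (regParam r) (x, y) : ℂ) *
      (diff (expo i) (x, y) * conj (diff (expo j) (x, y))) ∂mu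
      = expo (i - j) y * ∫ x, ((1 / (sinSq x + regParam r) : ℝ) : ℂ) *
        ((expo i x - 1) * conj (expo j x - 1)) ∂mu := by
    intro y
    rw [← integral_const_mul, ← integral_add_right_eq_self _ y]
    congr 1
    ext x
    simp only [regKernel, diff, expo_add, add_sub_cancel_right, sub_eq_add_neg i j, expo_add_index,
      ← conj_expo, map_sub, map_mul, map_one]
    ring
  simp only [hinner]
  rw [integral_mul_const, integral_expo]
  by_cases hij : i = j
  · subst hij
    rw [sub_self, if_pos rfl, if_pos rfl, one_mul]
    have : ∀ x, ((1 / (sinSq x + regParam r) : ℝ) : ℂ) * ((expo i x - 1) * conj (expo i x - 1))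
        = 2 * (((1 / (sinSq x + regParam r) : ℝ) : ℂ) * expo 0 x)
          - ((1 / (sinSq x + regParam r) : ℝ) : ℂ) * expo i x
          - ((1 / (sinSq x + regParam r) : ℝ) : ℂ) * expo (-i) x := by
      intro x
      have h5 := expo_mul_conj i x
      rw [← conj_expo, expo_zero_index, map_sub, map_one]
      linear_combination ((1 / (sinSq x + regParam r) : ℝ) : ℂ) * h5
    simp only [this]
    have hA : Integrable (fun x => 2 * (((1 / (sinSq x + regParam r) : ℝ) : ℂ) * expo 0 x)
        - ((1 / (sinSq x + regParam r) : ℝ) : ℂ) * expo i x) mu :=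
      ((hki 0).const_mul 2).sub (hki i)
    rw [integral_sub hA (hki (-i)),
      integral_sub ((hki 0).const_mul 2) (hki i), integral_const_mul,
      integral_regKernel_mul_expo h0 h1, integral_regKernel_mul_expo h0 h1,
      integral_regKernel_mul_expo h0 h1]
    rw [energyMult]
    have e1 : (1 : ℝ) - r ^ 2 ≠ 0 := by nlinarith
    have e2 : (1 : ℝ) - r ≠ 0 := by linarith
    have e3 : (1 : ℝ) + r ≠ 0 := by linarith
    rw [Int.natAbs_neg, Int.natAbs_zero]
    norm_cast
    field_simp
    ring
  · rw [if_neg (sub_ne_zero.2 hij), if_neg hij, zero_mul]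

/-- The regularized energy operator, of Fourier multiplier `(1 - r^|n|) / (1 - r)`. -/
lemma exists_energyOp {r : ℝ} (h0 : 0 < r) (h1 : r < 1) :
    ∃ T : L2 →L[ℂ] L2, (∀ v w : L2, ⟪w, T v⟫_ℂ =
        (((1 + r) / (8 * r) : ℝ) : ℂ) * form (regKernel (regParam r)) v w) ∧
      ∀ (n : ℤ) (v : L2), ⟪basis n, T v⟫_ℂ = (energyMult r n : ℂ) * ⟪basis n, v⟫_ℂ := by
  have hd := regParam_pos h0 h1
  obtain ⟨S, hS, -⟩ := exists_formL2 (continuous_regKernel hd).measurable (abs_regKernel_le hd)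
  refine ⟨(((1 + r) / (8 * r) : ℝ) : ℂ) • S, fun v w => ?_, fun n v => ?_⟩
  · rw [_root_.smul_apply, inner_smul_right, hS]
  · rw [_root_.smul_apply, inner_smul_right]
    have h2 : S (basis n) = ((8 * r / (1 + r) * energyMult r n : ℝ) : ℂ) • basis n := by
      refine basis.repr.injective (lp.ext (funext fun m => ?_))
      rw [map_smul]
      simp only [lp.coeFn_smul, Pi.smul_apply, HilbertBasis.repr_apply_apply]
      rw [hS, form_congr (coeFn_basis n) (coeFn_basis m), form_regKernel_expo h0 h1,
        orthonormal_iff_ite.1 basis.orthonormal m n]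
      by_cases h : n = m
      · subst h; simp
      · rw [if_neg h, if_neg (Ne.symm h), smul_zero]
    rw [hS, form_swap, ← hS, h2, inner_smul_right, map_mul, Complex.conj_ofReal, inner_conj_symm,
      ← mul_assoc]
    congr 1
    norm_cast
    have e3 : (1 : ℝ) + r ≠ 0 := by linarith
    field_simp

/-! ### Comparison of the kernel with its pullback -/

/-- Jordan's inequality `sin (π t) ≥ 2 t` on `[0, 1/2]`. With `sinSq_le_norm_sq` it makes `sinSq` a
smooth substitute for the squared distance. -/
lemma four_mul_norm_sq_le_sinSq (x : UnitAddCircle) : 4 * ‖x‖ ^ 2 ≤ sinSq x := by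
  have h1 : |coord x| ≤ 1 / 2 := by
    rw [abs_coord]
    simpa using AddCircle.norm_le_half_period (1 : ℝ) one_ne_zero (x := x)
  rw [← abs_coord]
  conv_rhs => rw [← coe_coord x]
  rw [sinSq_coe]
  have h2 := Real.mul_le_sin (x := Real.pi * |coord x|) (by positivity)
    (by nlinarith [Real.pi_pos])
  have h3 : 2 / Real.pi * (Real.pi * |coord x|) = 2 * |coord x| := by
    field_simp
  rw [h3] at h2
  have h4 : Real.sin (Real.pi * coord x) ^ 2 = Real.sin (Real.pi * |coord x|) ^ 2 := by
    rcases abs_choice (coord x) with h | h <;> rw [h]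
    rw [mul_neg, Real.sin_neg, neg_sq]
  rw [h4]
  calc 4 * |coord x| ^ 2 = (2 * |coord x|) ^ 2 := by ring
    _ ≤ _ := pow_le_pow_left₀ (by positivity) h2 2

lemma sinSq_le_norm_sq (x : UnitAddCircle) : sinSq x ≤ Real.pi ^ 2 * ‖x‖ ^ 2 := by
  rw [← abs_coord, sq_abs]
  conv_lhs => rw [← coe_coord x]
  rw [sinSq_coe, ← mul_pow]
  exact Real.sin_sq_le_sq

lemma abs_sub_le_of_abs_deriv_le {f : ℝ → ℝ} (hf : Differentiable ℝ f) {t h K : ℝ}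
    (hK : ∀ x, |x - t| ≤ |h| → |deriv f x| ≤ K) : |f (t + h) - f t| ≤ K * |h| := by
  have h1 := Convex.norm_image_sub_le_of_norm_deriv_le (𝕜 := ℝ) (f := f) (C := K)
    (s := Metric.closedBall t |h|) (fun x _ => hf x)
    (fun x hx => hK x (by simpa [Real.dist_eq] using hx)) (convex_closedBall t |h|)
    (x := t) (y := t + h) (Metric.mem_closedBall_self (abs_nonneg h)) (by simp)
  simpa using h1

lemma exists_abs_le_of_periodic {f : ℝ → ℝ} (hp : Function.Periodic f 1) (hf : Continuous f) :
    ∃ C, 0 ≤ C ∧ ∀ x, |f x| ≤ C := by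
  obtain ⟨C, hC⟩ := (hp.isBounded_of_continuous one_ne_zero hf).exists_norm_le
  exact ⟨C, (norm_nonneg _).trans (hC (f 0) ⟨0, rfl⟩), fun x => hC (f x) ⟨x, rfl⟩⟩

lemma periodic_deriv {f : ℝ → ℝ} (hp : Function.Periodic f 1) : Function.Periodic (deriv f) 1 := by
  intro x
  rw [← deriv_comp_add_const, show (fun y => f (y + 1)) = f from funext hp]

/-! ### Expansion of the squared distance under a diffeomorphism -/

lemma exists_norm_sub_le (b : CircleDiffeo) :
    ∃ C : ℝ, 0 < C ∧ ∀ x y, ‖b.toEquiv x - b.toEquiv y‖ ≤ C * ‖x - y‖ := by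
  obtain ⟨F, G, h⟩ := exists_isLift b
  obtain ⟨C, hC0, hC⟩ := exists_abs_le_of_periodic h.deriv_periodic h.contDiff_deriv.continuous
  refine ⟨C + 1, by positivity, fun x y => ?_⟩
  obtain ⟨t, rfl⟩ := exists_coe y
  have hx : x = ((t + coord (x - t) : ℝ) : UnitAddCircle) := by
    rw [AddCircle.coe_add, coe_coord]
    abel
  rw [← abs_coord (x - t)]
  set k := coord (x - t)
  rw [hx, ← h.coe_eq, ← h.coe_eq, ← AddCircle.coe_sub]
  have h2 := abs_sub_le_of_abs_deriv_le (h.smooth.differentiable (by simp)) (t := t) (h := k)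
    (K := C) (fun x _ => hC x)
  have h3 : ‖((F (t + k) - F t : ℝ) : UnitAddCircle)‖ ≤ |F (t + k) - F t| := by
    rw [AddCircle.norm_eq]
    simp only [inv_one, one_mul, mul_one]
    have := round_le (F (t + k) - F t) 0
    simpa using this
  nlinarith [abs_nonneg k]

lemma exists_sinSq_comp_le (b : CircleDiffeo) :
    ∃ C : ℝ, 0 < C ∧ ∀ x y, sinSq (b.toEquiv x - b.toEquiv y) ≤ C * sinSq (x - y) := by
  obtain ⟨C, hC0, hC⟩ := exists_norm_sub_le b
  refine ⟨Real.pi ^ 2 * C ^ 2, by positivity, fun x y => ?_⟩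
  have h1 := sinSq_le_norm_sq (b.toEquiv x - b.toEquiv y)
  have h2 := four_mul_norm_sq_le_sinSq (x - y)
  have h3 := pow_le_pow_left₀ (norm_nonneg _) (hC x y) 2
  calc _ ≤ Real.pi ^ 2 * ‖b.toEquiv x - b.toEquiv y‖ ^ 2 := h1
    _ ≤ Real.pi ^ 2 * (C * ‖x - y‖) ^ 2 := by gcongr
    _ = Real.pi ^ 2 * C ^ 2 * ‖x - y‖ ^ 2 := by ring
    _ ≤ Real.pi ^ 2 * C ^ 2 * sinSq (x - y) := by
      gcongr
      nlinarith [sq_nonneg ‖x - y‖]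

lemma exists_le_sinSq_comp (b : CircleDiffeo) :
    ∃ C : ℝ, 0 < C ∧ ∀ x y, sinSq (x - y) ≤ C * sinSq (b.toEquiv x - b.toEquiv y) := by
  obtain ⟨C, hC0, hC⟩ := exists_sinSq_comp_le b.symm
  refine ⟨C, hC0, fun x y => ?_⟩
  have := hC (b.toEquiv x) (b.toEquiv y)
  rwa [show b.symm.toEquiv (b.toEquiv x) = x from b.toEquiv.symm_apply_apply x,
    show b.symm.toEquiv (b.toEquiv y) = y from b.toEquiv.symm_apply_apply y] at this

lemma abs_sin_sq_sub_sq_le (y : ℝ) : |Real.sin y ^ 2 - y ^ 2| ≤ 24 * y ^ 4 := by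
  rw [Real.sin_sq_eq_half_sub]
  have h4 : (2 * y) ^ 4 = 16 * y ^ 4 := by ring
  by_cases hy : |2 * y| ≤ 1
  · have h := abs_le.1 (Real.cos_bound hy)
    have h5 : |2 * y| ^ 4 = (2 * y) ^ 4 := by
      rw [← abs_pow]
      exact abs_of_nonneg (by positivity)
    rw [h5] at h
    rw [abs_le]
    have : 0 ≤ y ^ 4 := by positivity
    constructor <;> nlinarith [h.1, h.2]
  · have h1 : 1 < |2 * y| := not_le.1 hy
    have h2 : 1 < (2 * y) ^ 2 := by
      rw [← sq_abs]
      nlinarith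
    have h3 : (2 * y) ^ 2 ≤ (2 * y) ^ 4 := by nlinarith
    rw [abs_le]
    constructor <;> nlinarith [Real.cos_le_one (2 * y), Real.neg_one_le_cos (2 * y)]

/-- The product of the Jacobians. -/
def jac (b : CircleDiffeo) (z : UnitAddCircle × UnitAddCircle) : ℝ :=
  circleDeriv b.toEquiv z.1 * circleDeriv b.toEquiv z.2

lemma continuous_jac (b : CircleDiffeo) : Continuous (jac b) :=
  (b.continuous_circleDeriv.comp continuous_fst).mul (b.continuous_circleDeriv.comp continuous_snd)

lemma jac_pos (b : CircleDiffeo) (z : UnitAddCircle × UnitAddCircle) : 0 < jac b z :=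
  mul_pos (b.circleDeriv_pos _) (b.circleDeriv_pos _)

/-- The error is of order four and not three: with `a = F'(t)` and `a₂ = F''(t)`, both expressions
begin with `a² h² + a a₂ h³`. The cancellation comes from the symmetric product of the derivatives
at the two points, and it is what makes `bddKernel` bounded. -/
lemma exists_taylor_bound {b : CircleDiffeo} {F G : ℝ → ℝ} (hl : IsLift b F G) :
    ∃ C : ℝ, ∀ t h : ℝ, |h| ≤ 1 →
      |(F (t + h) - F t) ^ 2 - deriv F t * deriv F (t + h) * h ^ 2| ≤ C * h ^ 4 := by
  have hs1 := hl.contDiff_deriv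
  have hs2 : ContDiff ℝ ∞ (deriv (deriv F)) := (contDiff_infty_iff_deriv.1 hs1).2
  have hs3 : ContDiff ℝ ∞ (deriv (deriv (deriv F))) := (contDiff_infty_iff_deriv.1 hs2).2
  have hp1 := hl.deriv_periodic
  obtain ⟨A, hA0, hA⟩ := exists_abs_le_of_periodic hp1 hs1.continuous
  obtain ⟨B, hB0, hB⟩ := exists_abs_le_of_periodic (periodic_deriv hp1) hs2.continuous
  obtain ⟨C, hC0, hC⟩ := exists_abs_le_of_periodic (periodic_deriv (periodic_deriv hp1))
    hs3.continuous
  have d0 : Differentiable ℝ F := hl.smooth.differentiable (by simp)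
  have d1 : Differentiable ℝ (deriv F) := hs1.differentiable (by simp)
  have d2 : Differentiable ℝ (deriv (deriv F)) := hs2.differentiable (by simp)
  have e2 : ∀ t h, |deriv (deriv F) (t + h) - deriv (deriv F) t| ≤ C * |h| := fun t h =>
    abs_sub_le_of_abs_deriv_le d2 fun x _ => hC x
  have e1 : ∀ t h, |deriv F (t + h) - deriv F t - deriv (deriv F) t * h| ≤ C * |h| ^ 2 := by
    intro t h
    have h1 := abs_sub_le_of_abs_deriv_le (f := fun x => deriv F x - deriv (deriv F) t * x)
      (t := t) (h := h) (K := C * |h|) (d1.sub ((differentiable_const _).mul differentiable_id))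
      (fun x hx => by
        have hd : HasDerivAt (fun x => deriv F x - deriv (deriv F) t * x)
            (deriv (deriv F) x - deriv (deriv F) t * 1) x :=
          (d1 x).hasDerivAt.sub ((hasDerivAt_id x).const_mul _)
        rw [hd.deriv, mul_one]
        have := e2 t (x - t)
        rw [add_sub_cancel] at this
        exact this.trans (mul_le_mul_of_nonneg_left hx hC0))
    calc _ = |deriv F (t + h) - deriv (deriv F) t * (t + h) -
          (deriv F t - deriv (deriv F) t * t)| := by congr 1; ring
      _ ≤ _ := h1
      _ = _ := by ring
  have e0 : ∀ t h, |F (t + h) - F t - deriv F t * h - deriv (deriv F) t * h ^ 2 / 2|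
      ≤ C * |h| ^ 3 := by
    intro t h
    have h1 := abs_sub_le_of_abs_deriv_le
      (f := fun x => F x - deriv F t * x - deriv (deriv F) t * (x - t) ^ 2 / 2)
      (t := t) (h := h) (K := C * |h| ^ 2) (by fun_prop)
      (fun x hx => by
        have hd : HasDerivAt (fun x => F x - deriv F t * x - deriv (deriv F) t * (x - t) ^ 2 / 2)
            (deriv F x - deriv F t * 1 -
              deriv (deriv F) t * ((2 : ℕ) * (x - t) ^ (2 - 1) * 1) / 2) x :=
          ((d0 x).hasDerivAt.sub ((hasDerivAt_id x).const_mul _)).sub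
            (((((hasDerivAt_id x).sub_const t).pow 2).const_mul _).div_const 2)
        rw [hd.deriv]
        have := e1 t (x - t)
        rw [add_sub_cancel] at this
        calc _ = |deriv F x - deriv F t - deriv (deriv F) t * (x - t)| := by
              congr 1; push_cast; ring
          _ ≤ _ := this
          _ ≤ _ := by gcongr)
    calc _ = |F (t + h) - deriv F t * (t + h) - deriv (deriv F) t * (t + h - t) ^ 2 / 2 -
          (F t - deriv F t * t - deriv (deriv F) t * (t - t) ^ 2 / 2)| := by congr 1; ring
      _ ≤ _ := h1
      _ = _ := by ring
  refine ⟨B ^ 2 + 2 * (A + B) * C + C ^ 2 + A * C, fun t h hh => ?_⟩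
  set a := deriv F t
  set a2 := deriv (deriv F) t
  obtain ⟨E1, hE1⟩ : ∃ E, E = F (t + h) - F t - a * h - a2 * h ^ 2 / 2 := ⟨_, rfl⟩
  obtain ⟨E2, hE2⟩ : ∃ E, E = deriv F (t + h) - a - a2 * h := ⟨_, rfl⟩
  have k1 : |E1| ≤ C * |h| ^ 3 := by rw [hE1]; exact e0 t h
  have k2 : |E2| ≤ C * |h| ^ 2 := by rw [hE2]; exact e1 t h
  have ha : |a| ≤ A := hA t
  have ha2 : |a2| ≤ B := hB t
  have key : (F (t + h) - F t) ^ 2 - a * deriv F (t + h) * h ^ 2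
      = a2 ^ 2 * h ^ 4 / 4 + 2 * (a * h + a2 * h ^ 2 / 2) * E1 + E1 ^ 2 - a * E2 * h ^ 2 := by
    rw [hE1, hE2]
    ring
  rw [key]
  have hpos := abs_nonneg h
  have hh2 : |h| ^ 2 ≤ |h| := by nlinarith
  have t1 : |a2 ^ 2 * h ^ 4 / 4| ≤ B ^ 2 * |h| ^ 4 := by
    rw [abs_div, abs_mul, abs_pow, abs_pow]
    have : |a2| ^ 2 * |h| ^ 4 ≤ B ^ 2 * |h| ^ 4 := by gcongr
    have h4 : |(4 : ℝ)| = 4 := abs_of_pos (by norm_num)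
    rw [h4]
    have : 0 ≤ |a2| ^ 2 * |h| ^ 4 := by positivity
    linarith
  have t2 : |2 * (a * h + a2 * h ^ 2 / 2) * E1| ≤ 2 * (A + B) * C * |h| ^ 4 := by
    rw [abs_mul, abs_mul, abs_two]
    have h5 : |a * h + a2 * h ^ 2 / 2| ≤ (A + B) * |h| := by
      refine (abs_add_le _ _).trans ?_
      rw [abs_div, abs_mul, abs_mul, abs_pow, abs_two]
      have i1 : |a| * |h| ≤ A * |h| := by gcongr
      have i2 : |a2| * |h| ^ 2 ≤ B * |h| := by gcongr
      have i3 : 0 ≤ |a2| * |h| ^ 2 := by positivity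
      linarith
    calc 2 * |a * h + a2 * h ^ 2 / 2| * |E1| ≤ 2 * ((A + B) * |h|) * (C * |h| ^ 3) := by gcongr
      _ = _ := by ring
  have t3 : |E1 ^ 2| ≤ C ^ 2 * |h| ^ 4 := by
    rw [abs_pow]
    have h6 : |h| ^ 6 ≤ |h| ^ 4 := pow_le_pow_of_le_one hpos hh (by norm_num)
    calc |E1| ^ 2 ≤ (C * |h| ^ 3) ^ 2 := by gcongr
      _ = C ^ 2 * |h| ^ 6 := by ring
      _ ≤ _ := by gcongr
  have t4 : |a * E2 * h ^ 2| ≤ A * C * |h| ^ 4 := by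
    rw [abs_mul, abs_mul, abs_pow]
    calc |a| * |E2| * |h| ^ 2 ≤ A * (C * |h| ^ 2) * |h| ^ 2 := by gcongr
      _ = _ := by ring
  have h7 : |h| ^ 4 = h ^ 4 := by
    rw [← abs_pow]
    exact abs_of_nonneg (by positivity)
  conv_rhs => rw [← h7]
  refine (abs_sub _ _).trans ((add_le_add (abs_add_le _ _) le_rfl).trans ?_)
  have := abs_add_le (a2 ^ 2 * h ^ 4 / 4) (2 * (a * h + a2 * h ^ 2 / 2) * E1)
  linarith

/-- Replacing `sin²` by the square costs a fourth order error on either side; the rest is the Taylor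
bound for the lift. -/
lemma exists_abs_sinSq_comp_sub_le (b : CircleDiffeo) :
    ∃ M : ℝ, 0 ≤ M ∧ ∀ x y, |sinSq (b.toEquiv x - b.toEquiv y) - jac b (x, y) * sinSq (x - y)|
      ≤ M * sinSq (x - y) ^ 2 := by
  obtain ⟨F, G, hl⟩ := exists_isLift b
  obtain ⟨C, hC⟩ := exists_taylor_bound hl
  obtain ⟨A, hA0, hA⟩ := exists_abs_le_of_periodic hl.deriv_periodic hl.contDiff_deriv.continuous
  have hC0 : 0 ≤ C := by
    have := (abs_nonneg _).trans (hC 0 1 (by simp))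
    linarith
  refine ⟨Real.pi ^ 2 * C + 24 * (Real.pi * A) ^ 4 + A ^ 2 * (24 * Real.pi ^ 4), by positivity,
    fun x y => ?_⟩
  obtain ⟨t, rfl⟩ := exists_coe y
  have hx : x = ((t + coord (x - t) : ℝ) : UnitAddCircle) := by
    rw [AddCircle.coe_add, coe_coord]
    abel
  have h2 := four_mul_norm_sq_le_sinSq (x - t)
  rw [← abs_coord, sq_abs] at h2
  have hk : |coord (x - t)| ≤ 1 := by
    rw [abs_coord]
    have := AddCircle.norm_le_half_period (1 : ℝ) one_ne_zero (x := x - t)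
    rw [abs_one] at this
    linarith
  have hs : sinSq (x - t) = Real.sin (Real.pi * coord (x - t)) ^ 2 := by
    conv_lhs => rw [← coe_coord (x - t)]
    rw [sinSq_coe]
  set k := coord (x - t)
  have hk4 : k ^ 4 ≤ sinSq (x - t) ^ 2 := by
    have : k ^ 2 ≤ sinSq (x - t) := by nlinarith [sq_nonneg k]
    calc k ^ 4 = (k ^ 2) ^ 2 := by ring
      _ ≤ _ := pow_le_pow_left₀ (sq_nonneg k) this 2
  have hS : sinSq (b.toEquiv x - b.toEquiv t) = Real.sin (Real.pi * (F (t + k) - F t)) ^ 2 := by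
    rw [hx, ← hl.coe_eq, ← hl.coe_eq, ← AddCircle.coe_sub, sinSq_coe]
  have hj : jac b (x, (t : UnitAddCircle)) = deriv F t * deriv F (t + k) := by
    unfold jac
    simp only
    rw [hx, hl.circleDeriv_coe, hl.circleDeriv_coe, mul_comm]
  refine le_trans ?_ (mul_le_mul_of_nonneg_left hk4 (by positivity))
  rw [hS, hs, hj]
  have h3 := hC t k hk
  have h4 := abs_sin_sq_sub_sq_le (Real.pi * (F (t + k) - F t))
  have h5 := abs_sin_sq_sub_sq_le (Real.pi * k)
  have h6 := abs_sub_le_of_abs_deriv_le (hl.smooth.differentiable (by simp)) (t := t) (h := k)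
    (K := A) (fun x _ => hA x)
  have h7 : (Real.pi * (F (t + k) - F t)) ^ 4 ≤ (Real.pi * A) ^ 4 * k ^ 4 := by
    rw [mul_pow Real.pi (F (t + k) - F t), mul_pow Real.pi A, mul_assoc, ← mul_pow A k]
    refine mul_le_mul_of_nonneg_left ?_ (by positivity : (0 : ℝ) ≤ Real.pi ^ 4)
    have e : ∀ q : ℝ, q ^ 4 = |q| ^ 4 := fun q => by
      rw [← abs_pow]
      exact (abs_of_nonneg (by positivity)).symm
    rw [e (F (t + k) - F t), e (A * k)]
    refine pow_le_pow_left₀ (abs_nonneg _) ?_ 4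
    rwa [abs_mul, abs_of_nonneg hA0]
  have h8 : |deriv F t * deriv F (t + k)| ≤ A ^ 2 := by
    rw [abs_mul, sq]
    exact mul_le_mul (hA _) (hA _) (abs_nonneg _) hA0
  have h9 : |deriv F t * deriv F (t + k) * (Real.sin (Real.pi * k) ^ 2 - (Real.pi * k) ^ 2)|
      ≤ A ^ 2 * (24 * (Real.pi * k) ^ 4) := by
    rw [abs_mul]
    exact mul_le_mul h8 h5 (abs_nonneg _) (by positivity)
  have h10 : |Real.pi ^ 2 * ((F (t + k) - F t) ^ 2 - deriv F t * deriv F (t + k) * k ^ 2)|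
      ≤ Real.pi ^ 2 * (C * k ^ 4) := by
    rw [abs_mul, abs_of_nonneg (by positivity : (0 : ℝ) ≤ Real.pi ^ 2)]
    gcongr
  calc _ = |Real.pi ^ 2 * ((F (t + k) - F t) ^ 2 - deriv F t * deriv F (t + k) * k ^ 2)
        + (Real.sin (Real.pi * (F (t + k) - F t)) ^ 2 - (Real.pi * (F (t + k) - F t)) ^ 2)
        - deriv F t * deriv F (t + k) * (Real.sin (Real.pi * k) ^ 2 - (Real.pi * k) ^ 2)| := by
        congr 1; ring
    _ ≤ Real.pi ^ 2 * (C * k ^ 4) + 24 * ((Real.pi * A) ^ 4 * k ^ 4)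
        + A ^ 2 * (24 * (Real.pi * k) ^ 4) := by
        refine (abs_sub _ _).trans (add_le_add ((abs_add_le _ _).trans (add_le_add h10 ?_)) h9)
        linarith
    _ = _ := by ring

/-- The concentrated part of the difference of `regKernel` and its pullback. -/
def resKernel (b : CircleDiffeo) (d : ℝ) (z : UnitAddCircle × UnitAddCircle) : ℝ :=
  d * (1 - jac b z) / ((sinSq (z.1 - z.2) + d) * (sinSq (b.toEquiv z.1 - b.toEquiv z.2) + d))

/-- The bounded part of the difference of `regKernel` and its pullback. -/
def bddKernel (b : CircleDiffeo) (d : ℝ) (z : UnitAddCircle × UnitAddCircle) : ℝ :=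
  (sinSq (b.toEquiv z.1 - b.toEquiv z.2) - jac b z * sinSq (z.1 - z.2)) /
    ((sinSq (z.1 - z.2) + d) * (sinSq (b.toEquiv z.1 - b.toEquiv z.2) + d))

/-- The kernel `δ² sin² / ((sin² + δ²) (sin² ∘ b + δ²))`, which tends to `0` with `δ`. -/
def smallKernel (b : CircleDiffeo) (d : ℝ) (z : UnitAddCircle × UnitAddCircle) : ℝ :=
  d * sinSq (z.1 - z.2) /
    ((sinSq (z.1 - z.2) + d) * (sinSq (b.toEquiv z.1 - b.toEquiv z.2) + d))

/-- Writing `s`, `S` for `sinSq` before and after `b` and `j` for the Jacobian product, the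
numerator `(S + d) - j (s + d)` splits as `(S - j s) + d (1 - j)`. The first term is `O(s²)`; the
second matters only where `s` is comparable with `d` or smaller. -/
lemma kernel_decomp (b : CircleDiffeo) {d : ℝ} (hd : 0 < d) (z : UnitAddCircle × UnitAddCircle) :
    regKernel d z - jac b z * regKernel d (b.toEquiv z.1, b.toEquiv z.2)
      = bddKernel b d z + resKernel b d z := by
  have h1 := sinSq_nonneg (z.1 - z.2)
  have h2 := sinSq_nonneg (b.toEquiv z.1 - b.toEquiv z.2)
  have h3 : sinSq (z.1 - z.2) + d ≠ 0 := by positivity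
  have h4 : sinSq (b.toEquiv z.1 - b.toEquiv z.2) + d ≠ 0 := by positivity
  simp only [regKernel, bddKernel, resKernel]
  field_simp
  ring

lemma kernel_denom_pos (b : CircleDiffeo) {d : ℝ} (hd : 0 < d)
    (z : UnitAddCircle × UnitAddCircle) :
    0 < (sinSq (z.1 - z.2) + d) * (sinSq (b.toEquiv z.1 - b.toEquiv z.2) + d) :=
  mul_pos (add_pos_of_nonneg_of_pos (sinSq_nonneg _) hd)
    (add_pos_of_nonneg_of_pos (sinSq_nonneg _) hd)

lemma continuous_kernel_denom (b : CircleDiffeo) (d : ℝ) :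
    Continuous fun z : UnitAddCircle × UnitAddCircle =>
      (sinSq (z.1 - z.2) + d) * (sinSq (b.toEquiv z.1 - b.toEquiv z.2) + d) := by
  have h1 : Continuous fun z : UnitAddCircle × UnitAddCircle => sinSq (z.1 - z.2) :=
    continuous_sinSq.comp (continuous_fst.sub continuous_snd)
  have h2 : Continuous fun z : UnitAddCircle × UnitAddCircle =>
      sinSq (b.toEquiv z.1 - b.toEquiv z.2) :=
    continuous_sinSq.comp ((b.continuous.comp continuous_fst).sub (b.continuous.comp continuous_snd))
  exact (h1.add continuous_const).mul (h2.add continuous_const)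

lemma continuous_resKernel (b : CircleDiffeo) {d : ℝ} (hd : 0 < d) :
    Continuous (resKernel b d) :=
  (continuous_const.mul (continuous_const.sub (continuous_jac b))).div
    (continuous_kernel_denom b d) fun z => (kernel_denom_pos b hd z).ne'

lemma continuous_bddKernel (b : CircleDiffeo) {d : ℝ} (hd : 0 < d) :
    Continuous (bddKernel b d) := by
  have h1 : Continuous fun z : UnitAddCircle × UnitAddCircle => sinSq (z.1 - z.2) :=
    continuous_sinSq.comp (continuous_fst.sub continuous_snd)
  have h2 : Continuous fun z : UnitAddCircle × UnitAddCircle =>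
      sinSq (b.toEquiv z.1 - b.toEquiv z.2) :=
    continuous_sinSq.comp ((b.continuous.comp continuous_fst).sub (b.continuous.comp continuous_snd))
  exact (h2.sub ((continuous_jac b).mul h1)).div
    (continuous_kernel_denom b d) fun z => (kernel_denom_pos b hd z).ne'

lemma continuous_smallKernel (b : CircleDiffeo) {d : ℝ} (hd : 0 < d) :
    Continuous (smallKernel b d) := by
  have h1 : Continuous fun z : UnitAddCircle × UnitAddCircle => sinSq (z.1 - z.2) :=
    continuous_sinSq.comp (continuous_fst.sub continuous_snd)
  exact (continuous_const.mul h1).div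
    (continuous_kernel_denom b d) fun z => (kernel_denom_pos b hd z).ne'

lemma exists_abs_le_of_continuous {f : UnitAddCircle × UnitAddCircle → ℝ} (hf : Continuous f) :
    ∃ M, 0 ≤ M ∧ ∀ z, |f z| ≤ M := by
  obtain ⟨M, hM⟩ := isCompact_univ.exists_bound_of_continuousOn hf.continuousOn
  exact ⟨M, (norm_nonneg _).trans (hM 0 (Set.mem_univ _)), fun z => hM z (Set.mem_univ z)⟩

/-- The numerator is `O(s²)` and the denominator is at least `s S ≥ s² / C`, so the bound does not
depend on `d`. -/
lemma exists_abs_bddKernel_le (b : CircleDiffeo) :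
    ∃ M : ℝ, ∀ d, 0 < d → ∀ z, |bddKernel b d z| ≤ M := by
  obtain ⟨M, hM0, hM⟩ := exists_abs_sinSq_comp_sub_le b
  obtain ⟨C, hC0, hC⟩ := exists_le_sinSq_comp b
  refine ⟨M * C, fun d hd z => ?_⟩
  have h1 := sinSq_nonneg (z.1 - z.2)
  have h2 := sinSq_nonneg (b.toEquiv z.1 - b.toEquiv z.2)
  rw [bddKernel, abs_div, abs_of_pos (kernel_denom_pos b hd z),
    div_le_iff₀ (kernel_denom_pos b hd z)]
  refine (hM z.1 z.2).trans ?_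
  have h3 := hC z.1 z.2
  calc M * sinSq (z.1 - z.2) ^ 2 = M * (sinSq (z.1 - z.2) * sinSq (z.1 - z.2)) := by ring
    _ ≤ M * (sinSq (z.1 - z.2) * (C * sinSq (b.toEquiv z.1 - b.toEquiv z.2))) := by gcongr
    _ = M * C * (sinSq (z.1 - z.2) * sinSq (b.toEquiv z.1 - b.toEquiv z.2)) := by ring
    _ ≤ _ := by
      gcongr <;> linarith

lemma smallKernel_nonneg (b : CircleDiffeo) {d : ℝ} (hd : 0 < d)
    (z : UnitAddCircle × UnitAddCircle) : 0 ≤ smallKernel b d z :=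
  div_nonneg (mul_nonneg hd.le (sinSq_nonneg _)) (kernel_denom_pos b hd z).le

lemma smallKernel_le (b : CircleDiffeo) {d : ℝ} (hd : 0 < d)
    (z : UnitAddCircle × UnitAddCircle) :
    smallKernel b d z ≤ d / (sinSq (b.toEquiv z.1 - b.toEquiv z.2) + d) := by
  have h1 := sinSq_nonneg (z.1 - z.2)
  have h2 := sinSq_nonneg (b.toEquiv z.1 - b.toEquiv z.2)
  rw [smallKernel, div_le_div_iff₀ (kernel_denom_pos b hd z) (by positivity)]
  have : 0 ≤ d * d * (sinSq (b.toEquiv z.1 - b.toEquiv z.2) + d) := by positivity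
  nlinarith

/-- Dominated convergence: the kernel is at most `1`, vanishes where `X = Y`, and elsewhere is at
most `d / (S + d)` with `S > 0`. -/
lemma tendsto_integral_smallKernel (b : CircleDiffeo) :
    Filter.Tendsto (fun d => ∫ z, smallKernel b d z ∂(mu.prod mu)) (𝓝[>] 0) (𝓝 0) := by
  obtain ⟨C, hC0, hC⟩ := exists_le_sinSq_comp b
  suffices key : Filter.Tendsto (fun d => ∫ z, smallKernel b d z ∂(mu.prod mu)) (𝓝[>] 0)
      (𝓝 (∫ _, (0 : ℝ) ∂(mu.prod mu))) by simpa using key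
  refine tendsto_integral_filter_of_dominated_convergence (fun _ => 1) ?_ ?_
    (integrable_const _) (Filter.Eventually.of_forall fun z => ?_)
  · filter_upwards [self_mem_nhdsWithin] with d hd
    exact (continuous_smallKernel b hd).aestronglyMeasurable
  · filter_upwards [self_mem_nhdsWithin] with d hd
    refine Filter.Eventually.of_forall fun z => ?_
    rw [Real.norm_eq_abs, abs_of_nonneg (smallKernel_nonneg b hd z)]
    refine (smallKernel_le b hd z).trans (div_le_one_of_le₀ ?_ ?_)
    · linarith [sinSq_nonneg (b.toEquiv z.1 - b.toEquiv z.2)]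
    · exact (add_pos_of_nonneg_of_pos (sinSq_nonneg _) hd).le
  · by_cases hz : sinSq (z.1 - z.2) = 0
    · simp [smallKernel, hz]
    · have hs : 0 < sinSq (z.1 - z.2) := lt_of_le_of_ne (sinSq_nonneg _) (Ne.symm hz)
      have hS : 0 < sinSq (b.toEquiv z.1 - b.toEquiv z.2) := by
        have := hC z.1 z.2
        by_contra hc
        nlinarith
      have hlim : Filter.Tendsto (fun d => d / (sinSq (b.toEquiv z.1 - b.toEquiv z.2) + d))
          (𝓝[>] 0) (𝓝 0) := by
        have : ContinuousAt (fun d => d / (sinSq (b.toEquiv z.1 - b.toEquiv z.2) + d)) 0 :=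
          continuousAt_id.div (by fun_prop) (by simpa using hS.ne')
        have h3 := this.tendsto
        simp only [zero_div] at h3
        exact h3.mono_left nhdsWithin_le_nhds
      refine tendsto_of_tendsto_of_tendsto_of_le_of_le' tendsto_const_nhds hlim ?_ ?_
      · filter_upwards [self_mem_nhdsWithin] with d hd using smallKernel_nonneg b hd z
      · filter_upwards [self_mem_nhdsWithin] with d hd using smallKernel_le b hd z

/-- Differences of Lipschitz functions have squares bounded by a multiple of `sinSq`, so this is
what makes their contribution to the form of `resKernel` disappear in the limit. -/
lemma exists_abs_resKernel_mul_le (b : CircleDiffeo) : ∃ M : ℝ, 0 ≤ M ∧ ∀ d, 0 < d → ∀ z,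
    |resKernel b d z| * sinSq (z.1 - z.2) ≤ M * smallKernel b d z := by
  obtain ⟨M, hM0, hM⟩ := exists_abs_le_of_continuous (continuous_const.sub (continuous_jac b))
    (f := fun z => 1 - jac b z)
  refine ⟨M, hM0, fun d hd z => ?_⟩
  have h1 := sinSq_nonneg (z.1 - z.2)
  rw [resKernel, smallKernel, abs_div, abs_mul, abs_of_pos hd,
    abs_of_pos (kernel_denom_pos b hd z), div_mul_eq_mul_div, mul_div_assoc']
  refine div_le_div_of_nonneg_right ?_ (kernel_denom_pos b hd z).le
  calc d * |1 - jac b z| * sinSq (z.1 - z.2) ≤ d * M * sinSq (z.1 - z.2) := by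
        gcongr
        exact hM z
    _ = _ := by ring

lemma tendsto_form_resKernel (b : CircleDiffeo) {v w : UnitAddCircle → ℂ} {L : ℝ}
    (hv : ∀ x y, ‖v x - v y‖ ^ 2 ≤ L * sinSq (x - y))
    (hw : ∀ x y, ‖w x - w y‖ ^ 2 ≤ L * sinSq (x - y)) :
    Filter.Tendsto (fun d => form (resKernel b d) v w) (𝓝[>] 0) (𝓝 0) := by
  obtain ⟨M, hM0, hM⟩ := exists_abs_resKernel_mul_le b
  have hlim := (tendsto_integral_smallKernel b).const_mul (|L| * M)
  rw [mul_zero] at hlim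
  refine squeeze_zero_norm' ?_ hlim
  filter_upwards [self_mem_nhdsWithin] with d hd
  rw [← integral_const_mul]
  have hint : Integrable (fun z => |L| * M * smallKernel b d z) (mu.prod mu) :=
    ((continuous_const.mul (continuous_smallKernel b hd))).integrable_of_hasCompactSupport
      (HasCompactSupport.of_compactSpace _)
  refine norm_integral_le_of_norm_le hint (Filter.Eventually.of_forall fun z => ?_)
  rw [norm_mul, norm_mul, RCLike.norm_conj, Complex.norm_real, Real.norm_eq_abs]
  have h1 := sinSq_nonneg (z.1 - z.2)
  have h2 : ‖diff v z‖ * ‖diff w z‖ ≤ |L| * sinSq (z.1 - z.2) := by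
    have e1 : ‖diff v z‖ ^ 2 ≤ |L| * sinSq (z.1 - z.2) :=
      (hv z.1 z.2).trans (mul_le_mul_of_nonneg_right (le_abs_self L) h1)
    have e2 : ‖diff w z‖ ^ 2 ≤ |L| * sinSq (z.1 - z.2) :=
      (hw z.1 z.2).trans (mul_le_mul_of_nonneg_right (le_abs_self L) h1)
    nlinarith [sq_nonneg (‖diff v z‖ - ‖diff w z‖)]
  calc |resKernel b d z| * (‖diff v z‖ * ‖diff w z‖)
      ≤ |resKernel b d z| * (|L| * sinSq (z.1 - z.2)) := by gcongr
    _ = |L| * (|resKernel b d z| * sinSq (z.1 - z.2)) := by ring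
    _ ≤ |L| * (M * smallKernel b d z) := mul_le_mul_of_nonneg_left (hM d hd z) (abs_nonneg _)
    _ = _ := by ring

/-! ### Nonstationary phase -/

/-- For nonnegative `p`, `q` the phase `p F + q t` has derivative at least a multiple of `p + q`,
because `F' > 0`. There is no stationary point, and three integrations by parts give the cubic
decay. -/
lemma IsLift.exists_phase_integral_le {b : CircleDiffeo} {F G : ℝ → ℝ} (hl : IsLift b F G) :
    ∃ C : ℝ, 0 ≤ C ∧ ∀ p q : ℕ, 0 < p + q →
      ‖∫ t in (0 : ℝ)..1, Complex.exp (2 * Real.pi * Complex.I * (p * F t + q * t : ℝ))‖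
        ≤ C / ((p : ℝ) + q) ^ 3 := by
  have hs1 := hl.contDiff_deriv
  have hs2 : ContDiff ℝ ∞ (deriv (deriv F)) := (contDiff_infty_iff_deriv.1 hs1).2
  have hs3 : ContDiff ℝ ∞ (deriv (deriv (deriv F))) := (contDiff_infty_iff_deriv.1 hs2).2
  have hs4 : ContDiff ℝ ∞ (deriv (deriv (deriv (deriv F)))) := (contDiff_infty_iff_deriv.1 hs3).2
  have hp1 := hl.deriv_periodic
  have hp2 := periodic_deriv hp1
  have hp3 := periodic_deriv hp2
  have hp4 := periodic_deriv hp3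
  obtain ⟨A2, hA20, hA2⟩ := exists_abs_le_of_periodic hp2 hs2.continuous
  obtain ⟨A3, hA30, hA3⟩ := exists_abs_le_of_periodic hp3 hs3.continuous
  obtain ⟨A4, hA40, hA4⟩ := exists_abs_le_of_periodic hp4 hs4.continuous
  obtain ⟨c₀, C₀, hc₀, hcb⟩ := exists_circleDeriv_bounds b
  set c := min c₀ 1 with hc
  have hcpos : 0 < c := lt_min hc₀ one_pos
  have hcF : ∀ t, c ≤ deriv F t := fun t => by
    rw [← hl.circleDeriv_coe]
    exact (min_le_left _ _).trans (hcb _).1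
  refine ⟨A4 * (1 / c) ^ 4 + 10 * (A2 * A3) * (1 / c) ^ 5 + 15 * A2 ^ 3 * (1 / c) ^ 6,
    by positivity, fun p q hpq => ?_⟩
  set N : ℝ := (p : ℝ) + q with hN
  have hN0 : 0 < N := by
    have : (0 : ℝ) < ((p + q : ℕ) : ℝ) := by exact_mod_cast hpq
    rw [hN]
    push_cast at this
    exact this
  obtain ⟨f, hf⟩ : ∃ f : ℝ → ℝ, f = fun t => p * deriv F t + q := ⟨_, rfl⟩
  obtain ⟨f1, hf1⟩ : ∃ f : ℝ → ℝ, f = fun t => p * deriv (deriv F) t := ⟨_, rfl⟩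
  obtain ⟨f2, hf2⟩ : ∃ f : ℝ → ℝ, f = fun t => p * deriv (deriv (deriv F)) t := ⟨_, rfl⟩
  obtain ⟨f3, hf3⟩ : ∃ f : ℝ → ℝ, f = fun t => p * deriv (deriv (deriv (deriv F))) t := ⟨_, rfl⟩
  have hfN : ∀ t, c * N ≤ f t := fun t => by
    rw [hf, hN]
    have h1 : (p : ℝ) * c ≤ p * deriv F t := mul_le_mul_of_nonneg_left (hcF t) (Nat.cast_nonneg p)
    have h2 : (q : ℝ) * c ≤ q * 1 :=
      mul_le_mul_of_nonneg_left (min_le_right _ _) (Nat.cast_nonneg q)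
    simp only
    linarith
  have hf0 : ∀ t, 0 < f t := fun t => (mul_pos hcpos hN0).trans_le (hfN t)
  have d0 : ∀ t, HasDerivAt f (f1 t) t := fun t => by
    rw [hf, hf1]
    exact ((hs1.differentiable (by simp) t).hasDerivAt.const_mul (p : ℝ)).add_const (q : ℝ)
  have d1 : ∀ t, HasDerivAt f1 (f2 t) t := fun t => by
    rw [hf1, hf2]
    exact (hs2.differentiable (by simp) t).hasDerivAt.const_mul (p : ℝ)
  have d2 : ∀ t, HasDerivAt f2 (f3 t) t := fun t => by
    rw [hf2, hf3]
    exact (hs3.differentiable (by simp) t).hasDerivAt.const_mul (p : ℝ)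
  obtain ⟨i, hi⟩ : ∃ i : ℝ → ℝ, i = fun t => (f t)⁻¹ := ⟨_, rfl⟩
  have di : ∀ t, HasDerivAt i (-f1 t * i t ^ 2) t := fun t => by
    rw [hi]
    have := (d0 t).inv (hf0 t).ne'
    convert! this using 1
    simp only [inv_pow]
    rw [div_eq_mul_inv]
  have hfi : ∀ t, f t * i t = 1 := fun t => by
    rw [hi]
    exact mul_inv_cancel₀ (hf0 t).ne'
  -- The three integrations by parts are packed into one primitive `W = E (i / τ - g1 / τ² + g2 /
  -- τ³)`, with `i = 1 / f`. The corrections satisfy `f g1 = i'`, `f g2 = g1'` and `g3 = g2'`, so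
  -- that `W' = E + E g3 / τ³`.
  obtain ⟨g1, hg1⟩ : ∃ g : ℝ → ℝ, g = fun t => -f1 t * i t ^ 3 := ⟨_, rfl⟩
  obtain ⟨g2, hg2⟩ : ∃ g : ℝ → ℝ, g = fun t => -f2 t * i t ^ 4 + 3 * f1 t ^ 2 * i t ^ 5 := ⟨_, rfl⟩
  obtain ⟨g3, hg3⟩ : ∃ g : ℝ → ℝ, g = fun t => -f3 t * i t ^ 4 + 10 * (f1 t * f2 t) * i t ^ 5
    - 15 * f1 t ^ 3 * i t ^ 6 := ⟨_, rfl⟩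
  have dg1 : ∀ t, HasDerivAt g1 (f t * g2 t) t := fun t => by
    have h := (d1 t).neg.mul ((di t).pow 3)
    rw [hg1]
    refine h.congr_deriv ?_
    rw [hg2]
    simp only [Pi.neg_apply, Pi.pow_apply]
    push_cast
    linear_combination (f2 t * i t ^ 3 - 3 * f1 t ^ 2 * i t ^ 4) * hfi t
  have dg2 : ∀ t, HasDerivAt g2 (g3 t) t := fun t => by
    have h := ((d2 t).neg.mul ((di t).pow 4)).add
      ((((d1 t).pow 2).const_mul 3).mul ((di t).pow 5))
    rw [hg2]
    refine h.congr_deriv ?_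
    rw [hg3]
    simp only [Pi.neg_apply, Pi.pow_apply]
    push_cast
    ring
  set τ : ℂ := 2 * Real.pi * Complex.I with hτ
  have hτ0 : τ ≠ 0 := by
    rw [hτ]
    simp [Real.pi_ne_zero]
  obtain ⟨E, hE⟩ : ∃ E : ℝ → ℂ, E = fun t => Complex.exp (τ * (p * F t + q * t : ℝ)) := ⟨_, rfl⟩
  have dE : ∀ t, HasDerivAt E (τ * f t * E t) t := fun t => by
    have h1 : HasDerivAt (fun t : ℝ => ((p * F t + q * t : ℝ) : ℂ)) ((f t : ℝ) : ℂ) t := by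
      have h0 : HasDerivAt (fun t : ℝ => p * F t + q * t) (f t) t := by
        have := ((hl.hasDerivAt t).const_mul (p : ℝ)).add ((hasDerivAt_id t).const_mul (q : ℝ))
        rw [hf]
        simpa using! this
      exact h0.ofReal_comp
    rw [hE]
    refine ((h1.const_mul τ).cexp).congr_deriv ?_
    ring
  have hnE : ∀ t, ‖E t‖ = 1 := fun t => by
    rw [hE]
    simp only [hτ]
    rw [show (2 * Real.pi * Complex.I * (p * F t + q * t : ℝ) : ℂ)
      = ((2 * Real.pi * (p * F t + q * t) : ℝ) : ℂ) * Complex.I by push_cast; ring]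
    exact Complex.norm_exp_ofReal_mul_I _
  have hcE : Continuous E := continuous_iff_continuousAt.2 fun t => (dE t).continuousAt
  obtain ⟨W, hW⟩ : ∃ W : ℝ → ℂ, W = fun t =>
    E t * ((i t : ℂ) / τ - (g1 t : ℂ) / τ ^ 2 + (g2 t : ℂ) / τ ^ 3) := ⟨_, rfl⟩
  have dW : ∀ t, HasDerivAt W (E t + E t * (g3 t : ℂ) / τ ^ 3) t := fun t => by
    have h := (dE t).mul (((((di t).ofReal_comp).div_const τ).sub
      (((dg1 t).ofReal_comp).div_const (τ ^ 2))).add (((dg2 t).ofReal_comp).div_const (τ ^ 3)))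
    rw [hW]
    refine h.congr_deriv ?_
    have e1 : (f t : ℂ) * i t = 1 := by exact_mod_cast hfi t
    have e2 : (f t : ℂ) * g1 t = -f1 t * i t ^ 2 := by
      rw [hg1]
      push_cast
      linear_combination -(f1 t : ℂ) * i t ^ 2 * e1
    push_cast
    simp only [Pi.add_apply, Pi.sub_apply]
    field_simp
    linear_combination τ ^ 3 * E t * e1 - τ ^ 2 * E t * e2
  have ci : Continuous i := continuous_iff_continuousAt.2 fun t => (di t).continuousAt
  have c1 : Continuous f1 := continuous_iff_continuousAt.2 fun t => (d1 t).continuousAt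
  have c2 : Continuous f2 := continuous_iff_continuousAt.2 fun t => (d2 t).continuousAt
  have c3 : Continuous f3 := by
    rw [hf3]
    exact continuous_const.mul hs4.continuous
  have cg3 : Continuous g3 := by
    rw [hg3]
    fun_prop
  have cg3' : Continuous fun t => E t * (g3 t : ℂ) / τ ^ 3 :=
    (hcE.mul (Complex.continuous_ofReal.comp cg3)).div_const _
  -- There are no boundary terms: the amplitudes are periodic, and the phase increases by the
  -- integer `p + q` over a period.
  have hW10 : W 1 = W 0 := by
    have e1 : F 1 = F 0 + 1 := by simpa using hl.add_one 0
    have k1 : f1 1 = f1 0 := by rw [hf1]; simpa using congrArg ((p : ℝ) * ·) (hp2 0)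
    have k2 : f2 1 = f2 0 := by rw [hf2]; simpa using congrArg ((p : ℝ) * ·) (hp3 0)
    have k0 : f 1 = f 0 := by
      rw [hf]
      have := hp1 0
      rw [zero_add] at this
      simp only [this]
    have ki : i 1 = i 0 := by rw [hi]; simp only [k0]
    have kE : E 1 = E 0 := by
      rw [hE]
      simp only
      rw [e1, Complex.exp_eq_exp_iff_exists_int]
      refine ⟨p + q, ?_⟩
      rw [hτ]
      push_cast
      ring
    rw [hW, hg1, hg2]
    simp only [k1, k2, ki, kE]
  have hint := intervalIntegral.integral_eq_sub_of_hasDerivAt (a := 0) (b := 1)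
    (fun t _ => dW t) ((hcE.add cg3').intervalIntegrable _ _)
  rw [hW10, sub_self, intervalIntegral.integral_add (hcE.intervalIntegrable _ _)
    (cg3'.intervalIntegrable _ _)] at hint
  have hmain : ∫ t in (0 : ℝ)..1, E t = -∫ t in (0 : ℝ)..1, E t * (g3 t : ℂ) / τ ^ 3 :=
    eq_neg_of_add_eq_zero_left hint
  have hgoal : ∫ t in (0 : ℝ)..1, Complex.exp (τ * (p * F t + q * t : ℝ))
      = ∫ t in (0 : ℝ)..1, E t := by rw [hE]
  rw [hgoal, hmain, norm_neg]
  have hpN : (p : ℝ) ≤ N := by rw [hN]; linarith [(Nat.cast_nonneg q : (0 : ℝ) ≤ q)]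
  have hbound : ∀ t, ‖E t * (g3 t : ℂ) / τ ^ 3‖ ≤ (A4 * (1 / c) ^ 4
      + 10 * (A2 * A3) * (1 / c) ^ 5 + 15 * A2 ^ 3 * (1 / c) ^ 6) / N ^ 3 := by
    intro t
    have hτn : 1 ≤ ‖τ ^ 3‖ := by
      rw [norm_pow]
      apply one_le_pow₀
      rw [hτ]
      simp only [Complex.norm_mul, Complex.norm_I, Complex.norm_ofNat, mul_one, Complex.norm_real,
        Real.norm_eq_abs, abs_of_pos Real.pi_pos]
      nlinarith [Real.pi_gt_three]
    rw [norm_div, norm_mul, hnE, one_mul, Complex.norm_real, Real.norm_eq_abs]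
    have hi0 : 0 ≤ i t := by rw [hi]; exact (inv_pos.2 (hf0 t)).le
    have hile : i t ≤ (1 / c) / N := by
      rw [hi]
      simp only
      rw [div_div, one_div]
      exact inv_anti₀ (mul_pos hcpos hN0) (hfN t)
    have b1 : |f1 t| ≤ N * A2 := by
      rw [hf1, abs_mul, Nat.abs_cast]
      exact mul_le_mul hpN (hA2 t) (abs_nonneg _) hN0.le
    have b2 : |f2 t| ≤ N * A3 := by
      rw [hf2, abs_mul, Nat.abs_cast]
      exact mul_le_mul hpN (hA3 t) (abs_nonneg _) hN0.le
    have b3 : |f3 t| ≤ N * A4 := by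
      rw [hf3, abs_mul, Nat.abs_cast]
      exact mul_le_mul hpN (hA4 t) (abs_nonneg _) hN0.le
    -- The three terms have sizes `N · N⁻⁴`, `N² · N⁻⁵` and `N³ · N⁻⁶`, all equal to `N⁻³`.
    have hg : |g3 t| ≤ (N * A4) * ((1 / c) / N) ^ 4 + 10 * ((N * A2) * (N * A3)) * ((1 / c) / N) ^ 5
        + 15 * (N * A2) ^ 3 * ((1 / c) / N) ^ 6 := by
      rw [hg3]
      refine (abs_sub _ _).trans (add_le_add ((abs_add_le _ _).trans (add_le_add ?_ ?_)) ?_)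
      · rw [abs_mul, abs_neg, abs_pow, abs_of_nonneg hi0]
        gcongr
      · rw [abs_mul, abs_mul, abs_mul, abs_pow, abs_of_nonneg hi0, abs_of_pos (by norm_num :
          (0 : ℝ) < 10)]
        gcongr
      · rw [abs_mul, abs_mul, abs_pow, abs_pow, abs_of_nonneg hi0, abs_of_pos (by norm_num :
          (0 : ℝ) < 15)]
        gcongr
    calc |g3 t| / ‖τ ^ 3‖ ≤ |g3 t| / 1 := by gcongr
      _ = |g3 t| := div_one _
      _ ≤ _ := hg
      _ = _ := by field_simp
  have := intervalIntegral.norm_integral_le_of_norm_le_const (a := 0) (b := 1)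
    (fun t _ => hbound t)
  simpa using this

lemma inner_basis_compL2 (b : CircleDiffeo) (k j : ℤ) :
    ⟪basis k, compL2 b (basis j)⟫_ℂ
      = ∫ x, expo j (b.toEquiv x) * conj (expo k x) ∂mu := by
  rw [inner_basis]
  apply integral_congr_ae
  filter_upwards [coeFn_compL2 b (basis j),
    (quasiMeasurePreserving b).ae_eq_comp (coeFn_basis j)] with x h1 h2
  rw [h1, h2]
  rfl

/-- For `j` and `k` of opposite signs the phase `j F - k t` is, up to sign, a combination of `F` and
`t` with nonnegative coefficients, hence nonstationary. The cubic decay is split into two powers of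
`k` and one of `j`: the latter serves for Cauchy–Schwarz in `j`, and the former beat the multiplier
`|k|` with one power to spare. The factor `8` comes from `1 + |k| ≤ 2 (|j| + |k|)` and its analogue
for `j`. -/
lemma exists_inner_basis_compL2_le (b : CircleDiffeo) :
    ∃ C : ℝ, 0 ≤ C ∧ ∀ k j : ℤ, (0 ≤ j ∧ k < 0 ∨ j < 0 ∧ 0 ≤ k) →
      ‖⟪basis k, compL2 b (basis j)⟫_ℂ‖ ≤ C / (1 + |(k : ℝ)|) ^ 2 / (1 + |(j : ℝ)|) := by
  obtain ⟨F, G, hl⟩ := exists_isLift b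
  obtain ⟨C, hC0, hC⟩ := hl.exists_phase_integral_le
  refine ⟨8 * C, by positivity, fun k j hkj => ?_⟩
  have hpos : 0 < j.natAbs + k.natAbs := by omega
  have h1 : ‖⟪basis k, compL2 b (basis j)⟫_ℂ‖ ≤ C / ((j.natAbs : ℝ) + k.natAbs) ^ 3 := by
    rw [inner_basis_compL2, integral_mu]
    have hterm : ∀ t : ℝ, expo j (b.toEquiv (t : UnitAddCircle)) * conj (expo k (t : UnitAddCircle))
        = Complex.exp (2 * Real.pi * Complex.I * (j * F t - k * t : ℝ)) := fun t => by
      rw [← hl.coe_eq, conj_expo, expo_coe, expo_coe, ← Complex.exp_add]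
      congr 1
      push_cast
      ring
    simp only [hterm]
    rcases hkj with ⟨hj, hk⟩ | ⟨hj, hk⟩
    · have e1 : (j : ℝ) = j.natAbs := by
        rw [Nat.cast_natAbs, abs_of_nonneg hj]
      have e2 : (k : ℝ) = -(k.natAbs : ℝ) := by
        rw [Nat.cast_natAbs, abs_of_neg hk]
        push_cast
        ring
      have := hC j.natAbs k.natAbs hpos
      rw [e1, e2]
      simpa only [neg_mul, sub_neg_eq_add] using this
    · have e1 : (j : ℝ) = -(j.natAbs : ℝ) := by
        rw [Nat.cast_natAbs, abs_of_neg hj]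
        push_cast
        ring
      have e2 : (k : ℝ) = k.natAbs := by
        rw [Nat.cast_natAbs, abs_of_nonneg hk]
      have := hC j.natAbs k.natAbs hpos
      rw [← RCLike.norm_conj, intervalIntegral.integral_of_le zero_le_one, ← integral_conj] at this
      rw [e1, e2, intervalIntegral.integral_of_le zero_le_one]
      refine le_trans (le_of_eq ?_) this
      congr 1
      apply integral_congr_ae
      refine Filter.Eventually.of_forall fun t => ?_
      simp only
      rw [← Complex.exp_conj]
      congr 1
      simp only [map_mul, Complex.conj_ofReal, Complex.conj_I, map_ofNat]
      push_cast
      ring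
  refine h1.trans ?_
  have ek : |(k : ℝ)| = k.natAbs := by rw [Nat.cast_natAbs]; push_cast; rfl
  have ej : |(j : ℝ)| = j.natAbs := by rw [Nat.cast_natAbs]; push_cast; rfl
  rw [ek, ej, div_div]
  have hN : (1 : ℝ) ≤ (j.natAbs : ℝ) + k.natAbs := by exact_mod_cast hpos
  have hj0 : (0 : ℝ) ≤ j.natAbs := Nat.cast_nonneg _
  have hk0 : (0 : ℝ) ≤ k.natAbs := Nat.cast_nonneg _
  set p : ℝ := (j.natAbs : ℝ)
  set q : ℝ := (k.natAbs : ℝ)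
  rw [div_le_div_iff₀ (by positivity) (by positivity)]
  have : (1 + q) ^ 2 * (1 + p) ≤ (2 * (p + q)) ^ 2 * (2 * (p + q)) := by
    gcongr <;> linarith
  calc C * ((1 + q) ^ 2 * (1 + p)) ≤ C * ((2 * (p + q)) ^ 2 * (2 * (p + q))) := by gcongr
    _ = _ := by ring

/-! ### The projection on nonnegative frequencies -/

/-- The closed span of the characters of nonnegative frequency. -/
def hardySpace : Submodule ℂ L2 :=
  (Submodule.span ℂ (basis '' {k : ℤ | 0 ≤ k})).topologicalClosure

instance : CompleteSpace hardySpace :=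
  (Submodule.isClosed_topologicalClosure _).completeSpace_coe

/-- The projection on nonnegative frequencies. -/
def szego : L2 →L[ℂ] L2 := hardySpace.starProjection

lemma szego_basis (k : ℤ) : szego (basis k) = if 0 ≤ k then basis k else 0 := by
  split_ifs with hk
  · exact Submodule.starProjection_eq_self_iff.2
      (Submodule.le_topologicalClosure _ (Submodule.subset_span ⟨k, hk, rfl⟩))
  · rw [szego, Submodule.starProjection_apply_eq_zero_iff, hardySpace,
      Submodule.orthogonal_closure, Submodule.mem_orthogonal]
    intro u hu
    induction hu using Submodule.span_induction with
    | mem x hx =>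
      obtain ⟨j, hj, rfl⟩ := hx
      rw [orthonormal_iff_ite.1 basis.orthonormal j k, if_neg]
      rintro rfl
      exact hk hj
    | zero => exact inner_zero_left _
    | add x y _ _ hx hy => rw [inner_add_left, hx, hy, add_zero]
    | smul c x _ hx => rw [inner_smul_left, hx, mul_zero]

lemma inner_basis_szego (k : ℤ) (v : L2) :
    ⟪basis k, szego v⟫_ℂ = if 0 ≤ k then ⟪basis k, v⟫_ℂ else 0 := by
  have h : ⟪szego (basis k), v⟫_ℂ = ⟪basis k, szego v⟫_ℂ :=
    Submodule.inner_starProjection_left_eq_right _ _ _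
  rw [← h, szego_basis]
  split_ifs
  · rfl
  · exact inner_zero_left _

/-- The sign of the frequency. -/
def hilbertTr : L2 →L[ℂ] L2 := (2 : ℂ) • szego - ContinuousLinearMap.id ℂ L2

lemma hilbertTr_apply (v : L2) : hilbertTr v = (2 : ℂ) • szego v - v := rfl

/-- The sign of a frequency. -/
def freqSign (k : ℤ) : ℂ := if 0 ≤ k then 1 else -1

lemma freqSign_mul_natAbs (k : ℤ) : freqSign k * (k.natAbs : ℂ) = k := by
  unfold freqSign
  have h1 : (k.natAbs : ℂ) = ((|k| : ℤ) : ℂ) := by rw [Nat.cast_natAbs]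
  rw [h1]
  split_ifs with h
  · rw [abs_of_nonneg h, one_mul]
  · rw [abs_of_neg (not_le.1 h)]
    push_cast
    ring

lemma norm_freqSign (k : ℤ) : ‖freqSign k‖ = 1 := by
  unfold freqSign
  split_ifs <;> simp

lemma conj_freqSign (k : ℤ) : conj (freqSign k) = freqSign k := by
  unfold freqSign
  split_ifs <;> simp

lemma inner_basis_hilbertTr (k : ℤ) (v : L2) :
    ⟪basis k, hilbertTr v⟫_ℂ = freqSign k * ⟪basis k, v⟫_ℂ := by
  rw [hilbertTr_apply, inner_sub_right, inner_smul_right, inner_basis_szego, freqSign]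
  split_ifs <;> ring

lemma hilbertTr_basis (k : ℤ) : hilbertTr (basis k) = freqSign k • basis k := by
  rw [hilbertTr_apply, szego_basis, freqSign]
  split_ifs
  · rw [two_smul, one_smul, add_sub_cancel_right]
  · rw [smul_zero, zero_sub, neg_smul, one_smul]

/-! ### Weighted sums of Fourier coefficients -/

lemma hasSum_sq_norm_inner_basis (v : L2) :
    HasSum (fun j => ‖⟪basis j, v⟫_ℂ‖ ^ 2) (‖v‖ ^ 2) := by
  have h := basis.hasSum_inner_mul_inner v v
  have h2 := Complex.hasSum_re h
  convert! h2 using 1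
  · ext j
    rw [← inner_conj_symm (basis j) v, RCLike.norm_conj, RCLike.mul_conj]
    norm_cast
  · rw [inner_self_eq_norm_sq_to_K]
    norm_cast

lemma summable_inv_one_add_abs_sq : Summable fun j : ℤ => ((1 + |(j : ℝ)|)⁻¹) ^ 2 := by
  apply Summable.of_nat_of_neg
  all_goals
    have h := (summable_nat_add_iff 1).2 (Real.summable_one_div_nat_pow.2 (one_lt_two))
    refine h.congr fun n => ?_
    simp only [Int.cast_neg, Int.cast_natCast, abs_neg, Nat.abs_cast]
    push_cast
    rw [inv_pow, one_div, add_comm]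

/-- Cauchy–Schwarz and Parseval, since `(1 + |j|)⁻¹` is square summable. -/
lemma exists_weighted_sum_le : ∃ c : ℝ, 0 ≤ c ∧ ∀ v : L2,
    Summable (fun j : ℤ => (1 + |(j : ℝ)|)⁻¹ * ‖⟪basis j, v⟫_ℂ‖) ∧
      ∑' j : ℤ, (1 + |(j : ℝ)|)⁻¹ * ‖⟪basis j, v⟫_ℂ‖ ≤ c * ‖v‖ := by
  refine ⟨(∑' j : ℤ, ((1 + |(j : ℝ)|)⁻¹) ^ 2) ^ (1 / 2 : ℝ), by positivity, fun v => ?_⟩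
  have h1 := hasSum_sq_norm_inner_basis v
  have h := Real.summable_and_inner_le_Lp_mul_Lq_tsum_of_nonneg Real.HolderConjugate.two_two
    (f := fun j : ℤ => (1 + |(j : ℝ)|)⁻¹) (g := fun j => ‖⟪basis j, v⟫_ℂ‖)
    (fun j => by positivity) (fun j => norm_nonneg _)
    (by simpa only [Real.rpow_two] using summable_inv_one_add_abs_sq)
    (by simpa only [Real.rpow_two] using h1.summable)
  refine ⟨h.1, h.2.trans (le_of_eq ?_)⟩
  simp only [Real.rpow_two]
  rw [h1.tsum_eq]
  congr 1
  rw [← Real.sqrt_eq_rpow, Real.sqrt_sq (norm_nonneg _)]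

lemma summable_of_weighted {a : ℤ → ℂ} {c : ℝ} (ha : ∀ j : ℤ, ‖a j‖ ≤ c * (1 + |(j : ℝ)|)⁻¹)
    (v : L2) : Summable fun j => ‖a j * ⟪basis j, v⟫_ℂ‖ := by
  obtain ⟨c₀, -, h⟩ := exists_weighted_sum_le
  refine Summable.of_nonneg_of_le (fun _ => norm_nonneg _) (fun j => ?_) ((h v).1.mul_left c)
  rw [norm_mul, ← mul_assoc]
  exact mul_le_mul_of_nonneg_right (ha j) (norm_nonneg _)

lemma exists_norm_tsum_le : ∃ c₀ : ℝ, 0 ≤ c₀ ∧ ∀ (a : ℤ → ℂ) (c : ℝ) (v : L2),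
    (∀ j : ℤ, ‖a j‖ ≤ c * (1 + |(j : ℝ)|)⁻¹) → ‖∑' j : ℤ, a j * ⟪basis j, v⟫_ℂ‖ ≤ c * (c₀ * ‖v‖) := by
  obtain ⟨c₀, h0, h⟩ := exists_weighted_sum_le
  refine ⟨c₀, h0, fun a c v ha => ?_⟩
  have hc : 0 ≤ c := by simpa using (norm_nonneg _).trans (ha 0)
  refine (norm_tsum_le_tsum_norm (summable_of_weighted ha v)).trans ?_
  refine le_trans ((summable_of_weighted ha v).tsum_le_tsum
    (g := fun j : ℤ => c * ((1 + |(j : ℝ)|)⁻¹ * ‖⟪basis j, v⟫_ℂ‖)) (fun j => ?_)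
    ((h v).1.mul_left c)) ?_
  · rw [norm_mul, ← mul_assoc]
    exact mul_le_mul_of_nonneg_right (ha j) (norm_nonneg _)
  · rw [tsum_mul_left]
    exact mul_le_mul_of_nonneg_left (h v).2 hc

/-- Bounds for the coefficients of `T v` from bounds for the matrix of `T`, at the frequencies
which occur in `v`. -/
lemma exists_norm_inner_basis_apply_le : ∃ c₀ : ℝ, 0 ≤ c₀ ∧
    ∀ (T : L2 →L[ℂ] L2) (k : ℤ) (c : ℝ) (v : L2), 0 ≤ c →
      (∀ j, ⟪basis j, v⟫_ℂ ≠ 0 → ‖⟪basis k, T (basis j)⟫_ℂ‖ ≤ c / (1 + |(j : ℝ)|)) →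
      ‖⟪basis k, T v⟫_ℂ‖ ≤ c * (c₀ * ‖v‖) := by
  obtain ⟨c₀, h0, h⟩ := exists_norm_tsum_le
  refine ⟨c₀, h0, fun T k c v hc hT => ?_⟩
  have h1 := basis.tsum_inner_mul_inner (ContinuousLinearMap.adjoint T (basis k)) v
  simp only [ContinuousLinearMap.adjoint_inner_left] at h1
  have h2 := h (fun j => if ⟪basis j, v⟫_ℂ = 0 then 0 else ⟪basis k, T (basis j)⟫_ℂ) c v
    (fun j => by
      split_ifs with hj
      · rw [norm_zero]
        positivity
      · rw [← div_eq_mul_inv]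
        exact hT j hj)
  refine le_trans (le_of_eq ?_) h2
  rw [← h1]
  congr 1
  apply tsum_congr
  intro j
  split_ifs with hj
  · rw [hj, mul_zero, mul_zero]
  · rfl

/-- The commutator is twice that with the projection `szego`, whose matrix only links a nonnegative
frequency to a negative one. There the phase is nonstationary, so the commutator is smoothing. -/
lemma exists_commutator_le (b : CircleDiffeo) : ∃ K : ℝ, 0 ≤ K ∧ ∀ (k : ℤ) (v : L2),
    ‖⟪basis k, compL2 b (hilbertTr v) - hilbertTr (compL2 b v)⟫_ℂ‖
      ≤ K / (1 + |(k : ℝ)|) ^ 2 * ‖v‖ := by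
  obtain ⟨C, hC0, hC⟩ := exists_inner_basis_compL2_le b
  obtain ⟨c₀, h0, h⟩ := exists_norm_inner_basis_apply_le
  have hP : ∀ v, ‖szego v‖ ≤ ‖v‖ := fun v => by
    have := ContinuousLinearMap.le_of_opNorm_le szego
      (Submodule.starProjection_norm_le hardySpace) v
    simpa using this
  refine ⟨4 * (C * c₀), by positivity, fun k v => ?_⟩
  have hcomm : compL2 b (hilbertTr v) - hilbertTr (compL2 b v)
      = (2 : ℂ) • (compL2 b (szego v) - szego (compL2 b v)) := by
    rw [hilbertTr_apply, hilbertTr_apply, map_sub, map_smul, smul_sub]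
    abel
  rw [hcomm, inner_smul_right, norm_mul, RCLike.norm_ofNat, inner_sub_right, inner_basis_szego]
  have hkey : ∀ w : L2, (∀ j, ⟪basis j, w⟫_ℂ ≠ 0 → (0 ≤ j ∧ k < 0 ∨ j < 0 ∧ 0 ≤ k)) →
      ‖⟪basis k, compL2 b w⟫_ℂ‖ ≤ C / (1 + |(k : ℝ)|) ^ 2 * (c₀ * ‖w‖) := fun w hw =>
    h (compL2 b) k _ w (by positivity) fun j hj => hC k j (hw j hj)
  split_ifs with hk
  · have h1 : ⟪basis k, compL2 b (szego v)⟫_ℂ - ⟪basis k, compL2 b v⟫_ℂ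
        = -⟪basis k, compL2 b (v - szego v)⟫_ℂ := by
      rw [map_sub, inner_sub_right]
      ring
    rw [h1, norm_neg]
    have h2 := hkey (v - szego v) (fun j hj => by
      right
      refine ⟨?_, hk⟩
      by_contra hj'
      apply hj
      rw [inner_sub_right, inner_basis_szego, if_pos (not_lt.1 hj'), sub_self])
    have h3 : ‖v - szego v‖ ≤ 2 * ‖v‖ := by
      refine (norm_sub_le _ _).trans ?_
      linarith [hP v]
    calc 2 * ‖⟪basis k, compL2 b (v - szego v)⟫_ℂ‖
        ≤ 2 * (C / (1 + |(k : ℝ)|) ^ 2 * (c₀ * (2 * ‖v‖))) := by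
          refine mul_le_mul_of_nonneg_left (h2.trans ?_) two_pos.le
          gcongr
      _ = _ := by ring
  · rw [sub_zero]
    have h2 := hkey (szego v) (fun j hj => by
      left
      refine ⟨?_, not_le.1 hk⟩
      by_contra hj'
      apply hj
      rw [inner_basis_szego, if_neg hj'])
    calc 2 * ‖⟪basis k, compL2 b (szego v)⟫_ℂ‖
        ≤ 2 * (C / (1 + |(k : ℝ)|) ^ 2 * (c₀ * (2 * ‖v‖))) := by
          refine mul_le_mul_of_nonneg_left (h2.trans ?_) two_pos.le
          have := hP v
          gcongr
          linarith [norm_nonneg v]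
      _ = _ := by ring

/-! ### Invariance of the flux -/

lemma integral_deriv_mul_expo {φ ψ : ℝ → ℂ} (hφ : ∀ t, HasDerivAt φ (ψ t) t)
    (hψ : Continuous ψ) (hp : φ 1 = φ 0) (k : ℤ) :
    ∫ t in (0 : ℝ)..1, ψ t * conj (expo k (t : UnitAddCircle))
      = 2 * Real.pi * Complex.I * k *
        ∫ t in (0 : ℝ)..1, φ t * conj (expo k (t : UnitAddCircle)) := by
  have hE : ∀ t : ℝ, HasDerivAt (fun t : ℝ => conj (expo k (t : UnitAddCircle)))
      (-(2 * Real.pi * Complex.I * k) * conj (expo k (t : UnitAddCircle))) t := fun t => by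
    have hf : (fun t : ℝ => conj (expo k (t : UnitAddCircle)))
        = fun t : ℝ => Complex.exp (2 * Real.pi * Complex.I * (-k : ℤ) * t) :=
      funext fun t => by rw [conj_expo, expo_coe]
    rw [hf, conj_expo, expo_coe]
    have h1 : HasDerivAt (fun t : ℝ => (2 * Real.pi * Complex.I * (-k : ℤ) * t : ℂ))
        (2 * Real.pi * Complex.I * (-k : ℤ) * 1) t :=
      ((hasDerivAt_id t).ofReal_comp).const_mul _
    refine h1.cexp.congr_deriv ?_
    push_cast
    ring
  have cE : Continuous (fun t : ℝ => conj (expo k (t : UnitAddCircle))) :=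
    Complex.continuous_conj.comp ((continuous_expo k).comp continuous_coe)
  have cφ : Continuous φ := continuous_iff_continuousAt.2 fun t => (hφ t).continuousAt
  have c1 : Continuous fun t => ψ t * conj (expo k (t : UnitAddCircle)) := hψ.mul cE
  have c2 : Continuous fun t =>
      φ t * (-(2 * Real.pi * Complex.I * k) * conj (expo k (t : UnitAddCircle))) :=
    cφ.mul (continuous_const.mul cE)
  have h := intervalIntegral.integral_eq_sub_of_hasDerivAt (a := 0) (b := 1)
    (fun t _ => (hφ t).mul (hE t)) ((c1.add c2).intervalIntegrable _ _)
  have e0 : ((1 : ℝ) : UnitAddCircle) = ((0 : ℝ) : UnitAddCircle) := by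
    simp
  rw [intervalIntegral.integral_add (c1.intervalIntegrable _ _)
    (c2.intervalIntegrable _ _)] at h
  simp only [Pi.mul_apply, hp, e0, sub_self] at h
  rw [eq_neg_of_add_eq_zero_left h, ← intervalIntegral.integral_neg,
    ← intervalIntegral.integral_const_mul]
  congr 1
  ext t
  ring

lemma exists_continuous_toL2 {f : UnitAddCircle → ℂ} (hf : Continuous f) :
    ∃ v : L2, v =ᵐ[mu] f := by
  have h : MemLp f 2 mu := by
    obtain ⟨C, hC⟩ := isCompact_univ.exists_bound_of_continuousOn hf.continuousOn
    exact MemLp.of_bound hf.aestronglyMeasurable C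
      (Filter.Eventually.of_forall fun x => hC x (Set.mem_univ x))
  exact ⟨h.toLp f, h.coeFn_toLp⟩

/-- `(e_i ∘ b)' / (2 π i)` as a square integrable function. -/
lemma exists_flux (b : CircleDiffeo) (i : ℤ) : ∃ v : L2,
    (∀ k : ℤ, ⟪basis k, v⟫_ℂ = k * ⟪basis k, compL2 b (basis i)⟫_ℂ) ∧
    ∀ j : ℤ, ⟪compL2 b (basis j), v⟫_ℂ = if i = j then (i : ℂ) else 0 := by
  have hc : Continuous fun x => (i : ℂ) * ((circleDeriv b.toEquiv x : ℂ) *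
      expo i (b.toEquiv x)) :=
    continuous_const.mul ((Complex.continuous_ofReal.comp b.continuous_circleDeriv).mul
      ((continuous_expo i).comp b.continuous))
  obtain ⟨v, hv⟩ := exists_continuous_toL2 hc
  obtain ⟨F, G, hl⟩ := exists_isLift b
  refine ⟨v, fun k => ?_, fun j => ?_⟩
  · have hd : ∀ t, HasDerivAt (fun t : ℝ => expo i ((F t : ℝ) : UnitAddCircle))
        (2 * Real.pi * Complex.I * ((i : ℂ) * (((deriv F t : ℝ) : ℂ) *
          expo i ((F t : ℝ) : UnitAddCircle)))) t := fun t => by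
      simp only [expo_coe]
      have h1 := (((hl.hasDerivAt t).ofReal_comp).const_mul (2 * Real.pi * Complex.I * i : ℂ)).cexp
      refine h1.congr_deriv ?_
      ring
    have h1 := integral_deriv_mul_expo hd (by
      have := hl.contDiff_deriv.continuous
      have h2 : Continuous fun t => expo i ((F t : ℝ) : UnitAddCircle) :=
        (continuous_expo i).comp (continuous_coe.comp hl.smooth.continuous)
      fun_prop) (by
        have := hl.add_one 0
        rw [zero_add] at this
        simp only [this, AddCircle.coe_add_period]) k
    rw [inner_basis_compL2, inner_basis, integral_mu (fun x =>
      expo i (b.toEquiv x) * conj (expo k x))]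
    have h2 : ∫ x, v x * conj (expo k x) ∂mu = ∫ x, ((i : ℂ) * ((circleDeriv b.toEquiv x : ℂ) *
        expo i (b.toEquiv x))) * conj (expo k x) ∂mu := by
      apply integral_congr_ae
      filter_upwards [hv] with x hx
      rw [hx]
    rw [h2, integral_mu]
    simp only [← hl.coe_eq, hl.circleDeriv_coe]
    simp only [mul_assoc (2 * (Real.pi : ℂ) * Complex.I)] at h1
    rw [intervalIntegral.integral_const_mul] at h1
    have h3 : (2 * (Real.pi : ℂ) * Complex.I) ≠ 0 := by simp [Real.pi_ne_zero]
    exact mul_left_cancel₀ h3 h1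
  -- The inner product is `i ∫ b' (e_{i-j} ∘ b) dθ`, which no longer depends on `b` after a change
  -- of variables: this is the invariance of the flux.
  · rw [L2.inner_def]
    have h2 : ∫ x, ⟪(compL2 b (basis j) : UnitAddCircle → ℂ) x, v x⟫_ℂ ∂mu
        = ∫ x, (i : ℂ) * (circleDeriv b.toEquiv x • expo (i - j) (b.toEquiv x)) ∂mu := by
      apply integral_congr_ae
      filter_upwards [hv, coeFn_compL2 b (basis j),
        (quasiMeasurePreserving b).ae_eq_comp (coeFn_basis j)] with x h1 h2 h3
      rw [h1, h2, h3, RCLike.inner_apply, Function.comp_apply, conj_expo, sub_eq_add_neg,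
        expo_add_index, Complex.real_smul]
      ring
    rw [h2, integral_const_mul, integral_comp_mul_deriv_circle b (continuous_expo _),
      integral_expo]
    by_cases hij : i = j
    · subst hij
      simp
    · rw [if_neg (sub_ne_zero.2 hij), if_neg hij, mul_zero]

/-! ### Limits on the basis suffice -/

/-- Density of trigonometric polynomials plus a uniform bound. Homogeneity is only required of the
norms, so that linear and antilinear functionals are both covered. -/
lemma tendsto_of_uniform_bound {ι : Type*} {l : Filter ι} (g : ι → L2 → ℂ) (K : ℝ)
    (hadd : ∀ r v w, g r (v + w) = g r v + g r w)
    (hsmul : ∀ r (c : ℂ) v, ‖g r (c • v)‖ = ‖c‖ * ‖g r v‖)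
    (hK : ∀ᶠ r in l, ∀ v, ‖g r v‖ ≤ K * ‖v‖)
    (hb : ∀ i, Filter.Tendsto (fun r => g r (basis i)) l (𝓝 0)) (v : L2) :
    Filter.Tendsto (fun r => g r v) l (𝓝 0) := by
  have hspan : ∀ w ∈ Submodule.span ℂ (Set.range basis),
      Filter.Tendsto (fun r => g r w) l (𝓝 0) := by
    intro w hw
    induction hw using Submodule.span_induction with
    | mem x hx =>
      obtain ⟨i, rfl⟩ := hx
      exact hb i
    | zero =>
      have h0 : ∀ r, g r 0 = 0 := fun r => by
        have := hsmul r 0 0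
        rw [zero_smul, norm_zero, zero_mul, norm_eq_zero] at this
        exact this
      simp only [h0]
      exact tendsto_const_nhds
    | add x y _ _ hx hy =>
      simp only [hadd]
      simpa using hx.add hy
    | smul c x _ hx =>
      rw [tendsto_zero_iff_norm_tendsto_zero] at hx ⊢
      simp only [hsmul]
      simpa using hx.const_mul ‖c‖
  rw [Metric.tendsto_nhds]
  intro ε hε
  have hv : v ∈ closure ((Submodule.span ℂ (Set.range basis) : Submodule ℂ L2) : Set L2) := by
    rw [← Submodule.topologicalClosure_coe, basis.dense_span]
    trivial
  obtain ⟨w, hw, hvw⟩ := Metric.mem_closure_iff.1 hv (ε / 2 / (|K| + 1)) (by positivity)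
  filter_upwards [hK, (Metric.tendsto_nhds.1 (hspan w hw)) (ε / 2) (by positivity)] with r h1 h2
  rw [dist_zero_right] at h2 ⊢
  have h3 : g r v = g r (v - w) + g r w := by rw [← hadd, sub_add_cancel]
  rw [dist_eq_norm] at hvw
  have h4 : ‖g r (v - w)‖ ≤ ε / 2 := by
    refine (h1 _).trans ?_
    have h5 : ‖v - w‖ * (|K| + 1) < ε / 2 := (lt_div_iff₀ (by positivity)).1 hvw
    nlinarith [le_abs_self K, norm_nonneg (v - w)]
  rw [h3]
  refine (norm_add_le _ _).trans_lt ?_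
  linarith

lemma tendsto_inner_of_basis {ι : Type*} {l : Filter ι} (N : ι → L2 →L[ℂ] L2) (K : ℝ)
    (hK : ∀ᶠ r in l, ∀ v w, ‖⟪w, N r v⟫_ℂ‖ ≤ K * ‖v‖ * ‖w‖)
    (hb : ∀ i j, Filter.Tendsto (fun r => ⟪basis j, N r (basis i)⟫_ℂ) l (𝓝 0)) (v w : L2) :
    Filter.Tendsto (fun r => ⟪w, N r v⟫_ℂ) l (𝓝 0) := by
  refine tendsto_of_uniform_bound (fun r v => ⟪w, N r v⟫_ℂ) (K * ‖w‖)
    (fun r v v' => by simp only [map_add, inner_add_right])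
    (fun r c v => by simp only [map_smul, inner_smul_right, norm_mul]) ?_ (fun i => ?_) v
  · filter_upwards [hK] with r h v
    refine (h v w).trans (le_of_eq (by ring))
  · refine tendsto_of_uniform_bound (fun r w => ⟪w, N r (basis i)⟫_ℂ) (K * ‖basis i‖)
      (fun r v v' => by simp only [inner_add_left])
      (fun r c v => by simp only [inner_smul_left, norm_mul, RCLike.norm_conj]) ?_
      (fun j => hb i j) w
    filter_upwards [hK] with r h v using h (basis i) v

/-! ### The flux identity for invariant functions -/

lemma regParam_tendsto : Filter.Tendsto regParam (𝓝[<] 1) (𝓝[>] 0) := by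
  refine tendsto_nhdsWithin_iff.2 ⟨?_, ?_⟩
  · have : ContinuousAt regParam 1 := by
      unfold regParam
      exact ContinuousAt.div (by fun_prop) (by fun_prop) (by norm_num)
    have h := this.tendsto
    rw [show regParam 1 = 0 by simp [regParam]] at h
    exact h.mono_left nhdsWithin_le_nhds
  · have h0 : ∀ᶠ r : ℝ in 𝓝[<] 1, 0 < r :=
      nhdsWithin_le_nhds (lt_mem_nhds one_pos)
    filter_upwards [self_mem_nhdsWithin, h0] with r h1 h0
    exact regParam_pos h0 h1

lemma norm_sub_sq_le_of_lipschitz {w : UnitAddCircle → ℂ} {C : ℝ}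
    (h : ∀ x y, ‖w x - w y‖ ≤ C * ‖x - y‖) (x y : UnitAddCircle) :
    ‖w x - w y‖ ^ 2 ≤ C ^ 2 * sinSq (x - y) := by
  have h1 := four_mul_norm_sq_le_sinSq (x - y)
  calc ‖w x - w y‖ ^ 2 ≤ (C * ‖x - y‖) ^ 2 := by gcongr; exact h x y
    _ = C ^ 2 * ‖x - y‖ ^ 2 := by ring
    _ ≤ _ := by
      gcongr
      nlinarith [sq_nonneg ‖x - y‖]

lemma norm_expo_sub_le (j : ℤ) (x y : UnitAddCircle) :
    ‖expo j x - expo j y‖ ≤ 2 * Real.pi * |(j : ℝ)| * ‖x - y‖ := by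
  have h1 : expo j x - expo j y = expo j y * (expo j (x - y) - 1) := by
    rw [expo_sub, mul_sub, mul_one]
    linear_combination (-expo j x) * expo_mul_conj j y
  rw [h1, norm_mul, norm_expo, one_mul, ← abs_coord]
  conv_lhs => rw [← coe_coord (x - y)]
  rw [expo_coe, show (2 * Real.pi * Complex.I * j * (coord (x - y) : ℝ) : ℂ)
    = Complex.I * ((2 * Real.pi * j * coord (x - y) : ℝ) : ℂ) by push_cast; ring]
  refine (Real.norm_exp_I_mul_ofReal_sub_one_le).trans (le_of_eq ?_)
  rw [Real.norm_eq_abs, abs_mul, abs_mul, abs_mul, abs_two, abs_of_pos Real.pi_pos]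

lemma exists_expo_comp_lipschitz (b : CircleDiffeo) (j : ℤ) : ∃ L : ℝ, ∀ x y,
    ‖expo j (b.toEquiv x) - expo j (b.toEquiv y)‖ ^ 2 ≤ L * sinSq (x - y) := by
  obtain ⟨C, hC0, hC⟩ := exists_norm_sub_le b
  refine ⟨_, norm_sub_sq_le_of_lipschitz (w := fun x => expo j (b.toEquiv x))
    (C := 2 * Real.pi * |(j : ℝ)| * C) fun x y => ?_⟩
  refine (norm_expo_sub_le j _ _).trans ?_
  rw [mul_assoc _ C]
  gcongr
  exact hC x y

/-- As `r → 1`, sign times multiplier tends to `sign(k) |k| = k`, and the series becomes the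
Parseval series of the flux given by `exists_flux`. That series is absolutely summable and, because
`energyMult r k ≤ |k|`, dominates. -/
lemma tendsto_energy_comp (b : CircleDiffeo) (M : ℝ → L2 →L[ℂ] L2)
    (hM : ∀ r, 0 < r → r < 1 → ∀ (n : ℤ) (v : L2),
      ⟪basis n, M r v⟫_ℂ = (energyMult r n : ℂ) * ⟪basis n, v⟫_ℂ) (i j : ℤ) :
    Filter.Tendsto (fun r => ⟪hilbertTr (compL2 b (basis j)), M r (compL2 b (basis i))⟫_ℂ)
      (𝓝[<] 1) (𝓝 (if i = j then (i : ℂ) else 0)) := by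
  obtain ⟨v, hv, hv'⟩ := exists_flux b i
  have hsum := basis.hasSum_inner_mul_inner (compL2 b (basis j)) v
  rw [hv'] at hsum
  simp only [hv] at hsum
  rw [← hsum.tsum_eq]
  have h0 : ∀ᶠ r : ℝ in 𝓝[<] 1, 0 < r ∧ r < 1 := by
    filter_upwards [self_mem_nhdsWithin, nhdsWithin_le_nhds (lt_mem_nhds one_pos)] with r h1 h0
    exact ⟨h0, h1⟩
  have hcoef : ∀ k, ⟪hilbertTr (compL2 b (basis j)), basis k⟫_ℂ
      = freqSign k * ⟪compL2 b (basis j), basis k⟫_ℂ := fun k => by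
    rw [← inner_conj_symm, inner_basis_hilbertTr, map_mul, conj_freqSign, inner_conj_symm]
  have heq : ∀ r, 0 < r → r < 1 →
      ⟪hilbertTr (compL2 b (basis j)), M r (compL2 b (basis i))⟫_ℂ
      = ∑' k, freqSign k * ⟪compL2 b (basis j), basis k⟫_ℂ *
          ((energyMult r k : ℂ) * ⟪basis k, compL2 b (basis i)⟫_ℂ) := fun r hr0 hr1 => by
    rw [← basis.tsum_inner_mul_inner]
    exact tsum_congr fun k => by rw [hM r hr0 hr1, hcoef]
  have hlim : Filter.Tendsto (fun r => ∑' k, freqSign k * ⟪compL2 b (basis j), basis k⟫_ℂ *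
          ((energyMult r k : ℂ) * ⟪basis k, compL2 b (basis i)⟫_ℂ)) (𝓝[<] 1)
      (𝓝 (∑' k, ⟪compL2 b (basis j), basis k⟫_ℂ * (k * ⟪basis k, compL2 b (basis i)⟫_ℂ))) := by
    refine tendsto_tsum_of_dominated_convergence hsum.summable.norm (fun k => ?_) ?_
    · have h1 : Filter.Tendsto (fun r => ((energyMult r k : ℝ) : ℂ)) (𝓝[<] 1)
          (𝓝 ((k.natAbs : ℝ) : ℂ)) :=
        (Complex.continuous_ofReal.tendsto _).comp (tendsto_energyMult k)
      have h2 := (h1.mul_const ⟪basis k, compL2 b (basis i)⟫_ℂ).const_mul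
        (freqSign k * ⟪compL2 b (basis j), basis k⟫_ℂ)
      convert! h2 using 2
      rw [← freqSign_mul_natAbs k]
      push_cast
      ring
    · filter_upwards [h0] with r hr k
      rw [norm_mul, norm_mul, norm_mul, norm_mul, norm_mul, norm_freqSign, one_mul,
        Complex.norm_real, Real.norm_eq_abs, abs_of_nonneg (energyMult_nonneg hr.1 hr.2 k)]
      have h3 : ‖(k : ℂ)‖ = k.natAbs := by
        rw [Complex.norm_intCast, Nat.cast_natAbs]
        push_cast
        rfl
      rw [h3]
      gcongr
      exact energyMult_le hr.1 hr.2 k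
  refine hlim.congr' ?_
  filter_upwards [h0] with r hr
  exact (heq r hr.1 hr.2).symm

/-- With `B` the composition, `H` the sign of the frequency and `M r` the regularized `|D|`, compare
the fluxes `⟨H B w, M B v⟩` and `⟨H w, M v⟩`. Moving `H` past `B` costs the commutator, and moving
`B` past `M` costs `bddKernel` and `resKernel`. The first two costs are bounded uniformly in `r`. At
an invariant function the two fluxes agree, so only the form of `resKernel` is left. -/
lemma tendsto_form_of_invariant (b : CircleDiffeo) {f : L2} (hf : compL2 b f = f) :
    Filter.Tendsto (fun r => form (resKernel b (regParam r)) (compL2 b f)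
      (compL2 b (hilbertTr f))) (𝓝[<] 1) (𝓝 0) := by
  have h0 : ∀ᶠ r : ℝ in 𝓝[<] 1, 0 < r ∧ r < 1 := by
    filter_upwards [self_mem_nhdsWithin, nhdsWithin_le_nhds (lt_mem_nhds one_pos)] with r h1 h0
    exact ⟨h0, h1⟩
  -- Outside `(0, 1)` the operators are given the value `0`; only `r` near `1` matters.
  have hex : ∀ r : ℝ, ∃ T : L2 →L[ℂ] L2, 0 < r → r < 1 → (∀ v w : L2, ⟪w, T v⟫_ℂ =
        (((1 + r) / (8 * r) : ℝ) : ℂ) * form (regKernel (regParam r)) v w) ∧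
      ∀ (n : ℤ) (v : L2), ⟪basis n, T v⟫_ℂ = (energyMult r n : ℂ) * ⟪basis n, v⟫_ℂ := fun r => by
    by_cases hr : 0 < r ∧ r < 1
    · obtain ⟨T, hT⟩ := exists_energyOp hr.1 hr.2
      exact ⟨T, fun _ _ => hT⟩
    · exact ⟨0, fun h1 h2 => absurd ⟨h1, h2⟩ hr⟩
  choose M hM using hex
  obtain ⟨R, hR⟩ := exists_abs_bddKernel_le b
  have hex2 : ∀ r : ℝ, ∃ T : L2 →L[ℂ] L2, 0 < r → r < 1 →
      (∀ v w : L2, ⟪w, T v⟫_ℂ = form (bddKernel b (regParam r)) v w) ∧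
      ∀ v w : L2, ‖⟪w, T v⟫_ℂ‖ ≤ 4 * R * ‖v‖ * ‖w‖ := fun r => by
    by_cases hr : 0 < r ∧ r < 1
    · have hd := regParam_pos hr.1 hr.2
      obtain ⟨T, hT⟩ := exists_formL2 (continuous_bddKernel b hd).measurable (hR _ hd)
      exact ⟨T, fun _ _ => hT⟩
    · exact ⟨0, fun h1 h2 => absurd ⟨h1, h2⟩ hr⟩
  choose S hS using hex2
  set B := compL2 b with hB
  set H := hilbertTr with hH
  let C : L2 →L[ℂ] L2 := B.comp H - H.comp B
  have hCa : ∀ v, C v = B (H v) - H (B v) := fun v => rfl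
  -- `N r` has two expressions. As a commutator term minus a `bddKernel` term (`hN1`) it is
  -- uniformly bounded; as a `resKernel` term minus a difference of fluxes (`hN2`) it tends to `0`
  -- on characters. Together these give weak convergence to `0` on all of `L²`.
  let N : ℝ → L2 →L[ℂ] L2 := fun r =>
    (ContinuousLinearMap.adjoint C).comp ((M r).comp B) - (((1 + r) / (8 * r) : ℝ) : ℂ) •
      (ContinuousLinearMap.adjoint (B.comp H)).comp ((S r).comp B)
  have hN1 : ∀ r v w, ⟪w, N r v⟫_ℂ = ⟪C w, M r (B v)⟫_ℂ -
      (((1 + r) / (8 * r) : ℝ) : ℂ) * ⟪B (H w), S r (B v)⟫_ℂ := fun r v w => by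
    simp only [N, _root_.sub_apply, _root_.smul_apply,
      ContinuousLinearMap.comp_apply, inner_sub_right, inner_smul_right,
      ContinuousLinearMap.adjoint_inner_right]
  have hN2 : ∀ r, 0 < r → r < 1 → ∀ v w, ⟪w, N r v⟫_ℂ =
      (((1 + r) / (8 * r) : ℝ) : ℂ) * form (resKernel b (regParam r)) (B v) (B (H w))
        - (⟪H (B w), M r (B v)⟫_ℂ - ⟪H w, M r v⟫_ℂ) := fun r h0 h1 v w => by
    have hd := regParam_pos h0 h1
    obtain ⟨R', -, hR'⟩ := exists_abs_le_of_continuous (continuous_resKernel b hd)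
    obtain ⟨J, -, hJ⟩ := exists_abs_le_of_continuous ((continuous_jac b).mul
      ((continuous_regKernel hd).comp ((b.continuous.comp continuous_fst).prodMk
        (b.continuous.comp continuous_snd))))
    have e1 : form (regKernel (regParam r)) (B v) (B (H w)) - form (regKernel (regParam r)) v (H w)
        = form (bddKernel b (regParam r)) (B v) (B (H w))
          + form (resKernel b (regParam r)) (B v) (B (H w)) := by
      rw [← form_compL2 b (continuous_regKernel hd).measurable v (H w)]
      have k1 := form_sub_kernel (continuous_regKernel hd).measurable
        ((continuous_jac b).mul ((continuous_regKernel hd).comp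
          ((b.continuous.comp continuous_fst).prodMk
            (b.continuous.comp continuous_snd)))).measurable (abs_regKernel_le hd) hJ (B v) (B (H w))
      have k2 := form_sub_kernel ((continuous_regKernel hd).sub ((continuous_jac b).mul
          ((continuous_regKernel hd).comp ((b.continuous.comp continuous_fst).prodMk
            (b.continuous.comp continuous_snd))))).measurable (continuous_resKernel b hd).measurable
          (M := R + R') (fun z => by
            have := kernel_decomp b hd z
            change |regKernel (regParam r) z - jac b z * regKernel (regParam r)
              (b.toEquiv z.1, b.toEquiv z.2)| ≤ _
            rw [this]
            exact (abs_add_le _ _).trans (add_le_add (hR _ hd z) (hR' z))) hR' (B v) (B (H w))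
      have k3 : (fun z => (regKernel (regParam r) - fun z => jac b z * (regKernel (regParam r) ∘
          fun z => (b.toEquiv z.1, b.toEquiv z.2)) z) z - resKernel b (regParam r) z)
          = bddKernel b (regParam r) := by
        ext z
        have := kernel_decomp b hd z
        simp only [Pi.sub_apply, Function.comp_apply]
        linarith
      rw [← k3]
      refine eq_add_of_sub_eq ?_
      refine Eq.trans ?_ k2.symm
      congr 1
      exact k1.symm
    rw [hN1, hCa, inner_sub_left, (hM r h0 h1).1 _ (B (H w)), (hM r h0 h1).1 _ (H w),
      (hS r h0 h1).1]
    linear_combination (((1 + r) / (8 * r) : ℝ) : ℂ) * e1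
  obtain ⟨K, hK0, hK⟩ := exists_commutator_le b
  obtain ⟨c₀, hc0, hc⟩ := exists_norm_tsum_le
  have hbound : ∀ᶠ r : ℝ in 𝓝[<] 1, ∀ v w, ‖⟪w, N r v⟫_ℂ‖ ≤
      (K * c₀ * ‖B‖ + 4 * |R| * ‖B‖ * (‖B‖ * ‖H‖)) * ‖v‖ * ‖w‖ := by
    have hhalf : ∀ᶠ r : ℝ in 𝓝[<] 1, 1 / 2 < r :=
      nhdsWithin_le_nhds (lt_mem_nhds (by norm_num))
    filter_upwards [h0, hhalf] with r hr hr2 v w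
    have hκ : ‖(((1 + r) / (8 * r) : ℝ) : ℂ)‖ ≤ 1 := by
      rw [Complex.norm_real, Real.norm_eq_abs, abs_of_nonneg (div_nonneg (by linarith [hr.1])
        (by linarith [hr.1])), div_le_one (by linarith [hr.1])]
      linarith
    rw [hN1]
    have hB1 : ‖B v‖ ≤ ‖B‖ * ‖v‖ := B.le_opNorm v
    have hB2 : ‖B (H w)‖ ≤ ‖B‖ * (‖H‖ * ‖w‖) :=
      (B.le_opNorm _).trans (mul_le_mul_of_nonneg_left (H.le_opNorm w) (norm_nonneg _))
    -- One of the two powers of decay of the commutator absorbs the multiplier, which is at most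
    -- `|k|`; the other is the weight needed in `exists_norm_tsum_le`.
    have t1 : ‖⟪C w, M r (B v)⟫_ℂ‖ ≤ K * c₀ * ‖B‖ * ‖v‖ * ‖w‖ := by
      rw [← basis.tsum_inner_mul_inner]
      have h5 := hc (fun k => ⟪C w, basis k⟫_ℂ * (energyMult r k : ℂ)) (K * ‖w‖) (B v)
        (fun k => by
          rw [norm_mul, ← inner_conj_symm, RCLike.norm_conj, Complex.norm_real, Real.norm_eq_abs,
            abs_of_nonneg (energyMult_nonneg hr.1 hr.2 k)]
          have h6 := hK k w
          have h7 := energyMult_le hr.1 hr.2 k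
          have h8 : (k.natAbs : ℝ) = |(k : ℝ)| := by rw [Nat.cast_natAbs]; push_cast; rfl
          rw [h8] at h7
          calc ‖⟪basis k, C w⟫_ℂ‖ * energyMult r k
              ≤ (K / (1 + |(k : ℝ)|) ^ 2 * ‖w‖) * (1 + |(k : ℝ)|) := by
                refine mul_le_mul h6 (by linarith) (energyMult_nonneg hr.1 hr.2 k) (by positivity)
            _ = _ := by field_simp)
      have h9 : ∑' k, ⟪C w, basis k⟫_ℂ * ⟪basis k, M r (B v)⟫_ℂ
          = ∑' k, ⟪C w, basis k⟫_ℂ * (energyMult r k : ℂ) * ⟪basis k, B v⟫_ℂ :=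
        tsum_congr fun k => by rw [(hM r hr.1 hr.2).2, mul_assoc]
      rw [h9]
      refine h5.trans ?_
      calc K * ‖w‖ * (c₀ * ‖B v‖) ≤ K * ‖w‖ * (c₀ * (‖B‖ * ‖v‖)) := by gcongr
        _ = _ := by ring
    have t2 : ‖(((1 + r) / (8 * r) : ℝ) : ℂ) * ⟪B (H w), S r (B v)⟫_ℂ‖
        ≤ 4 * |R| * ‖B‖ * (‖B‖ * ‖H‖) * ‖v‖ * ‖w‖ := by
      rw [norm_mul]
      calc _ ≤ 1 * (4 * R * ‖B v‖ * ‖B (H w)‖) :=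
            mul_le_mul hκ ((hS r hr.1 hr.2).2 _ _) (norm_nonneg _) zero_le_one
        _ = 4 * R * (‖B v‖ * ‖B (H w)‖) := by ring
        _ ≤ 4 * |R| * ((‖B‖ * ‖v‖) * (‖B‖ * (‖H‖ * ‖w‖))) := by
            gcongr
            exact le_abs_self R
        _ = _ := by ring
    calc _ ≤ _ := norm_sub_le _ _
      _ ≤ _ := add_le_add t1 t2
      _ = _ := by ring
  have hκlim : Filter.Tendsto (fun r : ℝ => (((1 + r) / (8 * r) : ℝ) : ℂ)) (𝓝[<] 1)
      (𝓝 (1 / 4)) := by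
    have h1 : ContinuousAt (fun r : ℝ => (1 + r) / (8 * r)) 1 :=
      ContinuousAt.div (by fun_prop) (by fun_prop) (by norm_num)
    have h2 := (Complex.continuous_ofReal.tendsto _).comp (h1.tendsto.mono_left
      (nhdsWithin_le_nhds (s := Set.Iio 1)))
    convert! h2 using 2
    norm_num
  -- On characters both fluxes have the same limit, and the form of `resKernel` vanishes in the
  -- limit because characters composed with `b` are Lipschitz.
  have hbasis : ∀ i j, Filter.Tendsto (fun r => ⟪basis j, N r (basis i)⟫_ℂ) (𝓝[<] 1) (𝓝 0) := by
    intro i j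
    have h1 := tendsto_energy_comp b M (fun r h0 h1 => (hM r h0 h1).2) i j
    have h2 : Filter.Tendsto (fun r => ⟪H (basis j), M r (basis i)⟫_ℂ) (𝓝[<] 1)
        (𝓝 (if i = j then (i : ℂ) else 0)) := by
      have h3 : Filter.Tendsto (fun r => freqSign j * ((energyMult r j : ℂ) *
          (if j = i then 1 else 0))) (𝓝[<] 1) (𝓝 (freqSign j * (((j.natAbs : ℝ) : ℂ) *
          (if j = i then 1 else 0)))) :=
        (((Complex.continuous_ofReal.tendsto _).comp (tendsto_energyMult j)).mul_const _).const_mul _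
      have h4 : freqSign j * (((j.natAbs : ℝ) : ℂ) * (if j = i then 1 else 0))
          = if i = j then (i : ℂ) else 0 := by
        rw [← mul_assoc]
        have := freqSign_mul_natAbs j
        rw [Complex.ofReal_natCast, this]
        by_cases hij : i = j
        · subst hij; simp
        · rw [if_neg hij, if_neg (Ne.symm hij), mul_zero]
      rw [← h4]
      refine h3.congr' ?_
      filter_upwards [h0] with r hr
      rw [hH, hilbertTr_basis, inner_smul_left, conj_freqSign, (hM r hr.1 hr.2).2,
        orthonormal_iff_ite.1 basis.orthonormal j i]
    obtain ⟨K1, hL1⟩ := exists_expo_comp_lipschitz b i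
    obtain ⟨K2, hL2⟩ := exists_expo_comp_lipschitz b j
    have h5 := tendsto_form_resKernel b (v := expo i ∘ b.toEquiv) (w := expo j ∘ b.toEquiv)
      (L := max K1 K2)
      (fun x y => (hL1 x y).trans (mul_le_mul_of_nonneg_right (le_max_left _ _) (sinSq_nonneg _)))
      (fun x y => (hL2 x y).trans (mul_le_mul_of_nonneg_right (le_max_right _ _) (sinSq_nonneg _)))
    have h6 := (h5.comp regParam_tendsto)
    have h7 := ((hκlim.mul h6).const_mul (freqSign j)).sub (h1.sub h2)
    rw [mul_zero, mul_zero, sub_self, sub_self] at h7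
    refine h7.congr' ?_
    filter_upwards [h0] with r hr
    rw [hN2 r hr.1 hr.2, hH, hilbertTr_basis, map_smul]
    congr 1
    have c1 : (B (basis i) : UnitAddCircle → ℂ) =ᵐ[mu] expo i ∘ b.toEquiv :=
      (coeFn_compL2 b _).trans ((quasiMeasurePreserving b).ae_eq_comp (coeFn_basis i))
    have c2 : (B (basis j) : UnitAddCircle → ℂ) =ᵐ[mu] expo j ∘ b.toEquiv :=
      (coeFn_compL2 b _).trans ((quasiMeasurePreserving b).ae_eq_comp (coeFn_basis j))
    have c3 : ((freqSign j • B (basis j) : L2) : UnitAddCircle → ℂ) =ᵐ[mu]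
        freqSign j • (expo j ∘ b.toEquiv) := by
      filter_upwards [Lp.coeFn_smul (freqSign j) (B (basis j)), c2] with x e1 e2
      rw [e1, Pi.smul_apply, Pi.smul_apply, e2]
    rw [form_congr c1 c3]
    have c4 : form (resKernel b (regParam r)) (expo i ∘ b.toEquiv)
        (freqSign j • (expo j ∘ b.toEquiv)) = freqSign j *
        form (resKernel b (regParam r)) (expo i ∘ b.toEquiv) (expo j ∘ b.toEquiv) := by
      rw [form, form, ← integral_const_mul]
      congr 1
      ext z
      simp only [diff, Pi.smul_apply, smul_eq_mul]
      rw [← mul_sub, map_mul, conj_freqSign]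
      ring
    rw [c4, Function.comp_apply]
    ring
  have hmain := tendsto_inner_of_basis N _ hbound hbasis f f
  have h8 := hmain.div hκlim (by norm_num)
  rw [zero_div] at h8
  refine h8.congr' ?_
  filter_upwards [h0] with r hr
  simp only [Pi.div_apply]
  rw [hN2 r hr.1 hr.2, hf, sub_self, sub_zero, mul_comm, mul_div_assoc, div_self, mul_one]
  have : (1 + r) / (8 * r) ≠ 0 := (div_pos (by linarith [hr.1]) (by linarith [hr.1])).ne'
  exact_mod_cast this

/-! ### Contraction at attracting fixed points -/

lemma contDiff_iterate {F : ℝ → ℝ} (hF : ContDiff ℝ ∞ F) (n : ℕ) : ContDiff ℝ ∞ (F^[n]) := by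
  induction n with
  | zero => exact contDiff_id
  | succ n ih => exact ih.comp hF

lemma isLift_iter {b : CircleDiffeo} {F G : ℝ → ℝ} (h : IsLift b F G) (n : ℕ) :
    IsLift (b.iter n) (F^[n]) (G^[n]) := by
  have hF : ∀ (n : ℕ) (t : ℝ), F^[n] (t + 1) = F^[n] t + 1 := fun n => by
    induction n with
    | zero => intro t; rfl
    | succ n ih => intro t; rw [Function.iterate_succ_apply, h.add_one, ih,
        Function.iterate_succ_apply]
  have hc : ∀ (n : ℕ) (t : ℝ), ((F^[n] t : ℝ) : UnitAddCircle) = b.toEquiv^[n] t := fun n => by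
    induction n with
    | zero => intro t; rfl
    | succ n ih => intro t; rw [Function.iterate_succ_apply, ih, h.coe_eq,
        Function.iterate_succ_apply]
  have hsm : ContDiff ℝ ∞ (F^[n]) := contDiff_iterate h.smooth n
  have hinv : ∀ t, F^[n] (G^[n] t) = t := Function.RightInverse.iterate h.right_inv n
  refine ⟨hsm, contDiff_iterate h.smooth_inv n, Function.LeftInverse.iterate h.left_inv n, hinv,
    hF n, fun t => by rw [hc, CircleDiffeo.iter_apply], fun t => ?_, fun t => ?_⟩
  · rw [Equiv.eq_symm_apply, CircleDiffeo.iter_apply, ← hc, hinv]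
  · have := (b.iter n).circleDeriv_pos t
    rwa [circleDeriv_eq (F := F^[n]) (fun t => by rw [hc, CircleDiffeo.iter_apply])
      hsm.continuous.continuousAt] at this

lemma IsLift.exists_contraction {b : CircleDiffeo} {F G : ℝ → ℝ} (h : IsLift b F G) {x : ℝ}
    (hx : F x = x) (h1 : deriv F x < 1) : ∃ η l : ℝ, 0 < η ∧ η < 1 / 2 ∧ 0 < l ∧ l < 1 ∧
      (∀ t, |t - x| ≤ η → deriv F t ≤ l) ∧ ∀ t, |t - x| ≤ η → |F t - x| ≤ l * |t - x| := by
  obtain ⟨l, hl1, hl2⟩ := exists_between h1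
  have hev : ∀ᶠ t in 𝓝 x, deriv F t < l :=
    h.contDiff_deriv.continuous.continuousAt.eventually (Iio_mem_nhds hl1)
  obtain ⟨ε, hε, hεb⟩ := Metric.eventually_nhds_iff.1 hev
  have hd : ∀ t, |t - x| ≤ min (ε / 2) (1 / 4) → deriv F t ≤ l := fun t ht => by
    refine (hεb ?_).le
    rw [Real.dist_eq]
    linarith [min_le_left (ε / 2) (1 / 4 : ℝ)]
  have hl0 : 0 < l := (h.deriv_pos x).trans hl1
  refine ⟨min (ε / 2) (1 / 4), l, by positivity, ?_, hl0, hl2, hd, fun t ht => ?_⟩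
  · linarith [min_le_right (ε / 2) (1 / 4 : ℝ)]
  · have := abs_sub_le_of_abs_deriv_le (h.smooth.differentiable (by simp)) (t := x) (h := t - x)
      (K := l) (fun y hy => by
        rw [abs_of_pos (h.deriv_pos y)]
        exact hd y (hy.trans ht))
    rwa [add_sub_cancel, hx] at this

lemma iterate_contraction {F : ℝ → ℝ} {x η l : ℝ} (hl0 : 0 < l) (hl1 : l < 1)
    (hc : ∀ t, |t - x| ≤ η → |F t - x| ≤ l * |t - x|) (n : ℕ) {t : ℝ} (ht : |t - x| ≤ η) :
    |F^[n] t - x| ≤ l ^ n * |t - x| := by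
  induction n with
  | zero => simp
  | succ n ih =>
    rw [Function.iterate_succ_apply']
    have h1 : |F^[n] t - x| ≤ η := by
      refine ih.trans (le_trans ?_ ht)
      exact mul_le_of_le_one_left (abs_nonneg _) (pow_le_one₀ hl0.le hl1.le)
    calc _ ≤ l * |F^[n] t - x| := hc _ h1
      _ ≤ l * (l ^ n * |t - x|) := by gcongr
      _ = _ := by ring

/-- Bounded distortion: `log (F^[n])'(t) - n log F'(x)` is a sum of differences of `log F'` along
the orbit. These are bounded by a Lipschitz constant times `l ^ i η`, so the sum is bounded by a
geometric series. -/
lemma IsLift.exists_distortion {b : CircleDiffeo} {F G : ℝ → ℝ} (h : IsLift b F G) {x : ℝ}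
    {η l : ℝ} (hl0 : 0 < l) (hl1 : l < 1)
    (hc : ∀ t, |t - x| ≤ η → |F t - x| ≤ l * |t - x|) :
    ∃ K : ℝ, 0 < K ∧ ∀ (n : ℕ) (t : ℝ), |t - x| ≤ η →
      deriv F x ^ n / K ≤ deriv (F^[n]) t ∧ deriv (F^[n]) t ≤ K * deriv F x ^ n := by
  have hs2 : ContDiff ℝ ∞ (deriv (deriv F)) := (contDiff_infty_iff_deriv.1 h.contDiff_deriv).2
  obtain ⟨c, C, hc0, hcC⟩ := exists_circleDeriv_bounds b
  have hcF : ∀ t, c ≤ deriv F t := fun t => by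
    rw [← h.circleDeriv_coe]
    exact (hcC _).1
  obtain ⟨A, hA0, hA⟩ := exists_abs_le_of_periodic (periodic_deriv h.deriv_periodic) hs2.continuous
  have dlog : ∀ t, HasDerivAt (fun t => Real.log (deriv F t)) (deriv (deriv F) t / deriv F t) t :=
    fun t => ((h.contDiff_deriv.differentiable (by simp) t).hasDerivAt).log (h.deriv_pos t).ne'
  have hlog : ∀ t, |Real.log (deriv F t) - Real.log (deriv F x)| ≤ A / c * |t - x| := fun t => by
    have := abs_sub_le_of_abs_deriv_le (f := fun t => Real.log (deriv F t)) (t := x) (h := t - x)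
      (K := A / c) (fun t => (dlog t).differentiableAt) (fun y _ => by
        rw [(dlog y).deriv, abs_div, abs_of_pos (h.deriv_pos y)]
        exact div_le_div₀ hA0 (hA y) hc0 (hcF y))
    rwa [add_sub_cancel] at this
  have hderiv : ∀ (n : ℕ) (t : ℝ),
      deriv (F^[n + 1]) t = deriv F (F^[n] t) * deriv (F^[n]) t := fun n t => by
    rw [Function.iterate_succ']
    exact ((h.hasDerivAt _).comp t ((isLift_iter h n).hasDerivAt t)).deriv
  have hsum : ∀ (n : ℕ) (t : ℝ), |t - x| ≤ η →
      |Real.log (deriv (F^[n]) t) - n * Real.log (deriv F x)|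
        ≤ A / c * η * ∑ i ∈ Finset.range n, l ^ i := fun n t ht => by
    induction n with
    | zero => simp
    | succ n ih =>
      rw [hderiv, Real.log_mul (h.deriv_pos _).ne' ((isLift_iter h n).deriv_pos t).ne',
        Finset.sum_range_succ]
      have h2 := hlog (F^[n] t)
      have h3 := iterate_contraction hl0 hl1 hc n ht
      have h4 : A / c * |F^[n] t - x| ≤ A / c * (l ^ n * η) := by gcongr; exact h3.trans (by gcongr)
      calc _ = |(Real.log (deriv F (F^[n] t)) - Real.log (deriv F x)) +
            (Real.log (deriv (F^[n]) t) - n * Real.log (deriv F x))| := by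
              congr 1; push_cast; ring
        _ ≤ _ := abs_add_le _ _
        _ ≤ A / c * (l ^ n * η) + A / c * η * ∑ i ∈ Finset.range n, l ^ i :=
              add_le_add (h2.trans h4) ih
        _ = _ := by ring
  refine ⟨Real.exp (A / c * |η| * (1 - l)⁻¹), Real.exp_pos _, fun n t ht => ?_⟩
  have hη : 0 ≤ η := (abs_nonneg _).trans ht
  rw [abs_of_nonneg hη]
  have hgeom : ∑ i ∈ Finset.range n, l ^ i ≤ (1 - l)⁻¹ := by
    rw [← tsum_geometric_of_lt_one hl0.le hl1]
    exact (summable_geometric_of_lt_one hl0.le hl1).sum_le_tsum _ (fun i _ => by positivity)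
  have h5 : A / c * η * ∑ i ∈ Finset.range n, l ^ i ≤ A / c * η * (1 - l)⁻¹ := by gcongr
  have h6 := abs_le.1 ((hsum n t ht).trans h5)
  have hpos := (isLift_iter h n).deriv_pos t
  have e1 : deriv F x ^ n = Real.exp (n * Real.log (deriv F x)) := by
    rw [Real.exp_nat_mul, Real.exp_log (h.deriv_pos x)]
  have e2 : deriv (F^[n]) t = Real.exp (Real.log (deriv (F^[n]) t)) := (Real.exp_log hpos).symm
  rw [e1, e2, ← Real.exp_sub, ← Real.exp_add]
  constructor <;> apply Real.exp_le_exp.2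
  · linarith [h6.1]
  · linarith [h6.2]

/-- Near an attracting fixed point all iterates contract at the rate of the multiplier. -/
lemma exists_iter_bounds (b : CircleDiffeo) {x : UnitAddCircle} (hx : b.toEquiv x = x)
    (h1 : circleDeriv b.toEquiv x < 1) :
    ∃ η K : ℝ, 0 < η ∧ η < 1 / 2 ∧ 0 < K ∧ ∀ (n : ℕ) (y : UnitAddCircle), ‖y - x‖ ≤ η →
      circleDeriv b.toEquiv x ^ n / K ≤ circleDeriv (b.iter n).toEquiv y ∧
      circleDeriv (b.iter n).toEquiv y ≤ K * circleDeriv b.toEquiv x ^ n ∧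
      ‖(b.iter n).toEquiv y - x‖ ≤ K * circleDeriv b.toEquiv x ^ n * ‖y - x‖ ∧
      ‖(b.iter n).toEquiv y - x‖ ≤ η := by
  obtain ⟨x, rfl⟩ := exists_coe x
  obtain ⟨F, G, h, hFx⟩ := exists_isLift_fixed b hx
  rw [h.circleDeriv_coe] at h1 ⊢
  obtain ⟨η, l, hη, hη2, hl0, hl1, -, hc⟩ := h.exists_contraction hFx h1
  obtain ⟨K, hK0, hK⟩ := h.exists_distortion hl0 hl1 hc
  refine ⟨η, K, hη, hη2, hK0, fun n y hy => ?_⟩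
  have hy' : y = ((x + coord (y - x) : ℝ) : UnitAddCircle) := by
    rw [AddCircle.coe_add, coe_coord]
    abel
  rw [← abs_coord (y - x)] at hy ⊢
  set k := coord (y - x)
  have ht : |x + k - x| ≤ η := by rwa [add_sub_cancel_left]
  have hn := isLift_iter h n
  have hxn : F^[n] x = x := Function.iterate_fixed hFx n
  have hco : ‖(b.iter n).toEquiv y - (x : UnitAddCircle)‖ ≤ |F^[n] (x + k) - x| := by
    rw [hy', ← hn.coe_eq, ← AddCircle.coe_sub]
    have h3 : ∀ r : ℝ, ‖((r : ℝ) : UnitAddCircle)‖ ≤ |r| := fun r => by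
      rw [AddCircle.norm_eq]
      simp only [inv_one, one_mul, mul_one]
      have := round_le r 0
      simpa using this
    exact h3 _
  refine ⟨?_, ?_, hco.trans ?_, hco.trans ?_⟩
  · rw [hy', hn.circleDeriv_coe]
    exact (hK n _ ht).1
  · rw [hy', hn.circleDeriv_coe]
    exact (hK n _ ht).2
  · have := abs_sub_le_of_abs_deriv_le (hn.smooth.differentiable (by simp)) (t := x) (h := k)
      (K := K * deriv F x ^ n) (fun z hz => by
        rw [abs_of_pos (hn.deriv_pos z)]
        exact (hK n z (hz.trans hy)).2)
    rwa [hxn] at this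
  · refine (iterate_contraction hl0 hl1 hc n ht).trans ?_
    exact (mul_le_of_le_one_left (abs_nonneg _) (pow_le_one₀ hl0.le hl1.le)).trans ht

/-! ### Rescaling -/

/-- The kernel `δ² / ((sin² + δ²) (sin² ∘ b + δ²))`. -/
def concKernel (b : CircleDiffeo) (d : ℝ) (z : UnitAddCircle × UnitAddCircle) : ℝ :=
  d / ((sinSq (z.1 - z.2) + d) * (sinSq (b.toEquiv z.1 - b.toEquiv z.2) + d))

lemma concKernel_nonneg (b : CircleDiffeo) {d : ℝ} (hd : 0 < d)
    (z : UnitAddCircle × UnitAddCircle) : 0 ≤ concKernel b d z :=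
  div_nonneg hd.le (kernel_denom_pos b hd z).le

lemma continuous_concKernel (b : CircleDiffeo) {d : ℝ} (hd : 0 < d) :
    Continuous (concKernel b d) :=
  continuous_const.div (continuous_kernel_denom b d) fun z => (kernel_denom_pos b hd z).ne'

lemma integrable_sq_norm_diff (v : L2) :
    Integrable (fun z => ‖diff v z‖ ^ 2) (mu.prod mu) := by
  have h := (Lp.memLp (diffL2 v)).integrable_norm_pow (by norm_num)
  refine h.congr ?_
  filter_upwards [coeFn_diffL2 v] with z hz
  rw [hz]

lemma integrable_kernel_mul {k : UnitAddCircle × UnitAddCircle → ℝ} (hk : Continuous k) (v : L2) :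
    Integrable (fun z => k z * ‖diff v z‖ ^ 2) (mu.prod mu) := by
  obtain ⟨M, -, hM⟩ := exists_abs_le_of_continuous hk
  exact (integrable_sq_norm_diff v).bdd_mul (c := M) hk.aestronglyMeasurable
    (Filter.Eventually.of_forall fun z => hM z)

/-- By Fubini, almost every `y` has `f x = f y` for almost all `x` in `V`, and `V` has positive
measure, so such a `y` exists in `V`. -/
lemma exists_ae_const_of_diff {f : L2} {V : Set UnitAddCircle} (hV : IsOpen V) (hne : V.Nonempty)
    (h : ∀ᵐ z ∂(mu.prod mu), z ∈ V ×ˢ V → diff f z = 0) :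
    ∃ c : ℂ, ∀ᵐ x ∂mu, x ∈ V → f x = c := by
  have h1 := Measure.ae_ae_of_ae_prod h
  have h2 : ∃ y ∈ V, ∀ᵐ x ∂mu, (y, x) ∈ V ×ˢ V → diff f (y, x) = 0 := by
    by_contra hcon
    have h3 : mu V = 0 := by
      refine measure_mono_null (fun y hy => ?_) (ae_iff.1 h1)
      exact fun hae => hcon ⟨y, hy, hae⟩
    exact (hV.measure_pos mu hne).ne' h3
  obtain ⟨y, hy, hy2⟩ := h2
  refine ⟨f y, ?_⟩
  filter_upwards [hy2] with x hx hxV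
  have := hx ⟨hy, hxV⟩
  simp only [diff, sub_eq_zero] at this
  exact this.symm

lemma compL2_iter {g : CircleDiffeo} {f : L2} (hf : compL2 g f = f) (n : ℕ) :
    f ∘ (g.iter n).toEquiv =ᵐ[mu] f := by
  have h1 : f ∘ g.toEquiv =ᵐ[mu] f := by
    have := coeFn_compL2 g f
    rw [hf] at this
    exact this.symm
  induction n with
  | zero => exact Filter.EventuallyEq.rfl
  | succ n ih => exact ((quasiMeasurePreserving g).ae_eq_comp ih).trans h1

/-- Take `d = λ^(2n)` and pull back by `gⁿ`, which sends a fixed `V` into `U`. On the image `|X - Y|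
= O(λⁿ)`, so the kernel is at least `1 / (A d)`, while the Jacobian is at least `d / K²`. The powers
of `d` cancel, and `f ∘ gⁿ = f` leaves a fixed multiple of the integral of `|f(X) - f(Y)|²` over `V
× V`, bounded by a null sequence. The map `g` is separate from `b` so that it can be `b` or its
inverse. -/
lemma exists_ae_const_of_concentration (b g : CircleDiffeo) {f : L2} (hf : compL2 g f = f)
    {x : UnitAddCircle} (hx : g.toEquiv x = x) (h1 : circleDeriv g.toEquiv x < 1)
    {U : Set UnitAddCircle} (hU : U ∈ 𝓝 x) (hUm : MeasurableSet U)
    (hlim : Filter.Tendsto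
      (fun d => ∫ z in U ×ˢ U, concKernel b d z * ‖diff f z‖ ^ 2 ∂(mu.prod mu)) (𝓝[>] 0) (𝓝 0)) :
    ∃ V ∈ 𝓝 x, ∃ c : ℂ, ∀ᵐ y ∂mu, y ∈ V → f y = c := by
  obtain ⟨η, K, hη, hη2, hK0, hK⟩ := exists_iter_bounds g hx h1
  obtain ⟨ε, hε, hεU⟩ := Metric.mem_nhds_iff.1 hU
  obtain ⟨C, hC0, hC⟩ := exists_sinSq_comp_le b
  set l := circleDeriv g.toEquiv x with hl
  have hl0 : 0 < l := g.circleDeriv_pos x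
  set V := Metric.ball x η with hV
  refine ⟨V, Metric.ball_mem_nhds x hη, exists_ae_const_of_diff Metric.isOpen_ball
    ⟨x, Metric.mem_ball_self hη⟩ ?_⟩
  have hVm : MeasurableSet V := Metric.isOpen_ball.measurableSet
  -- On the image of `V`, two points are at distance at most `2 K η λⁿ`; hence the product of the
  -- two denominators is at most `A d²`.
  set A : ℝ := (Real.pi ^ 2 * (2 * K * η) ^ 2 + 1) * (C * (Real.pi ^ 2 * (2 * K * η) ^ 2) + 1)
    with hA
  have hA0 : 0 < A := by positivity
  have hn : ∀ᶠ n : ℕ in Filter.atTop, (1 / (A * K ^ 2)) *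
      ∫ z in V ×ˢ V, ‖diff f z‖ ^ 2 ∂(mu.prod mu) ≤
      ∫ z in U ×ˢ U, concKernel b ((l ^ n) ^ 2) z * ‖diff f z‖ ^ 2 ∂(mu.prod mu) := by
    have hsmall : ∀ᶠ n : ℕ in Filter.atTop, K * l ^ n * η < ε := by
      have : Filter.Tendsto (fun n : ℕ => K * l ^ n * η) Filter.atTop (𝓝 (K * 0 * η)) :=
        ((tendsto_pow_atTop_nhds_zero_of_lt_one hl0.le h1).const_mul K).mul_const η
      rw [mul_zero, zero_mul] at this
      exact this.eventually (gt_mem_nhds hε)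
    filter_upwards [hsmall] with n hsm
    set d := (l ^ n) ^ 2 with hd
    have hd0 : 0 < d := by positivity
    set φ := (g.iter n).toEquiv with hφ
    have hfn := compL2_iter hf n
    have hmap : ∀ y ∈ V, φ y ∈ U := fun y hy => by
      apply hεU
      rw [Metric.mem_ball, dist_eq_norm] at hy ⊢
      refine lt_of_le_of_lt (hK n y hy.le).2.2.1 (lt_of_le_of_lt ?_ hsm)
      gcongr
    have hcont := continuous_concKernel b hd0
    have hH : Integrable (fun z => concKernel b d z * ‖diff f z‖ ^ 2) (mu.prod mu) :=
      integrable_kernel_mul hcont f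
    have hcv := integral_comp_mul_deriv_prod (g.iter n)
      (f := (U ×ˢ U).indicator fun z => ((concKernel b d z * ‖diff f z‖ ^ 2 : ℝ) : ℂ))
      ((Complex.continuous_ofReal.comp_aestronglyMeasurable hH.aestronglyMeasurable).indicator
        (hUm.prod hUm))
    have hcv2 : ∫ z, (circleDeriv φ z.1 * circleDeriv φ z.2) *
        (U ×ˢ U).indicator (fun z => concKernel b d z * ‖diff f z‖ ^ 2) (φ z.1, φ z.2)
          ∂(mu.prod mu) = ∫ z in U ×ˢ U, concKernel b d z * ‖diff f z‖ ^ 2 ∂(mu.prod mu) := by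
      rw [← integral_indicator (hUm.prod hUm)]
      have hind : ∀ w, (U ×ˢ U).indicator
          (fun z => ((concKernel b d z * ‖diff f z‖ ^ 2 : ℝ) : ℂ)) w
          = (((U ×ˢ U).indicator (fun z => concKernel b d z * ‖diff f z‖ ^ 2) w : ℝ) : ℂ) :=
        fun w => by
          by_cases hw : w ∈ U ×ˢ U
          · rw [Set.indicator_of_mem hw, Set.indicator_of_mem hw]
          · rw [Set.indicator_of_notMem hw, Set.indicator_of_notMem hw, Complex.ofReal_zero]
      simp only [hind, Complex.real_smul, ← Complex.ofReal_mul] at hcv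
      rw [integral_complex_ofReal, integral_complex_ofReal] at hcv
      exact_mod_cast hcv
    rw [← hcv2, ← integral_indicator (hVm.prod hVm), ← integral_const_mul]
    have hint : Integrable (fun z => (circleDeriv φ z.1 * circleDeriv φ z.2) *
        (U ×ˢ U).indicator (fun z => concKernel b d z * ‖diff f z‖ ^ 2) (φ z.1, φ z.2))
        (mu.prod mu) := by
      have hb : Integrable (fun z => (circleDeriv φ z.1 * circleDeriv φ z.2) *
          ((U ×ˢ U).indicator (fun z => concKernel b d z) (φ z.1, φ z.2)) * ‖diff f z‖ ^ 2)
          (mu.prod mu) := by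
        obtain ⟨M, hM0, hM⟩ := exists_abs_le_of_continuous (continuous_jac (g.iter n))
        obtain ⟨M', hM0', hM'⟩ := exists_abs_le_of_continuous hcont
        refine (integrable_sq_norm_diff f).bdd_mul (c := M * M') ?_ ?_
        · refine Measurable.aestronglyMeasurable ?_
          refine (continuous_jac (g.iter n)).measurable.mul ?_
          refine (hcont.measurable.indicator (hUm.prod hUm)).comp ?_
          exact ((g.iter n).continuous.measurable.comp measurable_fst).prodMk
            ((g.iter n).continuous.measurable.comp measurable_snd)
        · refine Filter.Eventually.of_forall fun z => ?_
          rw [norm_mul]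
          refine mul_le_mul (hM z) ?_ (norm_nonneg _) hM0
          by_cases hw : (φ z.1, φ z.2) ∈ U ×ˢ U
          · rw [Set.indicator_of_mem hw]; exact hM' _
          · rw [Set.indicator_of_notMem hw, norm_zero]; exact hM0'
      refine hb.congr ?_
      filter_upwards [diff_congr hfn] with z hz
      have hz' : diff f (φ z.1, φ z.2) = diff f z := hz
      by_cases hw : (φ z.1, φ z.2) ∈ U ×ˢ U
      · rw [Set.indicator_of_mem hw, Set.indicator_of_mem hw, hz']; ring
      · rw [Set.indicator_of_notMem hw, Set.indicator_of_notMem hw]; ring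
    refine integral_mono_ae (((integrable_sq_norm_diff f).indicator (hVm.prod hVm)).const_mul _)
      hint ?_
    filter_upwards [diff_congr hfn] with z hz
    have hz' : diff f (φ z.1, φ z.2) = diff f z := hz
    have hjac0 : 0 < circleDeriv φ z.1 * circleDeriv φ z.2 := jac_pos (g.iter n) z
    by_cases hzV : z ∈ V ×ˢ V
    · have hm : (φ z.1, φ z.2) ∈ U ×ˢ U := ⟨hmap _ hzV.1, hmap _ hzV.2⟩
      rw [Set.indicator_of_mem hzV, Set.indicator_of_mem hm, hz', ← mul_assoc]
      refine mul_le_mul_of_nonneg_right ?_ (sq_nonneg _)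
      have hz1 : ‖z.1 - x‖ ≤ η := by
        have := hzV.1; rw [hV, Metric.mem_ball, dist_eq_norm] at this; exact this.le
      have hz2 : ‖z.2 - x‖ ≤ η := by
        have := hzV.2; rw [hV, Metric.mem_ball, dist_eq_norm] at this; exact this.le
      have hj : (l ^ n / K) * (l ^ n / K) ≤ circleDeriv φ z.1 * circleDeriv φ z.2 :=
        mul_le_mul (hK n _ hz1).1 (hK n _ hz2).1 (by positivity) ((g.iter n).circleDeriv_pos _).le
      have hdist : ‖φ z.1 - φ z.2‖ ≤ 2 * K * η * l ^ n := by
        have e1 := (hK n _ hz1).2.2.1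
        have e2 := (hK n _ hz2).2.2.1
        have e3 : φ z.1 - φ z.2 = (φ z.1 - x) - (φ z.2 - x) := by abel
        rw [e3]
        refine (norm_sub_le _ _).trans ((add_le_add e1 e2).trans ?_)
        have : K * l ^ n * ‖z.1 - x‖ + K * l ^ n * ‖z.2 - x‖ ≤ K * l ^ n * η + K * l ^ n * η := by
          gcongr
        refine this.trans (le_of_eq (by ring))
      have hs : sinSq (φ z.1 - φ z.2) ≤ Real.pi ^ 2 * (2 * K * η) ^ 2 * d := by
        refine (sinSq_le_norm_sq _).trans ?_
        calc Real.pi ^ 2 * ‖φ z.1 - φ z.2‖ ^ 2 ≤ Real.pi ^ 2 * (2 * K * η * l ^ n) ^ 2 := by gcongr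
          _ = _ := by rw [hd]; ring
      have hS := (hC (φ z.1) (φ z.2)).trans (mul_le_mul_of_nonneg_left hs hC0.le)
      have hden : (sinSq (φ z.1 - φ z.2) + d) *
          (sinSq (b.toEquiv (φ z.1) - b.toEquiv (φ z.2)) + d) ≤ A * d ^ 2 := by
        calc _ ≤ (Real.pi ^ 2 * (2 * K * η) ^ 2 * d + d) *
              (C * (Real.pi ^ 2 * (2 * K * η) ^ 2 * d) + d) := by
                refine mul_le_mul (by linarith) (by linarith) ?_ (by positivity)
                exact (add_pos_of_nonneg_of_pos (sinSq_nonneg _) hd0).le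
          _ = _ := by rw [hA]; ring
      have hk : 1 / (A * d) ≤ concKernel b d (φ z.1, φ z.2) := by
        rw [concKernel, div_le_div_iff₀ (by positivity) (kernel_denom_pos b hd0 (φ z.1, φ z.2)),
          one_mul]
        refine hden.trans (le_of_eq (by ring))
      calc 1 / (A * K ^ 2) = (l ^ n / K) * (l ^ n / K) * (1 / (A * d)) := by
            rw [hd]; field_simp
        _ ≤ _ := mul_le_mul hj hk (by positivity) hjac0.le
    · rw [Set.indicator_of_notMem hzV, mul_zero]
      refine mul_nonneg hjac0.le (Set.indicator_nonneg (fun w _ => ?_) _)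
      exact mul_nonneg (concKernel_nonneg b hd0 w) (sq_nonneg _)
  have hseq : Filter.Tendsto (fun n : ℕ => (l ^ n) ^ 2) Filter.atTop (𝓝[>] 0) := by
    refine tendsto_nhdsWithin_iff.2 ⟨?_, Filter.Eventually.of_forall fun n => ?_⟩
    · have := (tendsto_pow_atTop_nhds_zero_of_lt_one hl0.le h1).pow 2
      simpa using this
    · exact pow_pos (pow_pos hl0 n) 2
  have h3 := ge_of_tendsto (hlim.comp hseq) hn
  have h4 : ∫ z in V ×ˢ V, ‖diff f z‖ ^ 2 ∂(mu.prod mu) ≤ 0 := by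
    have h5 : 0 < 1 / (A * K ^ 2) := by positivity
    by_contra hcon
    exact absurd h3 (not_le.2 (mul_pos h5 (not_le.1 hcon)))
  have h5 : ∫ z in V ×ˢ V, ‖diff f z‖ ^ 2 ∂(mu.prod mu) = 0 :=
    le_antisymm h4 (integral_nonneg fun z => sq_nonneg _)
  rw [setIntegral_eq_zero_iff_of_nonneg_ae (Filter.Eventually.of_forall fun z => sq_nonneg _)
    (integrable_sq_norm_diff f).integrableOn, Filter.EventuallyEq,
    ae_restrict_iff' (hVm.prod hVm)] at h5
  filter_upwards [h5] with z hz hzV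
  simpa using hz hzV

/-! ### Positivity -/

/-- `v` is almost everywhere equal to a Lipschitz function near `x`. -/
def LipschitzNear (v : UnitAddCircle → ℂ) (x : UnitAddCircle) : Prop :=
  ∃ U ∈ 𝓝 x, ∃ C : ℝ, 0 ≤ C ∧ ∀ᵐ z ∂(mu.prod mu), z.1 ∈ U → z.2 ∈ U →
    ‖diff v z‖ ^ 2 ≤ C * sinSq (z.1 - z.2)

lemma LipschitzNear.congr {v w : UnitAddCircle → ℂ} {x : UnitAddCircle} (h : LipschitzNear v x)
    (hvw : v =ᵐ[mu] w) : LipschitzNear w x := by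
  obtain ⟨U, hU, C, hC, hz⟩ := h
  refine ⟨U, hU, C, hC, ?_⟩
  filter_upwards [hz, diff_congr hvw] with z h1 h2
  rwa [← h2]

lemma LipschitzNear.comp (b : CircleDiffeo) {v : UnitAddCircle → ℂ} {x : UnitAddCircle}
    (h : LipschitzNear v (b.toEquiv x)) : LipschitzNear (v ∘ b.toEquiv) x := by
  obtain ⟨U, hU, C, hC, hz⟩ := h
  obtain ⟨C', hC', hs⟩ := exists_sinSq_comp_le b
  refine ⟨_, b.continuous.continuousAt.preimage_mem_nhds hU, C * C', by positivity, ?_⟩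
  have hq := QuasiMeasurePreserving.prodMap (quasiMeasurePreserving b) (quasiMeasurePreserving b)
  filter_upwards [hq.ae hz] with z h1 h2 h3
  refine (h1 h2 h3).trans ?_
  rw [mul_assoc]
  exact mul_le_mul_of_nonneg_left (hs _ _) hC

lemma resKernel_eq (b : CircleDiffeo) (d : ℝ) (z : UnitAddCircle × UnitAddCircle) :
    resKernel b d z = (1 - jac b z) * concKernel b d z := by
  unfold resKernel concKernel
  ring

lemma norm_diff_add_sq_le (p q : UnitAddCircle → ℂ) (z : UnitAddCircle × UnitAddCircle) :
    ‖diff (p + q) z‖ ^ 2 ≤ 2 * (‖diff p z‖ ^ 2 + ‖diff q z‖ ^ 2) := by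
  have h : diff (p + q) z = diff p z + diff q z := by
    simp only [diff, Pi.add_apply]; ring
  rw [h]
  have h1 := norm_add_le (diff p z) (diff q z)
  have h2 := norm_nonneg (diff p z + diff q z)
  nlinarith [sq_nonneg (‖diff p z‖ - ‖diff q z‖)]

/-- The local lower bound for the quadratic form of `resKernel`. -/
lemma exists_local_lower_bound (b : CircleDiffeo) (p q : UnitAddCircle → ℂ) (x : UnitAddCircle)
    (h : (LipschitzNear p x ∧ LipschitzNear q x) ∨
      (circleDeriv b.toEquiv x < 1 ∧ LipschitzNear q x) ∨
      (1 < circleDeriv b.toEquiv x ∧ LipschitzNear p x)) :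
    ∃ U : Set UnitAddCircle, IsOpen U ∧ x ∈ U ∧ ∃ C c : ℝ, 0 ≤ C ∧ 0 ≤ c ∧
      ((circleDeriv b.toEquiv x < 1 ∧ LipschitzNear q x) ∨
        (1 < circleDeriv b.toEquiv x ∧ LipschitzNear p x) → 0 < c) ∧
      ∀ᵐ z ∂(mu.prod mu), z.1 ∈ U → z.2 ∈ U → ∀ d, 0 < d →
        c * (concKernel b d z * ‖diff (p + q) z‖ ^ 2) ≤
          resKernel b d z * (‖diff p z‖ ^ 2 - ‖diff q z‖ ^ 2) + C * smallKernel b d z := by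
  obtain ⟨M, hM0, hM⟩ := exists_abs_resKernel_mul_le b
  have key : ∀ (v : UnitAddCircle → ℂ) (C : ℝ), 0 ≤ C → ∀ z : UnitAddCircle × UnitAddCircle,
      ‖diff v z‖ ^ 2 ≤ C * sinSq (z.1 - z.2) → ∀ d, 0 < d →
      |resKernel b d z| * ‖diff v z‖ ^ 2 ≤ C * M * smallKernel b d z := fun v C hC z hz d hd => by
    calc _ ≤ |resKernel b d z| * (C * sinSq (z.1 - z.2)) :=
          mul_le_mul_of_nonneg_left hz (abs_nonneg _)
      _ = C * (|resKernel b d z| * sinSq (z.1 - z.2)) := by ring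
      _ ≤ C * (M * smallKernel b d z) := mul_le_mul_of_nonneg_left (hM d hd z) hC
      _ = _ := by ring
  by_cases h2 : (circleDeriv b.toEquiv x < 1 ∧ LipschitzNear q x) ∨
        (1 < circleDeriv b.toEquiv x ∧ LipschitzNear p x)
  · rcases h2 with ⟨h1, U, hU, C, hC, hz⟩ | ⟨h1, U, hU, C, hC, hz⟩
    -- Here `1 - jac ≥ 1 - l²`, and `|P + Q|² ≤ 2 (|P|² + |Q|²)` gives the constant `(1 - l²) / 2`.
    -- Replacing `+|Q|²` by `-|Q|²` costs `2 resKernel |Q|²`, which is at most `2 C M smallKernel`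
    -- because `q` is Lipschitz.
    · obtain ⟨l, hl1, hl2⟩ := exists_between h1
      have hl0 : 0 < l := (b.circleDeriv_pos x).trans hl1
      have hW : {y | circleDeriv b.toEquiv y < l} ∈ 𝓝 x :=
        b.continuous_circleDeriv.continuousAt.eventually (Iio_mem_nhds hl1)
      obtain ⟨V, hVs, hVo, hxV⟩ := mem_nhds_iff.1 (Filter.inter_mem hU hW)
      refine ⟨V, hVo, hxV, 2 * (C * M), (1 - l ^ 2) / 2, by positivity, by nlinarith,
        fun _ => by nlinarith, ?_⟩
      filter_upwards [hz] with z hz h1 h2 d hd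
      have e1 := key q C hC z (hz (hVs h1).1 (hVs h2).1) d hd
      have e2 := norm_diff_add_sq_le p q z
      have e3 : jac b z ≤ l ^ 2 := by
        have a1 : circleDeriv b.toEquiv z.1 < l := (hVs h1).2
        have a2 : circleDeriv b.toEquiv z.2 < l := (hVs h2).2
        rw [sq]
        exact mul_le_mul a1.le a2.le (b.circleDeriv_pos _).le hl0.le
      have e4 := concKernel_nonneg b hd z
      have e5 : (1 - l ^ 2) * concKernel b d z ≤ resKernel b d z := by
        rw [resKernel_eq]
        exact mul_le_mul_of_nonneg_right (by linarith) e4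
      have e6 : 0 ≤ (1 - l ^ 2) * concKernel b d z := mul_nonneg (by nlinarith) e4
      have e7 : |resKernel b d z| = resKernel b d z := abs_of_nonneg (e6.trans e5)
      rw [e7] at e1
      have e8 : (1 - l ^ 2) * concKernel b d z * (‖diff p z‖ ^ 2 + ‖diff q z‖ ^ 2) ≤
          resKernel b d z * (‖diff p z‖ ^ 2 + ‖diff q z‖ ^ 2) :=
        mul_le_mul_of_nonneg_right e5 (by positivity)
      have e9 := mul_le_mul_of_nonneg_left e2 e6
      nlinarith
    -- The mirror image: `resKernel` is negative and `p` is the Lipschitz part.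
    · obtain ⟨l, hl2, hl1⟩ := exists_between h1
      have hl0 : 0 < l := one_pos.trans hl2
      have hW : {y | l < circleDeriv b.toEquiv y} ∈ 𝓝 x :=
        b.continuous_circleDeriv.continuousAt.eventually (Ioi_mem_nhds hl1)
      obtain ⟨V, hVs, hVo, hxV⟩ := mem_nhds_iff.1 (Filter.inter_mem hU hW)
      refine ⟨V, hVo, hxV, 2 * (C * M), (l ^ 2 - 1) / 2, by positivity, by nlinarith,
        fun _ => by nlinarith, ?_⟩
      filter_upwards [hz] with z hz h1 h2 d hd
      have e1 := key p C hC z (hz (hVs h1).1 (hVs h2).1) d hd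
      have e2 := norm_diff_add_sq_le p q z
      have e3 : l ^ 2 ≤ jac b z := by
        have a1 : l < circleDeriv b.toEquiv z.1 := (hVs h1).2
        have a2 : l < circleDeriv b.toEquiv z.2 := (hVs h2).2
        rw [sq]
        exact mul_le_mul a1.le a2.le hl0.le (b.circleDeriv_pos _).le
      have e4 := concKernel_nonneg b hd z
      have e5 : (l ^ 2 - 1) * concKernel b d z ≤ -resKernel b d z := by
        rw [resKernel_eq, ← neg_mul]
        exact mul_le_mul_of_nonneg_right (by linarith) e4
      have e6 : 0 ≤ (l ^ 2 - 1) * concKernel b d z := mul_nonneg (by nlinarith) e4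
      have e7 : |resKernel b d z| = -resKernel b d z := abs_of_nonpos (by linarith)
      rw [e7] at e1
      have e8 : (l ^ 2 - 1) * concKernel b d z * (‖diff p z‖ ^ 2 + ‖diff q z‖ ^ 2) ≤
          -resKernel b d z * (‖diff p z‖ ^ 2 + ‖diff q z‖ ^ 2) :=
        mul_le_mul_of_nonneg_right e5 (by positivity)
      have e9 := mul_le_mul_of_nonneg_left e2 e6
      nlinarith
  · obtain ⟨⟨U, hU, C, hC, hz⟩, ⟨U', hU', C', hC', hz'⟩⟩ := h.resolve_right h2
    obtain ⟨V, hVs, hVo, hxV⟩ := mem_nhds_iff.1 (Filter.inter_mem hU hU')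
    refine ⟨V, hVo, hxV, (C + C') * M, 0, by positivity, le_rfl, fun h => absurd h h2, ?_⟩
    filter_upwards [hz, hz'] with z hz hz' h1 h2 d hd
    have e1 := key p C hC z (hz (hVs h1).1 (hVs h2).1) d hd
    have e2 := key q C' hC' z (hz' (hVs h1).2 (hVs h2).2) d hd
    have e3 : -(|resKernel b d z| * ‖diff p z‖ ^ 2) ≤ resKernel b d z * ‖diff p z‖ ^ 2 := by
      rw [← neg_mul]
      exact mul_le_mul_of_nonneg_right (neg_abs_le _) (sq_nonneg _)
    have e4 : resKernel b d z * ‖diff q z‖ ^ 2 ≤ |resKernel b d z| * ‖diff q z‖ ^ 2 :=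
      mul_le_mul_of_nonneg_right (le_abs_self _) (sq_nonneg _)
    rw [zero_mul]
    nlinarith

lemma exists_offdiag_bound (b : CircleDiffeo) {η : ℝ} (hη : 0 < η) :
    ∃ K : ℝ, 0 ≤ K ∧ ∀ d, 0 < d → ∀ z : UnitAddCircle × UnitAddCircle, η ≤ ‖z.1 - z.2‖ →
      |resKernel b d z| ≤ K * d := by
  obtain ⟨C, hC, hs⟩ := exists_le_sinSq_comp b
  obtain ⟨M, hM0, hM⟩ := exists_abs_le_of_continuous (continuous_const.sub (continuous_jac b) :
    Continuous fun z => 1 - jac b z)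
  refine ⟨M * (C / (4 * η ^ 2) ^ 2), by positivity, fun d hd z hz => ?_⟩
  have h1 : 4 * η ^ 2 ≤ sinSq (z.1 - z.2) := by
    refine le_trans ?_ (four_mul_norm_sq_le_sinSq _)
    gcongr
  have h2 : 4 * η ^ 2 / C ≤ sinSq (b.toEquiv z.1 - b.toEquiv z.2) := by
    rw [div_le_iff₀' hC]
    exact h1.trans (hs _ _)
  have h3 : concKernel b d z ≤ C / (4 * η ^ 2) ^ 2 * d := by
    rw [concKernel, div_le_iff₀ (kernel_denom_pos b hd z)]
    have h4 : (4 * η ^ 2) * (4 * η ^ 2 / C) ≤ (sinSq (z.1 - z.2) + d) *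
        (sinSq (b.toEquiv z.1 - b.toEquiv z.2) + d) :=
      mul_le_mul (by linarith) (by linarith) (by positivity)
        (by linarith [sinSq_nonneg (z.1 - z.2)])
    calc d = C / (4 * η ^ 2) ^ 2 * d * ((4 * η ^ 2) * (4 * η ^ 2 / C)) := by field_simp
      _ ≤ _ := mul_le_mul_of_nonneg_left h4 (by positivity)
  rw [resKernel_eq, abs_mul, abs_of_nonneg (concKernel_nonneg b hd z), mul_assoc M]
  exact mul_le_mul (hM z) h3 (concKernel_nonneg b hd z) hM0

/-- By a Lebesgue number of a finite subcover, nearby pairs lie in a common neighborhood where the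
local bound holds; for the other pairs the kernel is `O(d)`. -/
lemma exists_global_lower_bound (b : CircleDiffeo) (p q : UnitAddCircle → ℂ)
    (h : ∀ x, (LipschitzNear p x ∧ LipschitzNear q x) ∨
      (circleDeriv b.toEquiv x < 1 ∧ LipschitzNear q x) ∨
      (1 < circleDeriv b.toEquiv x ∧ LipschitzNear p x)) :
    ∃ C K : ℝ, 0 ≤ C ∧ 0 ≤ K ∧ ∀ᵐ z ∂(mu.prod mu), ∀ d, 0 < d →
      0 ≤ resKernel b d z * (‖diff p z‖ ^ 2 - ‖diff q z‖ ^ 2) + C * smallKernel b d z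
        + K * d * (‖diff p z‖ ^ 2 + ‖diff q z‖ ^ 2) := by
  choose U hUo hxU C c hC hc _ hz using fun x => exists_local_lower_bound b p q x (h x)
  obtain ⟨t, ht⟩ := CompactSpace.elim_nhds_subcover U fun x => (hUo x).mem_nhds (hxU x)
  obtain ⟨η, hη, hηU⟩ := lebesgue_number_lemma_of_metric (s := Set.univ)
    (c := fun x : t => U x) isCompact_univ (fun x => hUo x) (by
      intro y _
      have : y ∈ ⋃ x ∈ t, U x := by rw [ht]; trivial
      simpa using this)
  obtain ⟨K, hK0, hK⟩ := exists_offdiag_bound b hη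
  refine ⟨∑ x ∈ t, C x, K, Finset.sum_nonneg fun y _ => hC y, hK0, ?_⟩
  have hall : ∀ᵐ z ∂(mu.prod mu), ∀ x ∈ t, z.1 ∈ U x → z.2 ∈ U x → ∀ d, 0 < d →
        c x * (concKernel b d z * ‖diff (p + q) z‖ ^ 2) ≤
          resKernel b d z * (‖diff p z‖ ^ 2 - ‖diff q z‖ ^ 2) + C x * smallKernel b d z :=
    (Finset.eventually_all t).2 fun x _ => hz x
  filter_upwards [hall] with z hz d hd
  have hsm := smallKernel_nonneg b hd z
  have hsq : 0 ≤ ‖diff p z‖ ^ 2 + ‖diff q z‖ ^ 2 := by positivity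
  rcases lt_or_ge ‖z.1 - z.2‖ η with hlt | hge
  · obtain ⟨⟨x, hx⟩, hb⟩ := hηU z.2 trivial
    have h1 : z.1 ∈ U x := hb (by rwa [Metric.mem_ball, dist_eq_norm])
    have h2 : z.2 ∈ U x := hb (Metric.mem_ball_self hη)
    have h3 := hz x hx h1 h2 d hd
    have h4 : C x * smallKernel b d z ≤ (∑ x ∈ t, C x) * smallKernel b d z :=
      mul_le_mul_of_nonneg_right (Finset.single_le_sum (fun y _ => hC y) hx) hsm
    have h5 : 0 ≤ c x * (concKernel b d z * ‖diff (p + q) z‖ ^ 2) :=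
      mul_nonneg (hc x) (mul_nonneg (concKernel_nonneg b hd z) (sq_nonneg _))
    have h6 : 0 ≤ K * d * (‖diff p z‖ ^ 2 + ‖diff q z‖ ^ 2) := by positivity
    linarith
  · have h1 := hK d hd z hge
    have h2 : |resKernel b d z| * (‖diff p z‖ ^ 2 + ‖diff q z‖ ^ 2) ≤
        K * d * (‖diff p z‖ ^ 2 + ‖diff q z‖ ^ 2) := mul_le_mul_of_nonneg_right h1 hsq
    have h3 : -(|resKernel b d z| * ‖diff p z‖ ^ 2) ≤ resKernel b d z * ‖diff p z‖ ^ 2 := by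
      rw [← neg_mul]
      exact mul_le_mul_of_nonneg_right (neg_abs_le _) (sq_nonneg _)
    have h4 : resKernel b d z * ‖diff q z‖ ^ 2 ≤ |resKernel b d z| * ‖diff q z‖ ^ 2 :=
      mul_le_mul_of_nonneg_right (le_abs_self _) (sq_nonneg _)
    have h5 : 0 ≤ (∑ x ∈ t, C x) * smallKernel b d z :=
      mul_nonneg (Finset.sum_nonneg fun y _ => hC y) hsm
    nlinarith

/-- The function `ψ` inverts `regParam`: `ψ d` is the root smaller than `1` of `(1 - r)² = 4 r d`.
-/
lemma tendsto_of_comp_regParam {X : Type*} {l : Filter X} {h : ℝ → X}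
    (hh : Filter.Tendsto (fun r => h (regParam r)) (𝓝[<] 1) l) : Filter.Tendsto h (𝓝[>] 0) l := by
  set ψ : ℝ → ℝ := fun d => 1 + 2 * d - 2 * √(d ^ 2 + d) with hψ
  have hlt : ∀ d, 0 < d → ψ d < 1 := fun d hd => by
    have : d < √(d ^ 2 + d) := Real.lt_sqrt_of_sq_lt (by linarith)
    simp only [hψ]
    linarith
  have hreg : ∀ d, 0 < d → regParam (ψ d) = d := fun d hd => by
    have h1 : √(d ^ 2 + d) ^ 2 = d ^ 2 + d := Real.sq_sqrt (by positivity)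
    have h2 : 0 < ψ d := by
      have : √(d ^ 2 + d) < (1 + 2 * d) / 2 := by
        rw [Real.sqrt_lt' (by positivity)]
        nlinarith
      simp only [hψ]
      linarith
    rw [regParam, div_eq_iff (by positivity)]
    simp only [hψ]
    nlinarith
  have ht : Filter.Tendsto ψ (𝓝[>] 0) (𝓝[<] 1) := by
    refine tendsto_nhdsWithin_iff.2 ⟨?_, ?_⟩
    · have hc : Continuous ψ := by fun_prop
      have := hc.tendsto 0
      simp only [hψ] at this
      norm_num at this
      exact this.mono_left nhdsWithin_le_nhds
    · filter_upwards [self_mem_nhdsWithin] with d hd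
      exact hlt d hd
  refine (hh.comp ht).congr' ?_
  filter_upwards [self_mem_nhdsWithin] with d hd
  simp only [Function.comp_apply, hreg d hd]

/-- This is `Re ((P + Q) conj (P - Q)) = |P|² - |Q|²`, the origin of the opposite signs for the two
halves of the spectrum. -/
lemma re_form_add_sub {k : UnitAddCircle × UnitAddCircle → ℝ} (hk : Continuous k) (p q : L2) :
    (form k (p + q : L2) (p - q : L2)).re =
      ∫ z, k z * (‖diff p z‖ ^ 2 - ‖diff q z‖ ^ 2) ∂(mu.prod mu) := by
  obtain ⟨M, -, hM⟩ := exists_abs_le_of_continuous hk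
  have hi := integrable_form hk.measurable hM (p + q) (p - q)
  have := integral_re hi
  simp only [RCLike.re_to_complex] at this
  rw [form, ← this]
  refine integral_congr_ae ?_
  filter_upwards [diff_congr (Lp.coeFn_add p q), diff_congr (Lp.coeFn_sub p q)] with z h1 h2
  rw [h1, h2]
  have e1 : diff ((p : UnitAddCircle → ℂ) + q) z = diff p z + diff q z := by
    simp only [diff, Pi.add_apply]; ring
  have e2 : diff ((p : UnitAddCircle → ℂ) - q) z = diff p z - diff q z := by
    simp only [diff, Pi.sub_apply]; ring
  rw [e1, e2, Complex.re_ofReal_mul, ← Complex.normSq_eq_norm_sq, ← Complex.normSq_eq_norm_sq]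
  congr 1
  simp only [Complex.normSq_apply, Complex.mul_re, Complex.conj_re, Complex.conj_im,
    Complex.add_re, Complex.add_im, Complex.sub_re, Complex.sub_im]
  ring

/-- Integrate the local lower bound over `U × U` and the global one over the complement. A multiple
of the concentration integral is then at most the real part of the form plus error terms in
`smallKernel` and in `d`, and everything on that side tends to `0`. -/
lemma tendsto_concentration (b : CircleDiffeo) (p q : L2)
    (h : ∀ x, (LipschitzNear p x ∧ LipschitzNear q x) ∨
      (circleDeriv b.toEquiv x < 1 ∧ LipschitzNear q x) ∨
      (1 < circleDeriv b.toEquiv x ∧ LipschitzNear p x))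
    (hlim : Filter.Tendsto (fun d => form (resKernel b d) (p + q : L2) (p - q : L2))
      (𝓝[>] 0) (𝓝 0)) {x : UnitAddCircle}
    (hx : (circleDeriv b.toEquiv x < 1 ∧ LipschitzNear q x) ∨
      (1 < circleDeriv b.toEquiv x ∧ LipschitzNear p x)) :
    ∃ U ∈ 𝓝 x, MeasurableSet U ∧ Filter.Tendsto (fun d => ∫ z in U ×ˢ U,
      concKernel b d z * ‖diff (p + q : L2) z‖ ^ 2 ∂(mu.prod mu)) (𝓝[>] 0) (𝓝 0) := by
  obtain ⟨C, K, hC, hK, hg⟩ := exists_global_lower_bound b p q h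
  obtain ⟨U, hUo, hxU, C', c, hC', -, hc, hz⟩ := exists_local_lower_bound b p q x (h x)
  have hc0 := hc hx
  refine ⟨U, hUo.mem_nhds hxU, hUo.measurableSet, ?_⟩
  have hip := integrable_sq_norm_diff p
  have hiq := integrable_sq_norm_diff q
  set I := ∫ z, (‖diff p z‖ ^ 2 + ‖diff q z‖ ^ 2) ∂(mu.prod mu) with hI
  have hlim1 : Filter.Tendsto (fun d => (form (resKernel b d) (p + q : L2) (p - q : L2)).re)
      (𝓝[>] 0) (𝓝 0) := by
    exact (Complex.continuous_re.tendsto' 0 0 Complex.zero_re).comp hlim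
  have hd0 : Filter.Tendsto (fun d : ℝ => d) (𝓝[>] 0) (𝓝 0) :=
    Filter.tendsto_id.mono_left nhdsWithin_le_nhds
  have hlim2 : Filter.Tendsto (fun d => c⁻¹ *
      ((form (resKernel b d) (p + q : L2) (p - q : L2)).re
        + (C + C') * ∫ z, smallKernel b d z ∂(mu.prod mu) + K * d * I)) (𝓝[>] 0) (𝓝 0) := by
    have := (((hlim1.add ((tendsto_integral_smallKernel b).const_mul (C + C'))).add
      ((hd0.const_mul K).mul_const I)).const_mul c⁻¹)
    simpa using this
  refine squeeze_zero' ?_ ?_ hlim2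
  · filter_upwards [self_mem_nhdsWithin] with d hd
    exact integral_nonneg fun z => mul_nonneg (concKernel_nonneg b hd z) (sq_nonneg _)
  · filter_upwards [self_mem_nhdsWithin] with d hd
    rw [Set.mem_Ioi] at hd
    have hres := continuous_resKernel b hd
    have i1 : Integrable (fun z => resKernel b d z * (‖diff p z‖ ^ 2 - ‖diff q z‖ ^ 2))
        (mu.prod mu) := by
      simp only [mul_sub]
      exact (integrable_kernel_mul hres p).sub (integrable_kernel_mul hres q)
    have i2 : Integrable (fun z => (C + C') * smallKernel b d z) (mu.prod mu) := by
      obtain ⟨M, -, hM⟩ := exists_abs_le_of_continuous (continuous_smallKernel b hd)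
      exact (Integrable.of_bound (continuous_smallKernel b hd).aestronglyMeasurable M
        (Filter.Eventually.of_forall hM)).const_mul _
    have i3 : Integrable (fun z => K * d * (‖diff p z‖ ^ 2 + ‖diff q z‖ ^ 2)) (mu.prod mu) :=
      (hip.add hiq).const_mul _
    have i4 := integrable_kernel_mul (continuous_concKernel b hd) (p + q)
    rw [re_form_add_sub hres, ← integral_const_mul (C + C'), hI, ← integral_const_mul (K * d),
      ← integral_add i1 i2, ← integral_add (by exact i1.add i2) i3, ← integral_const_mul c⁻¹,
      ← integral_indicator (hUo.measurableSet.prod hUo.measurableSet)]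
    refine integral_mono_ae (i4.indicator (hUo.measurableSet.prod hUo.measurableSet))
      (((i1.add i2).add i3).const_mul _) ?_
    filter_upwards [hg, hz, diff_congr (Lp.coeFn_add p q)] with z hg hz hpq
    have g1 := hg d hd
    have hsm := mul_nonneg hC' (smallKernel_nonneg b hd z)
    have hsm' := mul_nonneg hC (smallKernel_nonneg b hd z)
    have hKd : 0 ≤ K * d * (‖diff p z‖ ^ 2 + ‖diff q z‖ ^ 2) := by positivity
    by_cases hzU : z ∈ U ×ˢ U
    · rw [Set.indicator_of_mem hzU, le_inv_mul_iff₀ hc0, hpq]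
      have g2 := hz hzU.1 hzU.2 d hd
      linarith
    · rw [Set.indicator_of_notMem hzU]
      refine mul_nonneg (inv_nonneg.2 hc0.le) ?_
      linarith

lemma compL2_symm_apply {b : CircleDiffeo} {f : L2} (hf : compL2 b f = f) :
    compL2 b.symm f = f := by
  have h1 : f =ᵐ[mu] f ∘ b.toEquiv := by
    have := coeFn_compL2 b f
    rwa [hf] at this
  refine Lp.ext ((coeFn_compL2 b.symm f).trans ?_)
  have h2 := (quasiMeasurePreserving b.symm).ae_eq_comp h1
  refine h2.trans (Filter.EventuallyEq.of_eq ?_)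
  funext y
  exact congrArg f (b.toEquiv.apply_symm_apply y)

lemma circleDeriv_symm_of_fixed (b : CircleDiffeo) {x : UnitAddCircle} (hx : b.toEquiv x = x) :
    circleDeriv b.symm.toEquiv x * circleDeriv b.toEquiv x = 1 := by
  obtain ⟨t, rfl⟩ := exists_coe x
  obtain ⟨F, G, h, ht⟩ := exists_isLift_fixed b hx
  have := h.deriv_inv_mul t
  rw [ht] at this
  rw [h.circleDeriv_coe, h.symm.circleDeriv_coe, this]

/-- Invariant functions whose two Szegő components are Lipschitz away from the attracting,
respectively repelling, fixed points are locally constant near hyperbolic fixed points. -/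
lemma exists_ae_const_near_fixed (b : CircleDiffeo) {f : L2} (hf : compL2 b f = f)
    (hp : ∀ x, ¬ (b.toEquiv x = x ∧ circleDeriv b.toEquiv x < 1) → LipschitzNear (szego f) x)
    (hq : ∀ x, ¬ (b.toEquiv x = x ∧ 1 < circleDeriv b.toEquiv x) →
      LipschitzNear (f - szego f : L2) x)
    {x : UnitAddCircle} (hx : b.toEquiv x = x) (h1 : circleDeriv b.toEquiv x ≠ 1) :
    ∃ V ∈ 𝓝 x, ∃ c : ℂ, ∀ᵐ y ∂mu, y ∈ V → f y = c := by
  set p := compL2 b (szego f) with hpd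
  set q := compL2 b (f - szego f) with hqd
  have hp' : ∀ x, ¬ (b.toEquiv x = x ∧ circleDeriv b.toEquiv x < 1) → LipschitzNear p x :=
    fun x hx => by
      refine (LipschitzNear.comp b (hp _ fun h => hx ?_)).congr (coeFn_compL2 b _).symm
      have := b.toEquiv.injective h.1
      rw [this] at h
      exact ⟨this, h.2⟩
  have hq' : ∀ x, ¬ (b.toEquiv x = x ∧ 1 < circleDeriv b.toEquiv x) → LipschitzNear q x :=
    fun x hx => by
      refine (LipschitzNear.comp b (hq _ fun h => hx ?_)).congr (coeFn_compL2 b _).symm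
      have := b.toEquiv.injective h.1
      rw [this] at h
      exact ⟨this, h.2⟩
  have hadd : p + q = f := by
    rw [hpd, hqd, ← map_add, add_sub_cancel, hf]
  have hsub : p - q = compL2 b (hilbertTr f) := by
    rw [hpd, hqd, ← map_sub, hilbertTr_apply, two_smul]
    congr 1
    abel
  have hlim : Filter.Tendsto (fun d => form (resKernel b d) (p + q : L2) (p - q : L2))
      (𝓝[>] 0) (𝓝 0) := by
    have := tendsto_of_comp_regParam (h := fun d => form (resKernel b d)
      (compL2 b f) (compL2 b (hilbertTr f))) (tendsto_form_of_invariant b hf)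
    rw [hadd, hsub]
    rwa [hf] at this
  have hxx : (circleDeriv b.toEquiv x < 1 ∧ LipschitzNear q x) ∨
      (1 < circleDeriv b.toEquiv x ∧ LipschitzNear p x) := by
    rcases lt_or_gt_of_ne h1 with h | h
    · exact Or.inl ⟨h, hq' x fun hc => absurd hc.2 (not_lt.2 h.le)⟩
    · exact Or.inr ⟨h, hp' x fun hc => absurd hc.2 (not_lt.2 h.le)⟩
  obtain ⟨U, hU, hUm, hU2⟩ := tendsto_concentration b p q (fun y => by
    by_cases h2 : b.toEquiv y = y ∧ circleDeriv b.toEquiv y < 1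
    · exact Or.inr (Or.inl ⟨h2.2, hq' y fun hc => absurd hc.2 (not_lt.2 h2.2.le)⟩)
    · by_cases h3 : b.toEquiv y = y ∧ 1 < circleDeriv b.toEquiv y
      · exact Or.inr (Or.inr ⟨h3.2, hp' y h2⟩)
      · exact Or.inl ⟨hp' y h2, hq' y h3⟩) hlim hxx
  rw [hadd] at hU2
  rcases lt_or_gt_of_ne h1 with h | h
  · exact exists_ae_const_of_concentration b b hf hx h hU hUm hU2
  -- At a repelling point the rescaling is done with the inverse, whose multiplier there is less
  -- than `1`.
  · refine exists_ae_const_of_concentration b b.symm (compL2_symm_apply hf) ?_ ?_ hU hUm hU2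
    · exact b.toEquiv.symm_apply_eq.2 hx.symm
    · have h2 := circleDeriv_symm_of_fixed b hx
      have h3 := b.symm.circleDeriv_pos x
      nlinarith

/-! ### Smooth functions on the circle and their Fourier series -/

lemma contDiff_smooth (φ : SmoothFun) :
    ContDiff ℝ ∞ fun t : ℝ => (φ : UnitAddCircle → ℂ) (t : UnitAddCircle) := φ.2

lemma continuous_smooth (φ : SmoothFun) : Continuous (φ : UnitAddCircle → ℂ) :=
  continuous_of_comp_coe ((contDiff_smooth φ).continuous)

lemma periodic_smooth (φ : UnitAddCircle → ℂ) :
    Function.Periodic (fun t : ℝ => φ (t : UnitAddCircle)) 1 := fun t => by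
  simp only [AddCircle.coe_add_period]

lemma apply_coord_of_periodic {g : ℝ → ℂ} (hg : Function.Periodic g 1) (t : ℝ) :
    g (coord (t : UnitAddCircle)) = g t := by
  have h : ((coord (t : UnitAddCircle) : ℝ) : UnitAddCircle) = (t : UnitAddCircle) := coe_coord _
  rw [← sub_eq_zero, ← AddCircle.coe_sub, AddCircle.coe_eq_zero_iff] at h
  obtain ⟨n, hn⟩ := h
  have h2 : coord (t : UnitAddCircle) = t + n * 1 := by
    rw [zsmul_eq_mul] at hn
    linarith
  rw [h2, hg.int_mul]

/-- Differentiation of smooth functions on the circle. -/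
def derivSmooth : SmoothFun →ₗ[ℂ] SmoothFun where
  toFun φ := ⟨fun y => deriv (fun t : ℝ => (φ : UnitAddCircle → ℂ) (t : UnitAddCircle)) (coord y), by
    have hp : Function.Periodic
        (deriv fun t : ℝ => (φ : UnitAddCircle → ℂ) (t : UnitAddCircle)) 1 := fun x => by
      rw [← deriv_comp_add_const]
      exact congrFun (congrArg deriv (funext (periodic_smooth φ))) x
    show ContDiff ℝ ∞ _
    simp only [apply_coord_of_periodic hp]
    exact (contDiff_infty_iff_deriv.1 φ.2).2⟩
  map_add' φ ψ := by
    ext y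
    exact deriv_add ((contDiff_smooth φ).differentiable (by simp) _)
      ((contDiff_smooth ψ).differentiable (by simp) _)
  map_smul' c φ := by
    ext y
    exact deriv_const_mul c ((contDiff_smooth φ).differentiable (by simp) _)

lemma derivSmooth_coe (φ : SmoothFun) (t : ℝ) :
    (derivSmooth φ : UnitAddCircle → ℂ) (t : UnitAddCircle)
      = deriv (fun t : ℝ => (φ : UnitAddCircle → ℂ) (t : UnitAddCircle)) t := by
  have hp : Function.Periodic
      (deriv fun t : ℝ => (φ : UnitAddCircle → ℂ) (t : UnitAddCircle)) 1 := fun x => by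
    rw [← deriv_comp_add_const]
    exact congrFun (congrArg deriv (funext (periodic_smooth φ))) x
  exact apply_coord_of_periodic hp t

lemma iteratedDeriv_smooth (φ : SmoothFun) (n : ℕ) :
    iteratedDeriv n (fun t : ℝ => (φ : UnitAddCircle → ℂ) (t : UnitAddCircle))
      = fun t : ℝ => ((derivSmooth ^ n) φ : UnitAddCircle → ℂ) (t : UnitAddCircle) := by
  induction n with
  | zero => simp
  | succ n ih =>
    rw [iteratedDeriv_succ, ih]
    funext t
    rw [pow_succ', Module.End.mul_apply, derivSmooth_coe]

lemma derivBound_iff (φ : SmoothFun) (N : ℕ) (M : ℝ) :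
    DerivBound (φ : UnitAddCircle → ℂ) N M ↔
      ∀ n ≤ N, ∀ x, ‖((derivSmooth ^ n) φ : UnitAddCircle → ℂ) x‖ ≤ M := by
  simp only [DerivBound, iteratedDeriv_smooth]
  refine forall₂_congr fun n _ => ⟨fun h x => ?_, fun h x => h x⟩
  obtain ⟨t, rfl⟩ := exists_coe x
  exact h t

/-- Multiplication by a smooth function. -/
def mulSmooth (χ : SmoothFun) : SmoothFun →ₗ[ℂ] SmoothFun where
  toFun φ := ⟨fun y => (χ : UnitAddCircle → ℂ) y * (φ : UnitAddCircle → ℂ) y,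
    (contDiff_smooth χ).mul (contDiff_smooth φ)⟩
  map_add' φ ψ := by
    ext y
    exact mul_add _ _ _
  map_smul' c φ := by
    ext y
    exact mul_left_comm _ _ _

lemma mulSmooth_apply (χ φ : SmoothFun) (y : UnitAddCircle) :
    (mulSmooth χ φ : UnitAddCircle → ℂ) y
      = (χ : UnitAddCircle → ℂ) y * (φ : UnitAddCircle → ℂ) y := rfl

lemma exists_derivBound_mul (χ : SmoothFun) (N : ℕ) :
    ∃ C : ℝ, ∀ (φ : SmoothFun) (M : ℝ), DerivBound (φ : UnitAddCircle → ℂ) N M →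
      DerivBound (mulSmooth χ φ : UnitAddCircle → ℂ) N (C * M) := by
  have hid : Function.Periodic (deriv (id : ℝ → ℝ)) 1 := fun x => by simp
  choose C hC using fun k => bound_comp_mul (G := id) contDiff_id hid k
    (fun t : ℝ => (χ : UnitAddCircle → ℂ) (t : UnitAddCircle)) χ.2 (periodic_smooth χ)
  refine ⟨∑ k ∈ Finset.range (N + 1), |C k|, fun φ M hM k hk x => ?_⟩
  have hM0 : 0 ≤ M := (norm_nonneg _).trans (hM 0 (Nat.zero_le _) 0)
  have h1 := hC k (fun t : ℝ => (φ : UnitAddCircle → ℂ) (t : UnitAddCircle)) M φ.2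
    (fun j hj => hM j (hj.trans hk)) x
  have h2 : (fun t : ℝ => (mulSmooth χ φ : UnitAddCircle → ℂ) (t : UnitAddCircle)) =
      fun t : ℝ => (φ : UnitAddCircle → ℂ) ((id t : ℝ) : UnitAddCircle)
        * (χ : UnitAddCircle → ℂ) (t : UnitAddCircle) := by
    funext t
    exact mul_comm _ _
  rw [h2]
  refine h1.trans (mul_le_mul_of_nonneg_right ((le_abs_self _).trans ?_) hM0)
  exact Finset.single_le_sum (f := fun k => |C k|) (fun i _ => abs_nonneg _)
    (Finset.mem_range.2 (by omega))

/-- The product of a distribution and a smooth function. -/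
def CircleDistribution.mul (u : CircleDistribution) (χ : SmoothFun) : CircleDistribution where
  toLin := u.toLin ∘ₗ mulSmooth χ
  bounded := by
    obtain ⟨N, C, hC⟩ := u.bounded
    obtain ⟨D, hD⟩ := exists_derivBound_mul χ N
    refine ⟨N, C * D, fun φ M hM => ?_⟩
    rw [mul_assoc]
    exact hC _ _ (hD φ M hM)

lemma CircleDistribution.mul_apply (u : CircleDistribution) (χ φ : SmoothFun) :
    (u.mul χ).toLin φ = u.toLin (mulSmooth χ φ) := rfl

/-- The exponential `e_k` as a smooth function. -/
def expoSmooth (k : ℤ) : SmoothFun := ⟨expo k, by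
  show ContDiff ℝ ∞ _
  simp only [expo_coe]
  exact (contDiff_const.mul Complex.ofRealCLM.contDiff).cexp⟩

lemma expoSmooth_apply (k : ℤ) (y : UnitAddCircle) :
    (expoSmooth k : UnitAddCircle → ℂ) y = expo k y := rfl

lemma derivSmooth_expoSmooth (k : ℤ) :
    derivSmooth (expoSmooth k) = (2 * Real.pi * Complex.I * k : ℂ) • expoSmooth k := by
  ext y
  obtain ⟨t, rfl⟩ := exists_coe y
  rw [derivSmooth_coe]
  simp only [expoSmooth_apply, expo_coe]
  have h := ((Complex.ofRealCLM.hasDerivAt (x := t)).const_mul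
    (2 * Real.pi * Complex.I * k : ℂ)).cexp.deriv
  refine h.trans ?_
  simp [expoSmooth_apply, expo_coe, mul_comm]

lemma derivSmooth_pow_expoSmooth (k : ℤ) (n : ℕ) :
    (derivSmooth ^ n) (expoSmooth k) = ((2 * Real.pi * Complex.I * k : ℂ) ^ n) • expoSmooth k := by
  induction n with
  | zero => simp
  | succ n ih =>
    rw [pow_succ', Module.End.mul_apply, ih, map_smul, derivSmooth_expoSmooth, smul_smul, pow_succ]

/-- A smooth function as a square integrable one. -/
def toL2 : SmoothFun →ₗ[ℂ] L2 where
  toFun φ := ContinuousMap.toLp 2 mu ℂ ⟨φ, continuous_smooth φ⟩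
  map_add' φ ψ := by
    rw [← map_add]
    rfl
  map_smul' c φ := by
    rw [RingHom.id_apply, ← map_smul]
    rfl

lemma coeFn_toL2 (φ : SmoothFun) : toL2 φ =ᵐ[mu] (φ : UnitAddCircle → ℂ) :=
  ContinuousMap.coeFn_toLp mu _

lemma toL2_expoSmooth (k : ℤ) : toL2 (expoSmooth k) = basis k :=
  Lp.ext ((coeFn_toL2 _).trans (coeFn_basis k).symm)

lemma inner_basis_toL2 (k : ℤ) (φ : SmoothFun) : ⟪basis k, toL2 φ⟫_ℂ
    = ∫ t in (0 : ℝ)..1, (φ : UnitAddCircle → ℂ) (t : UnitAddCircle)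
        * conj (expo k (t : UnitAddCircle)) := by
  rw [inner_basis, ← integral_mu (fun x => (φ : UnitAddCircle → ℂ) x * conj (expo k x))]
  refine integral_congr_ae ?_
  filter_upwards [coeFn_toL2 φ] with x hx
  rw [hx]

lemma inner_basis_toL2_deriv (k : ℤ) (φ : SmoothFun) : ⟪basis k, toL2 (derivSmooth φ)⟫_ℂ
    = 2 * Real.pi * Complex.I * k * ⟪basis k, toL2 φ⟫_ℂ := by
  rw [inner_basis_toL2, inner_basis_toL2]
  simp only [derivSmooth_coe]
  refine integral_deriv_mul_expo (fun t => ?_) ?_ ?_ k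
  · exact ((contDiff_smooth φ).differentiable (by simp) t).hasDerivAt
  · exact (contDiff_infty_iff_deriv.1 φ.2).2.continuous
  · have := periodic_smooth φ 0
    simpa using this

lemma inner_basis_toL2_deriv_pow (k : ℤ) (φ : SmoothFun) (n : ℕ) :
    ⟪basis k, toL2 ((derivSmooth ^ n) φ)⟫_ℂ
      = (2 * Real.pi * Complex.I * k : ℂ) ^ n * ⟪basis k, toL2 φ⟫_ℂ := by
  induction n with
  | zero => simp
  | succ n ih =>
    rw [pow_succ', Module.End.mul_apply, inner_basis_toL2_deriv, ih]
    ring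

lemma norm_basis (k : ℤ) : ‖basis k‖ = 1 := basis.orthonormal.norm_eq_one k

lemma norm_inner_basis_le (k : ℤ) (v : L2) : ‖⟪basis k, v⟫_ℂ‖ ≤ ‖v‖ := by
  have := norm_inner_le_norm (𝕜 := ℂ) (basis k) v
  rwa [norm_basis, one_mul] at this

lemma one_add_pow_le (x : ℝ) (hx : 0 ≤ x) (n : ℕ) : (1 + x) ^ n ≤ 2 ^ n * (1 + x ^ n) := by
  rcases le_total x 1 with h | h
  · calc (1 + x) ^ n ≤ 2 ^ n := by gcongr; linarith
      _ ≤ 2 ^ n * (1 + x ^ n) := le_mul_of_one_le_right (by positivity)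
          (by linarith [pow_nonneg hx n])
  · calc (1 + x) ^ n ≤ (2 * x) ^ n := by gcongr; linarith
      _ = 2 ^ n * x ^ n := mul_pow _ _ _
      _ ≤ _ := by gcongr; linarith

lemma norm_two_pi_I_mul (k : ℤ) : ‖(2 * Real.pi * Complex.I * k : ℂ)‖ = 2 * Real.pi * |(k : ℝ)| := by
  simp [abs_of_pos Real.pi_pos]

/-- The Fourier coefficients of a smooth function decay rapidly. -/
lemma exists_coeff_le (φ : SmoothFun) (n : ℕ) : ∃ C : ℝ, 0 ≤ C ∧ ∀ k : ℤ,
    (1 + |(k : ℝ)|) ^ n * ‖⟪basis k, toL2 φ⟫_ℂ‖ ≤ C := by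
  refine ⟨2 ^ n * (‖toL2 φ‖ + ‖toL2 ((derivSmooth ^ n) φ)‖), by positivity, fun k => ?_⟩
  have h1 := norm_inner_basis_le k (toL2 φ)
  have h2 := norm_inner_basis_le k (toL2 ((derivSmooth ^ n) φ))
  rw [inner_basis_toL2_deriv_pow, norm_mul, norm_pow, norm_two_pi_I_mul, mul_pow] at h2
  have h3 : (1 : ℝ) ≤ (2 * Real.pi) ^ n := one_le_pow₀ (by linarith [Real.pi_gt_three])
  have h4 : |(k : ℝ)| ^ n * ‖⟪basis k, toL2 φ⟫_ℂ‖ ≤ ‖toL2 ((derivSmooth ^ n) φ)‖ := by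
    refine le_trans ?_ h2
    rw [mul_assoc]
    exact le_mul_of_one_le_left (by positivity) h3
  calc _ ≤ 2 ^ n * (1 + |(k : ℝ)| ^ n) * ‖⟪basis k, toL2 φ⟫_ℂ‖ :=
        mul_le_mul_of_nonneg_right (one_add_pow_le _ (abs_nonneg _) n) (norm_nonneg _)
    _ = 2 ^ n * (‖⟪basis k, toL2 φ⟫_ℂ‖ + |(k : ℝ)| ^ n * ‖⟪basis k, toL2 φ⟫_ℂ‖) := by ring
    _ ≤ _ := by gcongr

lemma summable_of_le_inv_sq {a : ℤ → ℝ} {C : ℝ} (h0 : ∀ k, 0 ≤ a k)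
    (h : ∀ k : ℤ, (1 + |(k : ℝ)|) ^ 2 * a k ≤ C) : Summable a := by
  refine Summable.of_nonneg_of_le h0 (fun k => ?_) (summable_inv_one_add_abs_sq.mul_left C)
  have : (0 : ℝ) < (1 + |(k : ℝ)|) ^ 2 := by positivity
  rw [inv_pow, ← div_eq_mul_inv, le_div_iff₀' this]
  exact h k

lemma summable_coeff (φ : SmoothFun) (n : ℕ) :
    Summable fun k : ℤ => (1 + |(k : ℝ)|) ^ n * ‖⟪basis k, toL2 φ⟫_ℂ‖ := by
  obtain ⟨C, -, hC⟩ := exists_coeff_le φ (n + 2)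
  refine summable_of_le_inv_sq (C := C) (fun k => by positivity) fun k => ?_
  rw [← mul_assoc, ← pow_add, add_comm 2 n]
  exact hC k

lemma summable_norm_coeff (φ : SmoothFun) : Summable fun k : ℤ => ‖⟪basis k, toL2 φ⟫_ℂ‖ := by
  simpa using summable_coeff φ 0

lemma hasSum_smooth (φ : SmoothFun) (x : UnitAddCircle) :
    HasSum (fun k : ℤ => ⟪basis k, toL2 φ⟫_ℂ * expo k x) ((φ : UnitAddCircle → ℂ) x) := by
  have hc : ∀ k, fourierCoeff (φ : UnitAddCircle → ℂ) k = ⟪basis k, toL2 φ⟫_ℂ := fun k => by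
    rw [inner_basis, fourierCoeff]
    refine integral_congr_ae ?_
    filter_upwards [coeFn_toL2 φ] with x hx
    rw [hx, conj_expo, smul_eq_mul, mul_comm]
    rfl
  have := has_pointwise_sum_fourier_series_of_summable
    (f := ⟨(φ : UnitAddCircle → ℂ), continuous_smooth φ⟩) (by
      have := (summable_norm_coeff φ).of_norm
      simp only [← hc] at this
      exact this) x
  convert this using 3 with k
  · rw [← hc, smul_eq_mul]
    rfl
  · rfl

lemma norm_sub_sum_le {c : ℤ → ℂ} {s : ℂ} (hs : HasSum c s) (hc : Summable fun k => ‖c k‖)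
    (F : Finset ℤ) : ‖s - ∑ k ∈ F, c k‖ ≤ ∑' k, ‖c k‖ - ∑ k ∈ F, ‖c k‖ := by
  rw [← hs.tsum_eq, ← hs.summable.sum_add_tsum_compl (s := F), ← hc.sum_add_tsum_compl (s := F),
    add_sub_cancel_left, add_sub_cancel_left]
  exact norm_tsum_le_tsum_norm (hc.subtype _)

/-- A distribution applied to a smooth function, in terms of Fourier coefficients. -/
lemma CircleDistribution.hasSum_apply (u : CircleDistribution) (φ : SmoothFun) :
    HasSum (fun k : ℤ => ⟪basis k, toL2 φ⟫_ℂ * u.toLin (expoSmooth k)) (u.toLin φ) := by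
  obtain ⟨N, C, hC⟩ := u.bounded
  set c : ℕ → ℤ → ℂ := fun n k => ⟪basis k, toL2 ((derivSmooth ^ n) φ)⟫_ℂ with hc
  have hcs : ∀ n, Summable fun k => ‖c n k‖ := fun n => summable_norm_coeff _
  -- The sum of the tails of the Fourier series of all derivatives of order at most `N`: it bounds
  -- all these derivatives of the remainder at once.
  set e : Finset ℤ → ℝ := fun F =>
    ∑ n ∈ Finset.range (N + 1), (∑' k, ‖c n k‖ - ∑ k ∈ F, ‖c n k‖) with he
  have he0 : Filter.Tendsto (fun F => C * e F) Filter.atTop (𝓝 0) := by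
    have : Filter.Tendsto e Filter.atTop (𝓝 (∑ n ∈ Finset.range (N + 1), 0)) := by
      refine tendsto_finsetSum _ fun n _ => ?_
      have := (hcs n).hasSum.const_sub (∑' k, ‖c n k‖)
      rwa [sub_self] at this
    simpa using this.const_mul C
  have hbd : ∀ F : Finset ℤ, DerivBound
      ((φ - ∑ k ∈ F, ⟪basis k, toL2 φ⟫_ℂ • expoSmooth k : SmoothFun) : UnitAddCircle → ℂ)
      N (e F) := fun F => by
    rw [derivBound_iff]
    intro n hn x
    have h1 : ((derivSmooth ^ n) (φ - ∑ k ∈ F, ⟪basis k, toL2 φ⟫_ℂ • expoSmooth k) :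
        UnitAddCircle → ℂ) x = ((derivSmooth ^ n) φ : UnitAddCircle → ℂ) x
          - ∑ k ∈ F, c n k * expo k x := by
      rw [map_sub, map_sum]
      simp only [map_smul, derivSmooth_pow_expoSmooth, hc, inner_basis_toL2_deriv_pow]
      rw [Submodule.coe_sub, Pi.sub_apply, Submodule.coe_sum, Finset.sum_apply]
      congr 1
      refine Finset.sum_congr rfl fun k _ => ?_
      simp only [Submodule.coe_smul, Pi.smul_apply, smul_eq_mul, expoSmooth_apply]
      ring
    have hn' : ∀ k, ‖c n k * expo k x‖ = ‖c n k‖ := fun k => by rw [norm_mul, norm_expo, mul_one]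
    have h2 := norm_sub_sum_le (hasSum_smooth ((derivSmooth ^ n) φ) x) (by
      simp only [norm_mul, norm_expo, mul_one]; exact hcs n) F
    simp only [norm_mul, norm_expo, mul_one] at h2
    rw [h1]
    refine h2.trans ?_
    exact Finset.single_le_sum (f := fun n => ∑' k, ‖c n k‖ - ∑ k ∈ F, ‖c n k‖)
      (fun i _ => sub_nonneg.2 ((hcs i).sum_le_tsum _ fun _ _ => norm_nonneg _))
      (Finset.mem_range.2 (by omega))
  have h := squeeze_zero (fun F => norm_nonneg _) (fun F => hC _ _ (hbd F)) he0
  rw [HasSum, ← tendsto_sub_nhds_zero_iff, tendsto_zero_iff_norm_tendsto_zero]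
  refine h.congr fun F => ?_
  rw [map_sub, map_sum, norm_sub_rev]
  simp only [map_smul, smul_eq_mul]

/-- The Fourier coefficients of a distribution grow at most polynomially. -/
lemma CircleDistribution.exists_growth (u : CircleDistribution) : ∃ (N : ℕ) (C : ℝ), 0 ≤ C ∧
    ∀ k : ℤ, ‖u.toLin (expoSmooth k)‖ ≤ C * (1 + |(k : ℝ)|) ^ N := by
  obtain ⟨N, C, hC⟩ := u.bounded
  refine ⟨N, |C| * (2 * Real.pi) ^ N, by positivity, fun k => ?_⟩
  have h := hC (expoSmooth k) ((2 * Real.pi * (1 + |(k : ℝ)|)) ^ N) (by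
    rw [derivBound_iff]
    intro n hn x
    rw [derivSmooth_pow_expoSmooth, Submodule.coe_smul, Pi.smul_apply, norm_smul, norm_pow,
      norm_two_pi_I_mul, expoSmooth_apply, norm_expo, mul_one]
    have h1 : (1 : ℝ) ≤ 2 * Real.pi := by linarith [Real.pi_gt_three]
    calc (2 * Real.pi * |(k : ℝ)|) ^ n ≤ (2 * Real.pi * (1 + |(k : ℝ)|)) ^ n := by
          gcongr; linarith
      _ ≤ _ := pow_le_pow_right₀ (one_le_mul_of_one_le_of_one_le h1
          (by linarith [abs_nonneg (k : ℝ)])) hn)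
  refine h.trans ?_
  rw [mul_pow, ← mul_assoc]
  gcongr
  exact le_abs_self C

/-! ### Rapidly decaying Fourier coefficients and wavefront sets -/

/-- The Fourier coefficients of `u` of the sign of `σ` decay rapidly. -/
def CircleDistribution.RapidDecay (u : CircleDistribution) (σ : ℤ) : Prop :=
  ∀ N : ℕ, ∃ C : ℝ, 0 ≤ C ∧ ∀ k : ℤ, 0 < σ * k →
    (1 + |(k : ℝ)|) ^ N * ‖u.toLin (expoSmooth (-k))‖ ≤ C

/-- At the frequencies `2 π k` the local exponential is the restriction of a global character, up to
a unimodular factor. So the decay in the definition of `WF` yields decay of the Fourier coefficients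
of `χ u`. -/
lemma localExp_two_pi (χ : SmoothFun) (x : UnitAddCircle)
    (hχ : tsupport (χ : UnitAddCircle → ℂ) ⊆ Metric.ball x (1 / 2)) (k : ℤ) :
    localExp χ x hχ (2 * Real.pi * k) = conj (expo (-k) x) • mulSmooth χ (expoSmooth (-k)) := by
  ext y
  have h : Complex.exp (-(Complex.I * ((2 * Real.pi * k : ℝ) : ℂ) * coord (y - x)))
      = expo (-k) y * conj (expo (-k) x) := by
    rw [← expo_sub, ← coe_coord (y - x), expo_coe, coe_coord]
    congr 1
    push_cast
    ring
  rw [Submodule.coe_smul, Pi.smul_apply, mulSmooth_apply, expoSmooth_apply, smul_eq_mul]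
  show (χ : UnitAddCircle → ℂ) y * Complex.exp _ = _
  rw [h]
  ring

lemma CircleDistribution.exists_rapidDecay (u : CircleDistribution) {x : UnitAddCircle} {σ : ℤ}
    (hσ : σ ≠ 0) (h : (x, (σ : ℝ)) ∉ u.WF) :
    ∃ χ : SmoothFun, (χ : UnitAddCircle → ℂ) x ≠ 0 ∧ (u.mul χ).RapidDecay σ := by
  have h2 : ∃ (χ : SmoothFun) (hχ : tsupport (χ : UnitAddCircle → ℂ) ⊆ Metric.ball x (1 / 2)),
      (χ : UnitAddCircle → ℂ) x ≠ 0 ∧ ∀ N : ℕ, ∃ C : ℝ, ∀ η : ℝ, 0 < η * (σ : ℝ) →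
      (1 + |η|) ^ N * ‖u.toLin (localExp χ x hχ η)‖ ≤ C := by
    by_contra hcon
    exact h ⟨Int.cast_ne_zero.2 hσ, hcon⟩
  obtain ⟨χ, hχ, hx, hN⟩ := h2
  refine ⟨χ, hx, fun N => ?_⟩
  obtain ⟨C, hC⟩ := hN N
  refine ⟨max C 0, le_max_right _ _, fun k hk => ?_⟩
  have hk' : (0 : ℝ) < 2 * Real.pi * k * σ := by
    have : (0 : ℝ) < σ * k := by exact_mod_cast hk
    have := mul_pos Real.two_pi_pos this
    linarith
  refine le_trans ?_ ((hC (2 * Real.pi * k) hk').trans (le_max_left _ _))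
  rw [localExp_two_pi, map_smul, norm_smul, RCLike.norm_conj, norm_expo, one_mul, mul_apply]
  refine mul_le_mul_of_nonneg_right ?_ (norm_nonneg _)
  have : |(k : ℝ)| ≤ |2 * Real.pi * k| := by
    rw [abs_mul, abs_of_pos Real.two_pi_pos]
    exact le_mul_of_one_le_left (abs_nonneg _) (by linarith [Real.pi_gt_three])
  gcongr

lemma mulSmooth_expoSmooth_expoSmooth (j k : ℤ) :
    mulSmooth (expoSmooth j) (expoSmooth k) = expoSmooth (j + k) := by
  ext y
  exact (expo_add_index j k y).symm

lemma mulSmooth_comm (χ φ : SmoothFun) : mulSmooth χ φ = mulSmooth φ χ := by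
  ext y
  exact mul_comm _ _

lemma mulSmooth_assoc (χ ρ φ : SmoothFun) :
    mulSmooth χ (mulSmooth ρ φ) = mulSmooth (mulSmooth χ ρ) φ := by
  ext y
  exact (mul_assoc _ _ _).symm

lemma CircleDistribution.mul_mul (u : CircleDistribution) (χ ρ : SmoothFun) :
    (u.mul χ).mul ρ = u.mul (mulSmooth χ ρ) := by
  ext φ
  rw [mul_apply, mul_apply, mul_apply, mulSmooth_assoc]

/-- The coefficients are convolved with those of `ρ`. If `k - j` has the sign of `σ`, the decay of
`u` is used with `1 + |k| ≤ (1 + |k - j|) (1 + |j|)`. Otherwise `|k|` and `|k - j|` are at most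
`|j|`, and the rapid decay of the coefficients of `ρ` absorbs the polynomial growth of those of `u`.
-/
lemma CircleDistribution.RapidDecay.mul {u : CircleDistribution} {σ : ℤ} (h : u.RapidDecay σ)
    (ρ : SmoothFun) : (u.mul ρ).RapidDecay σ := by
  intro N
  obtain ⟨C, hC0, hC⟩ := h N
  obtain ⟨N₀, C₀, hC₀, hg⟩ := u.exists_growth
  have hs := (summable_coeff ρ (N + N₀)).mul_left (C + C₀)
  refine ⟨∑' j : ℤ, (C + C₀) * ((1 + |(j : ℝ)|) ^ (N + N₀) * ‖⟪basis j, toL2 ρ⟫_ℂ‖),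
    tsum_nonneg fun j => by positivity, fun k hk => ?_⟩
  have key : ∀ j : ℤ, (1 + |(k : ℝ)|) ^ N * ‖u.toLin (expoSmooth (-(k - j)))‖
      ≤ (C + C₀) * (1 + |(j : ℝ)|) ^ (N + N₀) := fun j => by
    have h1 : (1 : ℝ) ≤ 1 + |(j : ℝ)| := by linarith [abs_nonneg (j : ℝ)]
    rcases lt_or_ge 0 (σ * (k - j)) with hpos | hneg
    · have h2 : 1 + |(k : ℝ)| ≤ (1 + |((k - j : ℤ) : ℝ)|) * (1 + |(j : ℝ)|) := by
        have : |(k : ℝ)| ≤ |((k - j : ℤ) : ℝ)| + |(j : ℝ)| := by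
          have := abs_add_le ((k - j : ℤ) : ℝ) (j : ℝ)
          push_cast at this ⊢
          rwa [sub_add_cancel] at this
        nlinarith [abs_nonneg ((k - j : ℤ) : ℝ), abs_nonneg (j : ℝ)]
      calc _ ≤ ((1 + |((k - j : ℤ) : ℝ)|) * (1 + |(j : ℝ)|)) ^ N *
            ‖u.toLin (expoSmooth (-(k - j)))‖ := by gcongr
        _ = ((1 + |((k - j : ℤ) : ℝ)|) ^ N * ‖u.toLin (expoSmooth (-(k - j)))‖) *
            (1 + |(j : ℝ)|) ^ N := by rw [mul_pow]; ring
        _ ≤ C * (1 + |(j : ℝ)|) ^ N := by gcongr; exact hC _ hpos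
        _ ≤ _ := by
          refine mul_le_mul (by linarith) ?_ (by positivity) (by linarith)
          exact pow_le_pow_right₀ h1 (by omega)
    · have habs : |k| ≤ |j| ∧ |k - j| ≤ |j| := by
        rcases lt_trichotomy σ 0 with hs | hs | hs
        · have h3 : k < 0 := by nlinarith
          have h4 : j ≤ k := by nlinarith
          rw [abs_of_neg h3, abs_of_neg (by omega), abs_of_nonneg (by omega)]
          omega
        · simp [hs] at hk
        · have h3 : 0 < k := by nlinarith
          have h4 : k ≤ j := by nlinarith
          rw [abs_of_pos h3, abs_of_pos (by omega), abs_of_nonpos (by omega)]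
          omega
      have h3 : |(k : ℝ)| ≤ |(j : ℝ)| := by exact_mod_cast habs.1
      have h4 : |((-(k - j) : ℤ) : ℝ)| ≤ |(j : ℝ)| := by
        rw [← Int.cast_abs, ← Int.cast_abs, abs_neg]
        exact_mod_cast habs.2
      calc _ ≤ (1 + |(j : ℝ)|) ^ N * (C₀ * (1 + |(j : ℝ)|) ^ N₀) := by
            refine mul_le_mul (by gcongr) ((hg _).trans (by gcongr)) (norm_nonneg _)
              (by positivity)
        _ = C₀ * (1 + |(j : ℝ)|) ^ (N + N₀) := by rw [pow_add]; ring
        _ ≤ _ := by gcongr; linarith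
  have hsum := (u.mul (expoSmooth (-k))).hasSum_apply ρ
  have hle : ∀ j : ℤ, ‖((1 + |(k : ℝ)|) ^ N : ℝ) •
      (⟪basis j, toL2 ρ⟫_ℂ * (u.mul (expoSmooth (-k))).toLin (expoSmooth j))‖ ≤
      (C + C₀) * ((1 + |(j : ℝ)|) ^ (N + N₀) * ‖⟪basis j, toL2 ρ⟫_ℂ‖) := fun j => by
    rw [mul_apply, mulSmooth_expoSmooth_expoSmooth, norm_smul, norm_mul, Real.norm_of_nonneg
      (by positivity), show -k + j = -(k - j) by ring]
    calc _ = ((1 + |(k : ℝ)|) ^ N * ‖u.toLin (expoSmooth (-(k - j)))‖) *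
          ‖⟪basis j, toL2 ρ⟫_ℂ‖ := by ring
      _ ≤ ((C + C₀) * (1 + |(j : ℝ)|) ^ (N + N₀)) * ‖⟪basis j, toL2 ρ⟫_ℂ‖ :=
          mul_le_mul_of_nonneg_right (key j) (norm_nonneg _)
      _ = _ := by ring
  have h2 := tsum_of_norm_bounded hs.hasSum hle
  rw [(hsum.const_smul ((1 + |(k : ℝ)|) ^ N : ℝ)).tsum_eq, norm_smul,
    Real.norm_of_nonneg (by positivity), mul_apply, mulSmooth_comm] at h2
  exact h2

/-! ### Square integrability of distributions -/

/-- `u` is square integrable near `x`. -/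
def CircleDistribution.SqIntegrableNear (u : CircleDistribution) (x : UnitAddCircle) : Prop :=
  ∃ χ : SmoothFun, (χ : UnitAddCircle → ℂ) x ≠ 0 ∧ ∃ C : ℝ, 0 ≤ C ∧ ∀ φ : SmoothFun,
    ‖u.toLin (mulSmooth χ φ)‖ ≤ C * ‖toL2 φ‖

/-- The two directions come with different cutoffs. Their product has rapid decay on both sides, of
which one power suffices for a bound in `L²`. -/
lemma CircleDistribution.sqIntegrableNear_of_not_mem_WF (u : CircleDistribution)
    {x : UnitAddCircle} (h1 : (x, (1 : ℝ)) ∉ u.WF) (h2 : (x, (-1 : ℝ)) ∉ u.WF) :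
    u.SqIntegrableNear x := by
  obtain ⟨χ₁, hx₁, hd₁⟩ := u.exists_rapidDecay (σ := 1) one_ne_zero (by exact_mod_cast h1)
  obtain ⟨χ₂, hx₂, hd₂⟩ := u.exists_rapidDecay (σ := -1) (by norm_num) (by exact_mod_cast h2)
  refine ⟨mulSmooth χ₁ χ₂, mul_ne_zero hx₁ hx₂, ?_⟩
  have e1 := hd₁.mul χ₂
  have e2 := hd₂.mul χ₁
  rw [mul_mul, mulSmooth_comm] at e2
  rw [mul_mul] at e1
  set w := u.mul (mulSmooth χ₁ χ₂) with hw
  obtain ⟨C₁, hC₁, hw₁⟩ := e1 1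
  obtain ⟨C₂, hC₂, hw₂⟩ := e2 1
  obtain ⟨c₀, hc₀, hc⟩ := exists_norm_tsum_le
  set A := C₁ + C₂ + ‖w.toLin (expoSmooth 0)‖ with hA
  have hA0 : 0 ≤ A := by positivity
  have hbd : ∀ k : ℤ, ‖w.toLin (expoSmooth k)‖ ≤ A * (1 + |(k : ℝ)|)⁻¹ := fun k => by
    rw [← div_eq_mul_inv, le_div_iff₀ (by positivity), mul_comm]
    have hn := norm_nonneg (w.toLin (expoSmooth 0))
    rcases lt_trichotomy k 0 with hk | hk | hk
    · have := hw₁ (-k) (by omega)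
      rw [pow_one, neg_neg, Int.cast_neg, abs_neg] at this
      linarith
    · subst hk
      simp only [Int.cast_zero, abs_zero, add_zero, one_mul]
      linarith
    · have := hw₂ (-k) (by omega)
      rw [pow_one, neg_neg, Int.cast_neg, abs_neg] at this
      linarith
  refine ⟨A * c₀, by positivity, fun φ => ?_⟩
  have h3 := hc (fun k => w.toLin (expoSmooth k)) A (toL2 φ) hbd
  have h4 := (w.hasSum_apply φ).tsum_eq
  simp only [mul_comm] at h3 h4
  rw [h4] at h3
  refine h3.trans (le_of_eq (by ring))

/-! ### Gluing local bounds -/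

lemma norm_toL2_sq (φ : SmoothFun) :
    ‖toL2 φ‖ ^ 2 = ∫ x, ‖(φ : UnitAddCircle → ℂ) x‖ ^ 2 ∂mu := by
  have h : ((‖toL2 φ‖ ^ 2 : ℝ) : ℂ) = ((∫ x, ‖(φ : UnitAddCircle → ℂ) x‖ ^ 2 ∂mu : ℝ) : ℂ) := by
    rw [Complex.ofReal_pow]
    refine (inner_self_eq_norm_sq_to_K (𝕜 := ℂ) (toL2 φ)).symm.trans ?_
    rw [L2.inner_def, ← integral_complex_ofReal]
    refine integral_congr_ae ?_
    filter_upwards [coeFn_toL2 φ] with x hx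
    rw [hx, inner_self_eq_norm_sq_to_K]
    push_cast
    rfl
  exact_mod_cast h

lemma integrable_sq_norm_smooth (φ : SmoothFun) :
    Integrable (fun x => ‖(φ : UnitAddCircle → ℂ) x‖ ^ 2) mu := by
  have hc : Continuous fun x => ‖(φ : UnitAddCircle → ℂ) x‖ ^ 2 := (continuous_smooth φ).norm.pow 2
  exact hc.integrable_of_hasCompactSupport (HasCompactSupport.of_compactSpace _)

lemma norm_toL2_mulSmooth_le {g : SmoothFun} {K : Set UnitAddCircle} (hK : MeasurableSet K)
    (hg : ∀ x ∉ K, (g : UnitAddCircle → ℂ) x = 0) {B : ℝ} (hB0 : 0 ≤ B)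
    (hB : ∀ x, ‖(g : UnitAddCircle → ℂ) x‖ ≤ B) (φ : SmoothFun) :
    ‖toL2 (mulSmooth g φ)‖ ≤ B * √(∫ x in K, ‖(φ : UnitAddCircle → ℂ) x‖ ^ 2 ∂mu) := by
  have hI : 0 ≤ ∫ x in K, ‖(φ : UnitAddCircle → ℂ) x‖ ^ 2 ∂mu :=
    integral_nonneg fun x => sq_nonneg _
  refine (pow_le_pow_iff_left₀ (norm_nonneg _) (by positivity) two_ne_zero).1 ?_
  rw [norm_toL2_sq, mul_pow, Real.sq_sqrt hI, ← integral_const_mul,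
    ← integral_indicator hK]
  refine integral_mono (integrable_sq_norm_smooth _)
    (((integrable_sq_norm_smooth φ).const_mul _).indicator hK) fun x => ?_
  by_cases hx : x ∈ K
  · simp only [Set.indicator_of_mem hx, mulSmooth_apply, norm_mul, mul_pow]
    have := hB x
    gcongr
  · simp only [Set.indicator_of_notMem hx, mulSmooth_apply, hg x hx, zero_mul, norm_zero]
    norm_num

lemma div_mem_smoothFun {ψ σ : SmoothFun}
    (h : ∀ y ∈ tsupport (ψ : UnitAddCircle → ℂ), (σ : UnitAddCircle → ℂ) y ≠ 0) :
    (fun y => (ψ : UnitAddCircle → ℂ) y / (σ : UnitAddCircle → ℂ) y) ∈ SmoothFun := by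
  show ContDiff ℝ ∞ _
  rw [contDiff_iff_contDiffAt]
  intro t
  by_cases ht : (t : UnitAddCircle) ∈ tsupport (ψ : UnitAddCircle → ℂ)
  · simp only [div_eq_mul_inv]
    exact (contDiff_smooth ψ).contDiffAt.mul ((contDiff_smooth σ).contDiffAt.inv (h _ ht))
  · have hev : ∀ᶠ r : ℝ in 𝓝 t, (r : UnitAddCircle) ∉ tsupport (ψ : UnitAddCircle → ℂ) :=
      continuous_coe.continuousAt.eventually ((isClosed_tsupport _).isOpen_compl.mem_nhds ht)
    refine (contDiffAt_const (c := (0 : ℂ))).congr_of_eventuallyEq ?_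
    filter_upwards [hev] with r hr
    rw [image_eq_zero_of_notMem_tsupport hr, zero_div]

/-- The complex conjugate of a smooth function. -/
def conjSmooth (φ : SmoothFun) : SmoothFun := ⟨fun y => conj ((φ : UnitAddCircle → ℂ) y), by
  show ContDiff ℝ ∞ _
  exact Complex.conjCLE.contDiff.comp (contDiff_smooth φ)⟩

lemma exists_norm_le_smooth (φ : SmoothFun) :
    ∃ B, 0 ≤ B ∧ ∀ x, ‖(φ : UnitAddCircle → ℂ) x‖ ≤ B := by
  obtain ⟨C, hC⟩ := isCompact_univ.exists_bound_of_continuousOn (continuous_smooth φ).continuousOn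
  exact ⟨C, (norm_nonneg _).trans (hC 0 trivial), fun x => hC x trivial⟩

/-- Local square integrability bounds can be glued. -/
lemma CircleDistribution.exists_bound_tsupport (u : CircleDistribution) (ψ : SmoothFun)
    (h : ∀ x ∈ tsupport (ψ : UnitAddCircle → ℂ), u.SqIntegrableNear x) :
    ∃ C : ℝ, 0 ≤ C ∧ ∀ φ : SmoothFun, ‖u.toLin (mulSmooth ψ φ)‖ ≤
      C * √(∫ x in tsupport (ψ : UnitAddCircle → ℂ), ‖(φ : UnitAddCircle → ℂ) x‖ ^ 2 ∂mu) := by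
  choose! χ hχ C hC0 hC using h
  obtain ⟨t, htK, ht⟩ := (isClosed_tsupport (ψ : UnitAddCircle → ℂ)).isCompact.elim_nhds_subcover
    (fun x => {y | (χ x : UnitAddCircle → ℂ) y ≠ 0})
    (fun x hx => (continuous_smooth (χ x)).continuousAt.eventually_ne (hχ x hx))
  -- Since `σ = ∑ |χ_x|²` has no zero on the support of `ψ`, one can write `ψ = ∑ χ_x (conj χ_x) ψ /
  -- σ`. The factors `(conj χ_x) ψ / σ` vanish off that support, which keeps the final bound
  -- localized there.
  set σ : SmoothFun := ∑ x ∈ t, mulSmooth (conjSmooth (χ x)) (χ x) with hσ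
  have hσ_apply : ∀ y, (σ : UnitAddCircle → ℂ) y
      = ((∑ x ∈ t, ‖(χ x : UnitAddCircle → ℂ) y‖ ^ 2 : ℝ) : ℂ) := fun y => by
    rw [hσ, Submodule.coe_sum, Finset.sum_apply, Complex.ofReal_sum]
    refine Finset.sum_congr rfl fun x _ => ?_
    rw [mulSmooth_apply, Complex.ofReal_pow]
    exact Complex.conj_mul' _
  have hσ0 : ∀ y ∈ tsupport (ψ : UnitAddCircle → ℂ), (σ : UnitAddCircle → ℂ) y ≠ 0 :=
    fun y hy => by
      rw [hσ_apply, Complex.ofReal_ne_zero]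
      have := ht hy
      simp only [Set.mem_iUnion, Set.mem_ofPred_eq, exists_prop] at this
      obtain ⟨x, hx, hxy⟩ := this
      refine (lt_of_lt_of_le (b := ‖(χ x : UnitAddCircle → ℂ) y‖ ^ 2) ?_ ?_).ne'
      · positivity
      · exact Finset.single_le_sum (f := fun x => ‖(χ x : UnitAddCircle → ℂ) y‖ ^ 2)
          (fun _ _ => sq_nonneg _) hx
  set m : SmoothFun := ⟨_, div_mem_smoothFun hσ0⟩ with hm
  set g : UnitAddCircle → SmoothFun := fun x => mulSmooth (conjSmooth (χ x)) m with hg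
  choose B hB0 hB using fun x => exists_norm_le_smooth (g x)
  have hgK : ∀ x, ∀ y ∉ tsupport (ψ : UnitAddCircle → ℂ), (g x : UnitAddCircle → ℂ) y = 0 :=
    fun x y hy => by
      have : (m : UnitAddCircle → ℂ) y = 0 := by
        show (ψ : UnitAddCircle → ℂ) y / _ = 0
        rw [image_eq_zero_of_notMem_tsupport hy, zero_div]
      simp only [hg, mulSmooth_apply, this, mul_zero]
  refine ⟨∑ x ∈ t, C x * B x, Finset.sum_nonneg fun x hx => mul_nonneg (hC0 x (htK x hx)) (hB0 x),
    fun φ => ?_⟩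
  have hdec : mulSmooth ψ φ = ∑ x ∈ t, mulSmooth (χ x) (mulSmooth (g x) φ) := by
    ext y
    rw [Submodule.coe_sum, Finset.sum_apply]
    have h1 : ∀ x, (mulSmooth (χ x) (mulSmooth (g x) φ) : UnitAddCircle → ℂ) y =
        ((‖(χ x : UnitAddCircle → ℂ) y‖ ^ 2 : ℝ) : ℂ) *
          ((m : UnitAddCircle → ℂ) y * (φ : UnitAddCircle → ℂ) y) := fun x => by
      rw [Complex.ofReal_pow, ← Complex.conj_mul']
      simp only [hg, mulSmooth_apply]
      show _ * (conj _ * _ * _) = _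
      ring
    simp only [h1]
    rw [← Finset.sum_mul, ← Complex.ofReal_sum, ← hσ_apply, mulSmooth_apply, ← mul_assoc]
    congr 1
    show _ = _ * ((ψ : UnitAddCircle → ℂ) y / (σ : UnitAddCircle → ℂ) y)
    by_cases hy : y ∈ tsupport (ψ : UnitAddCircle → ℂ)
    · rw [mul_div_cancel₀ _ (hσ0 y hy)]
    · rw [image_eq_zero_of_notMem_tsupport hy, zero_div, mul_zero]
  rw [hdec, map_sum, Finset.sum_mul]
  refine (norm_sum_le _ _).trans (Finset.sum_le_sum fun x hx => ?_)
  refine (hC x (htK x hx) _).trans ?_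
  rw [mul_assoc]
  exact mul_le_mul_of_nonneg_left (norm_toL2_mulSmooth_le (isClosed_tsupport _).measurableSet
    (hgK x) (hB0 x) (hB x) φ) (hC0 x (htK x hx))

lemma denseRange_toL2 : DenseRange toL2 := by
  have h := basis.dense_span
  have h2 : Submodule.span ℂ (Set.range basis) ≤ LinearMap.range toL2 := by
    rw [Submodule.span_le]
    rintro _ ⟨k, rfl⟩
    exact ⟨expoSmooth k, toL2_expoSmooth k⟩
  have h3 := Submodule.topologicalClosure_mono h2
  rw [h, top_le_iff] at h3
  rw [DenseRange, ← LinearMap.coe_range]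
  exact (Submodule.dense_iff_topologicalClosure_eq_top).2 h3

/-- A distribution that is square integrable near every point is a square integrable function. -/
lemma CircleDistribution.exists_L2 (u : CircleDistribution) (h : ∀ x, u.SqIntegrableNear x) :
    ∃ f : L2, ∀ φ : SmoothFun, u.toLin φ = ∫ x, f x * (φ : UnitAddCircle → ℂ) x ∂mu := by
  obtain ⟨C, hC0, hC⟩ := u.exists_bound_tsupport (expoSmooth 0) fun x _ => h x
  have hbd : ∃ C, ∀ φ : SmoothFun, ‖u.toLin φ‖ ≤ C * ‖toL2 φ‖ := by
    refine ⟨C, fun φ => ?_⟩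
    have h1 := hC φ
    have h2 : mulSmooth (expoSmooth 0) φ = φ := by
      ext y
      rw [mulSmooth_apply, expoSmooth_apply, expo_zero_index, one_mul]
    rw [h2] at h1
    refine h1.trans (mul_le_mul_of_nonneg_left ?_ hC0)
    rw [Real.sqrt_le_left (norm_nonneg _), norm_toL2_sq]
    exact setIntegral_le_integral (integrable_sq_norm_smooth φ)
      (Filter.Eventually.of_forall fun x => sq_nonneg _)
  set l : L2 →L[ℂ] ℂ := u.toLin.extendOfNorm toL2 with hl
  have hl2 : ∀ φ, l (toL2 φ) = u.toLin φ := LinearMap.extendOfNorm_eq denseRange_toL2 hbd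
  set w : L2 := (InnerProductSpace.toDual ℂ L2).symm l with hw
  -- The pairing with functions is bilinear and the inner product antilinear on the left, hence the
  -- conjugate.
  refine ⟨star w, fun φ => ?_⟩
  rw [← hl2, ← InnerProductSpace.toDual_symm_apply, L2.inner_def]
  refine integral_congr_ae ?_
  filter_upwards [coeFn_toL2 φ, Lp.coeFn_star w] with x h1 h2
  rw [h1, h2, RCLike.inner_apply, mul_comm]
  rfl

/-! ### The action on densities and invariant distributions -/

lemma integral_comp_mul_deriv_ae (b : CircleDiffeo) {f : UnitAddCircle → ℂ}
    (hf : AEStronglyMeasurable f mu) :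
    ∫ x, circleDeriv b.toEquiv x • f (b.toEquiv x) ∂mu = ∫ x, f x ∂mu := by
  rw [← integral_jacobianMeasure b (fun x => f (b.toEquiv x))]
  have h := map_jacobianMeasure b
  have h2 := integral_map (μ := jacobianMeasure b) (φ := b.toEquiv) b.continuous.aemeasurable
    (f := f) (by rw [h]; exact hf)
  rw [h] at h2
  exact h2.symm

/-- The action `φ ↦ (φ ∘ b) b'` of a diffeomorphism on smooth densities. -/
def transport (b : CircleDiffeo) : SmoothFun →ₗ[ℂ] SmoothFun where
  toFun φ := ⟨fun y => (φ : UnitAddCircle → ℂ) (b.toEquiv y) * (circleDeriv b.toEquiv y : ℂ),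
    smooth_comp_mul b.smooth_toFun φ.2⟩
  map_add' φ ψ := by
    ext y
    exact add_mul _ _ _
  map_smul' c φ := by
    ext y
    exact mul_assoc _ _ _

lemma transport_apply (b : CircleDiffeo) (φ : SmoothFun) (y : UnitAddCircle) :
    (transport b φ : UnitAddCircle → ℂ) y
      = (φ : UnitAddCircle → ℂ) (b.toEquiv y) * (circleDeriv b.toEquiv y : ℂ) := rfl

/-- Invariance of a distribution under a diffeomorphism. -/
def CircleDistribution.Invariant (u : CircleDistribution) (b : CircleDiffeo) : Prop :=
  ∀ φ, u.toLin (transport b φ) = u.toLin φ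

lemma circleDeriv_trans (b c : CircleDiffeo) (y : UnitAddCircle) :
    circleDeriv (b.trans c).toEquiv y
      = circleDeriv c.toEquiv (b.toEquiv y) * circleDeriv b.toEquiv y := by
  obtain ⟨t, rfl⟩ := exists_coe y
  obtain ⟨F, G, h⟩ := exists_isLift b
  obtain ⟨F', G', h'⟩ := exists_isLift c
  have h1 : HasDerivAt (F' ∘ F) (deriv F' (F t) * deriv F t) t :=
    (h'.hasDerivAt _).comp t (h.hasDerivAt t)
  rw [circleDeriv_eq (f := (b.trans c).toEquiv) (F := F' ∘ F) (fun s => ?_) h1.continuousAt,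
    h1.deriv, h.circleDeriv_coe, ← h.coe_eq, h'.circleDeriv_coe]
  rw [Function.comp_apply, h'.coe_eq, h.coe_eq]
  rfl

lemma transport_transport (b c : CircleDiffeo) (φ : SmoothFun) :
    transport b (transport c φ) = transport (b.trans c) φ := by
  ext y
  rw [transport_apply, transport_apply, transport_apply, circleDeriv_trans, Complex.ofReal_mul,
    mul_assoc]
  rfl

/-- The change of variables by `b⁻¹` turns the pairing of `f ∘ b` with `φ` into that of `f` with `(φ
∘ b⁻¹) (b⁻¹)'`, and the characters separate `L²`. -/
lemma compL2_eq_of_invariant {u : CircleDistribution} {b : CircleDiffeo}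
    (hu : u.Invariant b.symm) {f : L2}
    (hf : ∀ φ : SmoothFun, u.toLin φ = ∫ x, f x * (φ : UnitAddCircle → ℂ) x ∂mu) :
    compL2 b f = f := by
  have h : ∀ φ : SmoothFun, ∫ x, compL2 b f x * (φ : UnitAddCircle → ℂ) x ∂mu
      = ∫ x, f x * (φ : UnitAddCircle → ℂ) x ∂mu := fun φ => by
    rw [← hf, ← hu, hf]
    have hm : AEStronglyMeasurable (fun x => f (b.toEquiv x) * (φ : UnitAddCircle → ℂ) x) mu :=
      ((Lp.aestronglyMeasurable f).comp_quasiMeasurePreserving (quasiMeasurePreserving b)).mul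
        (continuous_smooth φ).aestronglyMeasurable
    have h1 := integral_comp_mul_deriv_ae b.symm hm
    have h2 : ∫ x, compL2 b f x * (φ : UnitAddCircle → ℂ) x ∂mu
        = ∫ x, f (b.toEquiv x) * (φ : UnitAddCircle → ℂ) x ∂mu := by
      refine integral_congr_ae ?_
      filter_upwards [coeFn_compL2 b f] with x hx
      rw [hx]
      rfl
    rw [h2, ← h1]
    refine integral_congr_ae (Filter.Eventually.of_forall fun x => ?_)
    have h3 : b.toEquiv (b.symm.toEquiv x) = x := b.toEquiv.apply_symm_apply x
    simp only [transport_apply, h3, Complex.real_smul]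
    ring
  apply basis.repr.injective
  ext k
  rw [basis.repr_apply_apply, basis.repr_apply_apply, inner_basis, inner_basis]
  have := h (expoSmooth (-k))
  simp only [expoSmooth_apply, ← conj_expo] at this
  exact this

/-! ### Square integrability near attracting fixed points -/

lemma exists_bump (x : UnitAddCircle) {r : ℝ} (hr : 0 < r) :
    ∃ χ : SmoothFun, (∀ᶠ y in 𝓝 x, (χ : UnitAddCircle → ℂ) y = 1) ∧
      ∀ y, r ≤ ‖y - x‖ → (χ : UnitAddCircle → ℂ) y = 0 := by
  -- At distance at least `r` one has `sinSq ≥ 4 r² = 2 a`, so the transition is complete; near `x`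
  -- one has `sinSq < a` and it has not begun.
  set a : ℝ := 2 * r ^ 2 with ha
  have ha0 : 0 < a := by positivity
  refine ⟨⟨fun y => ((1 - Real.smoothTransition ((sinSq (y - x) - a) / a) : ℝ) : ℂ), ?_⟩, ?_, ?_⟩
  · show ContDiff ℝ ∞ _
    obtain ⟨s, rfl⟩ := exists_coe x
    simp only [← AddCircle.coe_sub, sinSq_coe]
    refine Complex.ofRealCLM.contDiff.comp (contDiff_const.sub
      (Real.smoothTransition.contDiff.comp ?_))
    refine ContDiff.div_const (ContDiff.sub (ContDiff.pow ?_ 2) contDiff_const) a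
    exact Real.contDiff_sin.comp (contDiff_const.mul (contDiff_id.sub contDiff_const))
  · have hc : ContinuousAt (fun y => sinSq (y - x)) x :=
      (continuous_sinSq.comp (continuous_id.sub continuous_const)).continuousAt
    have h0 : sinSq (x - x) < a := by
      have : sinSq (x - x) = 0 := by
        rw [sub_self, ← AddCircle.coe_zero (p := (1 : ℝ)), sinSq_coe]
        simp
      rwa [this]
    filter_upwards [hc.eventually (gt_mem_nhds h0)] with y hy
    show ((1 - Real.smoothTransition ((sinSq (y - x) - a) / a) : ℝ) : ℂ) = 1
    rw [Real.smoothTransition.zero_of_nonpos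
      (div_nonpos_of_nonpos_of_nonneg (by linarith) ha0.le)]
    simp
  · intro y hy
    show ((1 - Real.smoothTransition ((sinSq (y - x) - a) / a) : ℝ) : ℂ) = 0
    have h1 : 2 * a ≤ sinSq (y - x) := by
      refine le_trans ?_ (four_mul_norm_sq_le_sinSq _)
      rw [ha]
      nlinarith
    rw [Real.smoothTransition.one_of_one_le ((one_le_div ha0).2 (by linarith))]
    simp

/-- All derivatives of order at most `k` of `Φ n` are `O(ρ ^ n)` on `J`. -/
def GeometricOn (J : Set ℝ) (ρ : ℝ) (k : ℕ) (Φ : ℕ → ℝ → ℂ) : Prop :=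
  ∀ j ≤ k, ∃ C : ℝ, 0 ≤ C ∧ ∀ n, ∀ t ∈ J, ‖iteratedDeriv j (Φ n) t‖ ≤ C * ρ ^ n

lemma geometricOn_zero {J : Set ℝ} {ρ : ℝ} {Φ : ℕ → ℝ → ℂ} :
    GeometricOn J ρ 0 Φ ↔ ∃ C : ℝ, 0 ≤ C ∧ ∀ n, ∀ t ∈ J, ‖Φ n t‖ ≤ C * ρ ^ n := by
  refine ⟨fun h => by simpa using h 0 le_rfl, fun h j hj => ?_⟩
  obtain rfl : j = 0 := by omega
  simpa using h

lemma geometricOn_succ {J : Set ℝ} {ρ : ℝ} {Φ : ℕ → ℝ → ℂ} {k : ℕ} :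
    GeometricOn J ρ (k + 1) Φ ↔ GeometricOn J ρ 0 Φ ∧ GeometricOn J ρ k fun n => deriv (Φ n) := by
  refine ⟨fun h => ⟨fun j hj => h j (by omega), fun j hj => ?_⟩, fun h j hj => ?_⟩
  · simpa only [← iteratedDeriv_succ'] using h (j + 1) (by omega)
  · rcases j with _ | j
    · exact h.1 0 le_rfl
    · simpa only [← iteratedDeriv_succ'] using h.2 j (by omega)

lemma GeometricOn.mono {J : Set ℝ} {ρ : ℝ} {Φ : ℕ → ℝ → ℂ} {k m : ℕ} (h : GeometricOn J ρ k Φ)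
    (hm : m ≤ k) : GeometricOn J ρ m Φ := fun j hj => h j (hj.trans hm)

lemma GeometricOn.add {J : Set ℝ} {ρ : ℝ} {Φ Ψ : ℕ → ℝ → ℂ} {k : ℕ} (h : GeometricOn J ρ k Φ)
    (h' : GeometricOn J ρ k Ψ) (hΦ : ∀ n, ContDiff ℝ ∞ (Φ n)) (hΨ : ∀ n, ContDiff ℝ ∞ (Ψ n)) :
    GeometricOn J ρ k fun n t => Φ n t + Ψ n t := fun j hj => by
  obtain ⟨C, hC0, hC⟩ := h j hj
  obtain ⟨C', hC0', hC'⟩ := h' j hj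
  refine ⟨C + C', by positivity, fun n t ht => ?_⟩
  show ‖iteratedDeriv j (Φ n + Ψ n) t‖ ≤ _
  rw [iteratedDeriv_add ((hΦ n).contDiffAt.of_le (by exact_mod_cast le_top))
    ((hΨ n).contDiffAt.of_le (by exact_mod_cast le_top)), add_mul]
  exact (norm_add_le _ _).trans (add_le_add (hC n t ht) (hC' n t ht))

lemma contDiff_deriv_smooth {E : Type*} [NormedAddCommGroup E] [NormedSpace ℝ E] {f : ℝ → E}
    (hf : ContDiff ℝ ∞ f) : ContDiff ℝ ∞ (deriv f) := (contDiff_infty_iff_deriv.1 hf).2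

lemma deriv_mul_comp {F : ℝ → ℝ} (hF : ContDiff ℝ ∞ F) {h φ : ℝ → ℂ} (hh : ContDiff ℝ ∞ h)
    (hφ : ContDiff ℝ ∞ φ) (t : ℝ) : deriv (fun t => h t * φ (F t)) t
      = deriv h t * φ (F t) + (h t * ((deriv F t : ℝ) : ℂ)) * deriv φ (F t) := by
  have e1 : HasDerivAt φ (deriv φ (F t)) (F t) := (hφ.differentiable (by simp) _).hasDerivAt
  have e2 : HasDerivAt F (deriv F t) t := (hF.differentiable (by simp) _).hasDerivAt
  have e3 : HasDerivAt h (deriv h t) t := (hh.differentiable (by simp) _).hasDerivAt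
  refine (e3.mul (e1.scomp t e2)).deriv.trans ?_
  simp only [Complex.real_smul, Function.comp_apply]
  ring

lemma contDiff_mul_deriv {F : ℝ → ℝ} (hF : ContDiff ℝ ∞ F) {h : ℝ → ℂ} (hh : ContDiff ℝ ∞ h) :
    ContDiff ℝ ∞ fun t => h t * ((deriv F t : ℝ) : ℂ) :=
  hh.mul (Complex.ofRealCLM.contDiff.comp (contDiff_deriv_smooth hF))

lemma GeometricOn.mul_comp {J : Set ℝ} (hJ : IsCompact J) {ρ : ℝ} {F : ℝ → ℝ}
    (hF : ContDiff ℝ ∞ F) (hFJ : Set.MapsTo F J J) {k : ℕ} {h : ℝ → ℂ} (hh : ContDiff ℝ ∞ h)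
    {Φ : ℕ → ℝ → ℂ} (hΦ : ∀ n, ContDiff ℝ ∞ (Φ n)) (hg : GeometricOn J ρ k Φ) :
    GeometricOn J ρ k fun n t => h t * Φ n (F t) := by
  have base : ∀ {h : ℝ → ℂ} {Φ : ℕ → ℝ → ℂ}, ContDiff ℝ ∞ h → GeometricOn J ρ 0 Φ →
      GeometricOn J ρ 0 fun n t => h t * Φ n (F t) := fun {h Φ} hh hg => by
    rw [geometricOn_zero] at hg ⊢
    obtain ⟨C, hC0, hC⟩ := hg
    obtain ⟨B, hB⟩ := hJ.exists_bound_of_continuousOn hh.continuous.continuousOn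
    refine ⟨|B| * C, by positivity, fun n t ht => ?_⟩
    rw [norm_mul, mul_assoc]
    exact mul_le_mul ((hB t ht).trans (le_abs_self B)) (hC n _ (hFJ ht)) (norm_nonneg _)
      (abs_nonneg B)
  induction k generalizing h Φ with
  | zero => exact base hh hg
  | succ k ih =>
    have hg' := geometricOn_succ.1 hg
    refine geometricOn_succ.2 ⟨base hh hg'.1, ?_⟩
    simp only [funext (deriv_mul_comp hF hh (hΦ _))]
    refine GeometricOn.add (ih (contDiff_deriv_smooth hh) hΦ (hg.mono (by omega)))
      (ih (contDiff_mul_deriv hF hh) (fun n => contDiff_deriv_smooth (hΦ n)) hg'.2) ?_ ?_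
    · exact fun n => (contDiff_deriv_smooth hh).mul ((hΦ n).comp hF)
    · exact fun n => (contDiff_mul_deriv hF hh).mul ((contDiff_deriv_smooth (hΦ n)).comp hF)

/-- Solutions of a contracting recursion are small together with their derivatives. -/
lemma geometricOn_of_recursion {J : Set ℝ} (hJ : IsCompact J) {l ρ : ℝ} (hl : 0 ≤ l) (hlρ : l < ρ)
    {F : ℝ → ℝ} (hF : ContDiff ℝ ∞ F) (hFJ : Set.MapsTo F J J)
    (hF1 : ∀ t ∈ J, |deriv F t| ≤ 1) (k : ℕ) {h : ℝ → ℂ} (hh : ContDiff ℝ ∞ h)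
    (hhl : ∀ t ∈ J, ‖h t‖ ≤ l) {Φ R : ℕ → ℝ → ℂ} (hΦ : ∀ n, ContDiff ℝ ∞ (Φ n))
    (hR : ∀ n, ContDiff ℝ ∞ (R n)) (hrec : ∀ n t, Φ (n + 1) t = h t * Φ n (F t) + R n t)
    (hRg : GeometricOn J ρ k R) : GeometricOn J ρ k Φ := by
  have hρ : 0 < ρ := hl.trans_lt hlρ
  have base : ∀ {h : ℝ → ℂ} {Φ R : ℕ → ℝ → ℂ}, (∀ t ∈ J, ‖h t‖ ≤ l) → (∀ n, ContDiff ℝ ∞ (Φ n)) →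
      (∀ n t, Φ (n + 1) t = h t * Φ n (F t) + R n t) → GeometricOn J ρ 0 R →
      GeometricOn J ρ 0 Φ := fun {h Φ R} hhl hΦ hrec hRg => by
    rw [geometricOn_zero] at hRg ⊢
    obtain ⟨C, hC0, hC⟩ := hRg
    obtain ⟨B, hB⟩ := hJ.exists_bound_of_continuousOn (hΦ 0).continuous.continuousOn
    have hd : 0 < ρ - l := by linarith
    -- The constant `A` has to satisfy `l A + C ≤ ρ A`; the summand `|B|` takes care of `n = 0`.
    refine ⟨|B| + C / (ρ - l), by positivity, fun n => ?_⟩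
    induction n with
    | zero =>
      intro t ht
      rw [pow_zero, mul_one]
      have : 0 ≤ C / (ρ - l) := by positivity
      linarith [hB t ht, le_abs_self B]
    | succ n ih =>
      intro t ht
      rw [hrec]
      have h1 : ‖h t * Φ n (F t)‖ ≤ l * ((|B| + C / (ρ - l)) * ρ ^ n) := by
        rw [norm_mul]
        exact mul_le_mul (hhl t ht) (ih _ (hFJ ht)) (norm_nonneg _) hl
      refine (norm_add_le _ _).trans ((add_le_add h1 (hC n t ht)).trans ?_)
      have h2 : C ≤ (|B| + C / (ρ - l)) * (ρ - l) := by
        rw [add_mul, div_mul_cancel₀ _ hd.ne']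
        have := mul_nonneg (abs_nonneg B) hd.le
        linarith
      have h3 := mul_le_mul_of_nonneg_right h2 (pow_nonneg hρ.le n)
      rw [pow_succ]
      linarith
  induction k generalizing h Φ R with
  | zero => exact base hhl hΦ hrec hRg
  | succ k ih =>
    have hRg' := geometricOn_succ.1 hRg
    have hk : GeometricOn J ρ k Φ := ih hh hhl hΦ hR hrec (hRg.mono (by omega))
    refine geometricOn_succ.2 ⟨hk.mono (by omega), ?_⟩
    -- The derivatives satisfy a recursion of the same form, with `h F'` in place of `h`, still
    -- bounded by `l` as `|F'| ≤ 1`, and with the new remainder `h' (Φ n ∘ F) + (R n)'`. Its first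
    -- term is controlled by the bound for `Φ` just obtained.
    refine ih (contDiff_mul_deriv hF hh) (fun t ht => ?_) (fun n => contDiff_deriv_smooth (hΦ n))
      (R := fun n t => deriv h t * Φ n (F t) + deriv (R n) t) (fun n => ?_) (fun n t => ?_) ?_
    · rw [norm_mul, Complex.norm_real]
      exact (mul_le_of_le_one_right (norm_nonneg _) (hF1 t ht)).trans (hhl t ht)
    · exact ((contDiff_deriv_smooth hh).mul ((hΦ n).comp hF)).add (contDiff_deriv_smooth (hR n))
    · have e1 : DifferentiableAt ℝ (fun t => h t * Φ n (F t)) t :=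
        (hh.mul ((hΦ n).comp hF)).differentiable (by simp) t
      have e2 : DifferentiableAt ℝ (R n) t := (hR n).differentiable (by simp) t
      have e3 : Φ (n + 1) = fun t => h t * Φ n (F t) + R n t := funext (hrec n)
      rw [e3, deriv_fun_add e1 e2, deriv_mul_comp hF hh (hΦ n)]
      ring
    · exact GeometricOn.add (GeometricOn.mul_comp hJ hF hFJ (contDiff_deriv_smooth hh) hΦ hk)
        hRg'.2 (fun n => (contDiff_deriv_smooth hh).mul ((hΦ n).comp hF))
        (fun n => contDiff_deriv_smooth (hR n))

/-- Composition of smooth functions with a diffeomorphism. -/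
def compSmooth (b : CircleDiffeo) (φ : SmoothFun) : SmoothFun :=
  ⟨fun y => (φ : UnitAddCircle → ℂ) (b.toEquiv y), by
    obtain ⟨F, G, h⟩ := exists_isLift b
    show ContDiff ℝ ∞ _
    simp only [← h.coe_eq]
    exact (contDiff_smooth φ).comp h.smooth⟩

lemma norm_coe_le_abs (r : ℝ) : ‖((r : ℝ) : UnitAddCircle)‖ ≤ |r| := by
  rw [AddCircle.norm_eq]
  simp only [inv_one, one_mul, mul_one]
  simpa using round_le r 0

lemma eq_coe_add_coord (x : ℝ) (y : UnitAddCircle) :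
    y = ((x + coord (y - x) : ℝ) : UnitAddCircle) := by
  rw [AddCircle.coe_add, coe_coord]
  abel

lemma derivSmooth_pow_eq_zero {φ : SmoothFun} {y : UnitAddCircle}
    (h : ∀ᶠ z in 𝓝 y, (φ : UnitAddCircle → ℂ) z = 0) (n : ℕ) :
    ((derivSmooth ^ n) φ : UnitAddCircle → ℂ) y = 0 := by
  obtain ⟨t, rfl⟩ := exists_coe y
  have h1 := congrFun (iteratedDeriv_smooth φ n) t
  rw [← h1]
  have h2 : (fun t : ℝ => (φ : UnitAddCircle → ℂ) (t : UnitAddCircle)) =ᶠ[𝓝 t] fun _ => 0 :=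
    continuous_coe.continuousAt.eventually h
  rw [h2.iteratedDeriv_eq]
  simp

/-- The remainder in the expansion along the orbit tends to zero. -/
lemma CircleDistribution.tendsto_apply_transport (u : CircleDistribution) {b : CircleDiffeo}
    {F G : ℝ → ℝ} (hl : IsLift b F G) {x η l r : ℝ} (hr : r < η)
    (hl0 : 0 < l) (hl1 : l < 1)
    (hc1 : ∀ t, |t - x| ≤ η → deriv F t ≤ l) (hc : ∀ t, |t - x| ≤ η → |F t - x| ≤ l * |t - x|)
    {χ : SmoothFun} (hχ : ∀ y : UnitAddCircle, r ≤ ‖y - x‖ → (χ : UnitAddCircle → ℂ) y = 0)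
    (φ : SmoothFun) : Filter.Tendsto
      (fun n => u.toLin (mulSmooth χ (transport (b.iter n) φ))) Filter.atTop (𝓝 0) := by
  obtain ⟨ρ, hlρ, hρ1⟩ := exists_between hl1
  have hρ0 : 0 < ρ := hl0.trans hlρ
  obtain ⟨N, C, hC⟩ := u.bounded
  set J := Set.Icc (x - η) (x + η) with hJd
  have hJ : ∀ t, t ∈ J ↔ |t - x| ≤ η := fun t => by
    rw [hJd, abs_le, Set.mem_Icc]
    constructor <;> rintro ⟨h1, h2⟩ <;> constructor <;> linarith
  have hF' : ContDiff ℝ ∞ fun t => ((deriv F t : ℝ) : ℂ) :=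
    Complex.ofRealCLM.contDiff.comp hl.contDiff_deriv
  have hFJ : Set.MapsTo F J J := fun t ht => by
    rw [hJ] at ht ⊢
    exact (hc t ht).trans ((mul_le_of_le_one_left (abs_nonneg _) hl1.le).trans ht)
  have habs : ∀ t ∈ J, |deriv F t| ≤ l := fun t ht => by
    rw [abs_of_pos (hl.deriv_pos t)]
    exact hc1 t ((hJ t).1 ht)
  set Φ : ℕ → ℝ → ℂ := fun n t => (transport (b.iter n) φ : UnitAddCircle → ℂ) (t : UnitAddCircle)
    with hΦd
  have hΦ : ∀ n, ContDiff ℝ ∞ (Φ n) := fun n => contDiff_smooth _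
  -- The densities obey `Φ (n + 1) = F' (Φ n ∘ F)`, a contracting recursion without remainder, so
  -- all derivatives up to the order of `u` decay geometrically near the fixed point.
  have hg : GeometricOn J ρ N Φ := by
    refine geometricOn_of_recursion isCompact_Icc hl0.le hlρ hl.smooth hFJ
      (fun t ht => (habs t ht).trans hl1.le) N hF' (fun t ht => ?_) hΦ
      (R := fun _ _ => 0) (fun n => contDiff_const) (fun n t => ?_)
      (fun j hj => ⟨0, le_rfl, fun n t ht => by simp⟩)
    · rw [Complex.norm_real]
      exact habs t ht
    · have : transport (b.iter (n + 1)) φ = transport b (transport (b.iter n) φ) :=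
        (transport_transport b (b.iter n) φ).symm
      simp only [hΦd]
      rw [this, transport_apply, hl.coe_eq, hl.circleDeriv_coe, add_zero, mul_comm]
  have hg2 := hg.mul_comp isCompact_Icc contDiff_id (Set.mapsTo_id J)
    (contDiff_smooth χ) hΦ
  choose! D hD0 hD using hg2
  have hbd : ∀ n, DerivBound (mulSmooth χ (transport (b.iter n) φ) : UnitAddCircle → ℂ) N
      ((∑ j ∈ Finset.range (N + 1), D j) * ρ ^ n) := fun n => by
    rw [derivBound_iff]
    intro j hj y
    have hsum : D j ≤ ∑ j ∈ Finset.range (N + 1), D j :=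
      Finset.single_le_sum (fun i hi => hD0 i (by simp at hi; omega))
        (Finset.mem_range.2 (by omega))
    have hsum0 : 0 ≤ ∑ j ∈ Finset.range (N + 1), D j := (hD0 j hj).trans hsum
    rcases le_or_gt ‖y - x‖ η with hy | hy
    · rw [← abs_coord] at hy
      rw [eq_coe_add_coord x y]
      have h1 := congrFun (iteratedDeriv_smooth (mulSmooth χ (transport (b.iter n) φ)) j)
        (x + coord (y - x))
      rw [← h1]
      refine (hD j hj n (x + coord (y - x)) ?_).trans ?_
      · rw [hJ, add_sub_cancel_left]
        exact hy
      · gcongr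
    · rw [derivSmooth_pow_eq_zero ?_ j, norm_zero]
      · positivity
      · have : ∀ᶠ z in 𝓝 y, r < ‖z - (x : UnitAddCircle)‖ := by
          have hcn : ContinuousAt (fun z : UnitAddCircle => ‖z - (x : UnitAddCircle)‖) y := by
            fun_prop
          exact hcn.eventually (lt_mem_nhds (hr.trans hy))
        filter_upwards [this] with z hz
        rw [mulSmooth_apply, hχ z hz.le, zero_mul]
  refine squeeze_zero_norm (fun n => hC _ _ (hbd n)) ?_
  have := ((tendsto_pow_atTop_nhds_zero_of_lt_one hρ0.le hρ1).const_mul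
    (∑ j ∈ Finset.range (N + 1), D j)).const_mul C
  simpa using this

/-- With `T φ = (φ ∘ b) b'` and `ψ = χ - χ ∘ b⁻¹`, invariance gives `⟨u, χ φ⟩ = ⟨u, ψ φ⟩ + ⟨u, χ T
φ⟩`. Iterating produces the terms `⟨u, ψ Tⁿ φ⟩` and a remainder that tends to `0`. As `ψ` is
supported away from fixed points, each term is bounded by the `L²` norm of `Tⁿ φ` on its support,
which decays like `λ^(n/2)`. -/
lemma CircleDistribution.sqIntegrableNear_of_attracting {u : CircleDistribution} {b : CircleDiffeo}
    (hu : u.Invariant b) {x : UnitAddCircle} (hx : b.toEquiv x = x)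
    (h1 : circleDeriv b.toEquiv x < 1) (h : ∀ y, b.toEquiv y ≠ y → u.SqIntegrableNear y) :
    u.SqIntegrableNear x := by
  obtain ⟨η', K, hη', -, hK0, hK⟩ := exists_iter_bounds b hx h1
  obtain ⟨x, rfl⟩ := exists_coe x
  obtain ⟨F, G, hl, hFx⟩ := exists_isLift_fixed b hx
  have h1' := h1
  rw [hl.circleDeriv_coe] at h1'
  obtain ⟨η, l, hη, hη2, hl0, hl1, hc1, hc⟩ := hl.exists_contraction hFx h1'
  set r := min η η' / 2 with hr
  have hr0 : 0 < r := by positivity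
  have hrη : r < η := by
    have := min_le_left η η'
    rw [hr]; linarith
  have hrη' : r ≤ η' := by
    have := min_le_right η η'
    rw [hr]; linarith
  obtain ⟨χ, hχ1, hχ0⟩ := exists_bump (x : UnitAddCircle) hr0
  have hcirc : ∀ y : UnitAddCircle, ‖y - x‖ ≤ η → ‖b.toEquiv y - x‖ ≤ l * ‖y - x‖ := fun y hy => by
    rw [← abs_coord (y - x)] at hy ⊢
    have e : b.toEquiv y - x = ((F (x + coord (y - x)) - x : ℝ) : UnitAddCircle) := by
      rw [AddCircle.coe_sub, hl.coe_eq, ← eq_coe_add_coord]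
    rw [e]
    have := hc (x + coord (y - x)) (by rwa [add_sub_cancel_left])
    rw [add_sub_cancel_left] at this
    exact (norm_coe_le_abs _).trans this
  set ψ : SmoothFun := χ - compSmooth b.symm χ with hψ
  have hψ_apply : ∀ y, (ψ : UnitAddCircle → ℂ) y
      = (χ : UnitAddCircle → ℂ) y - (χ : UnitAddCircle → ℂ) (b.symm.toEquiv y) := fun y => rfl
  have happ : ∀ y, b.toEquiv (b.symm.toEquiv y) = y := fun y => b.toEquiv.apply_symm_apply y
  -- Since `b` maps the ball of radius `r` into itself, `χ ∘ b⁻¹` also vanishes outside this ball.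
  have hsupp : tsupport (ψ : UnitAddCircle → ℂ) ⊆ {y | ‖y - x‖ ≤ r} := by
    refine closure_minimal (fun y hy => ?_) (isClosed_le (by fun_prop) continuous_const)
    rw [Function.mem_support, hψ_apply] at hy
    by_contra hcon
    have hcon' : r < ‖y - x‖ := not_le.1 hcon
    apply hy
    rw [hχ0 y hcon'.le, zero_sub, neg_eq_zero]
    apply hχ0
    by_contra hlt
    have h2 := hcirc (b.symm.toEquiv y) ((not_le.1 hlt).le.trans hrη.le)
    rw [happ] at h2
    have h3 := mul_le_of_le_one_left (norm_nonneg (b.symm.toEquiv y - x)) hl1.le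
    linarith [not_le.1 hlt]
  -- By contraction `x` is the only fixed point in the ball, and near `x` both cutoffs equal `1`, so
  -- `ψ` vanishes there.
  have hnfix : ∀ y ∈ tsupport (ψ : UnitAddCircle → ℂ), b.toEquiv y ≠ y := fun y hy hyb => by
    have h2 := hcirc y ((hsupp hy : ‖y - x‖ ≤ r).trans hrη.le)
    rw [hyb] at h2
    have h3 : ‖y - x‖ = 0 := by nlinarith [norm_nonneg (y - x)]
    rw [norm_eq_zero, sub_eq_zero] at h3
    rw [h3] at hy
    refine notMem_tsupport_iff_eventuallyEq.2 ?_ hy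
    have hs : b.symm.toEquiv (x : UnitAddCircle) = x := b.toEquiv.symm_apply_eq.2 hx.symm
    have hc2 : Filter.Tendsto b.symm.toEquiv (𝓝 (x : UnitAddCircle)) (𝓝 (x : UnitAddCircle)) := by
      have := b.symm.continuous.tendsto (x : UnitAddCircle)
      rwa [hs] at this
    filter_upwards [hχ1, hc2.eventually hχ1] with z h4 h5
    rw [hψ_apply, h4, h5, sub_self]
    rfl
  obtain ⟨C, hC0, hC⟩ := u.exists_bound_tsupport ψ fun y hy => h y (hnfix y hy)
  have hstep : ∀ φ : SmoothFun, u.toLin (mulSmooth χ φ)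
      = u.toLin (mulSmooth ψ φ) + u.toLin (mulSmooth χ (transport b φ)) := fun φ => by
    have e1 : mulSmooth χ (transport b φ) = transport b (mulSmooth (compSmooth b.symm χ) φ) := by
      ext y
      rw [mulSmooth_apply, transport_apply, transport_apply, mulSmooth_apply]
      have : (compSmooth b.symm χ : UnitAddCircle → ℂ) (b.toEquiv y)
          = (χ : UnitAddCircle → ℂ) y :=
        congrArg (χ : UnitAddCircle → ℂ) (b.toEquiv.symm_apply_apply y)
      rw [this, mul_assoc]
    rw [e1, hu, ← map_add]
    congr 1
    ext y
    show _ = (ψ : UnitAddCircle → ℂ) y * _ + (χ : UnitAddCircle → ℂ) (b.symm.toEquiv y) * _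
    rw [hψ_apply, mulSmooth_apply]
    ring
  have hexp : ∀ (φ : SmoothFun) (M : ℕ), u.toLin (mulSmooth χ φ)
      = ∑ n ∈ Finset.range M, u.toLin (mulSmooth ψ (transport (b.iter n) φ))
        + u.toLin (mulSmooth χ (transport (b.iter M) φ)) := fun φ M => by
    induction M with
    | zero =>
      have : transport (b.iter 0) φ = φ := by
        ext y
        have h2 : circleDeriv (b.iter 0).toEquiv y = 1 := by
          obtain ⟨t, rfl⟩ := exists_coe y
          rw [(isLift_iter hl 0).circleDeriv_coe]
          simp
        rw [transport_apply, h2, Complex.ofReal_one, mul_one]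
        rfl
      rw [this, Finset.sum_range_zero, zero_add]
    | succ M ih =>
      have : transport (b.iter (M + 1)) φ = transport b (transport (b.iter M) φ) :=
        (transport_transport b (b.iter M) φ).symm
      rw [ih, Finset.sum_range_succ, hstep, this]
      ring
  set lam := circleDeriv b.toEquiv (x : UnitAddCircle) with hlam
  have hlam0 : 0 < lam := b.circleDeriv_pos _
  have hsq1 : √lam < 1 := by rwa [Real.sqrt_lt' one_pos, one_pow]
  -- Of the two factors `(bⁿ)'` in the square, one is bounded by `K λⁿ` and the other is the
  -- Jacobian of the change of variables.
  have hint : ∀ (φ : SmoothFun) (n : ℕ), √(∫ y in tsupport (ψ : UnitAddCircle → ℂ),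
      ‖(transport (b.iter n) φ : UnitAddCircle → ℂ) y‖ ^ 2 ∂mu) ≤ √K * √lam ^ n * ‖toL2 φ‖ :=
    fun φ n => by
      rw [Real.sqrt_le_left (by positivity), mul_pow, mul_pow, Real.sq_sqrt hK0.le, ← pow_mul,
        mul_comm n 2, pow_mul, Real.sq_sqrt hlam0.le, norm_toL2_sq]
      have hcf : Continuous fun y => ‖(φ : UnitAddCircle → ℂ) y‖ ^ 2 :=
        (continuous_smooth φ).norm.pow 2
      rw [← integral_comp_mul_deriv_circle (b.iter n) hcf, ← integral_const_mul,
        ← integral_indicator (isClosed_tsupport _).measurableSet]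
      have hcc : Continuous fun y => circleDeriv (b.iter n).toEquiv y •
          ‖(φ : UnitAddCircle → ℂ) ((b.iter n).toEquiv y)‖ ^ 2 :=
        (b.iter n).continuous_circleDeriv.smul (hcf.comp (b.iter n).continuous)
      refine integral_mono ((integrable_sq_norm_smooth _).indicator
        (isClosed_tsupport _).measurableSet) ((hcc.integrable_of_hasCompactSupport
          (HasCompactSupport.of_compactSpace _)).const_mul _) fun y => ?_
      have hd0 := (b.iter n).circleDeriv_pos y
      by_cases hy : y ∈ tsupport (ψ : UnitAddCircle → ℂ)
      · have h2 := (hK n y ((hsupp hy : ‖y - x‖ ≤ r).trans hrη')).2.1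
        simp only [Set.indicator_of_mem hy, transport_apply, norm_mul, Complex.norm_real,
          Real.norm_of_nonneg hd0.le, mul_pow, smul_eq_mul]
        have h3 := mul_le_mul_of_nonneg_right h2 (mul_nonneg hd0.le
          (sq_nonneg ‖(φ : UnitAddCircle → ℂ) ((b.iter n).toEquiv y)‖))
        refine le_trans (le_of_eq ?_) h3
        ring
      · simp only [Set.indicator_of_notMem hy, smul_eq_mul]
        positivity
  refine ⟨χ, by rw [hχ1.self_of_nhds]; exact one_ne_zero, C * (√K * (1 - √lam)⁻¹), ?_,
    fun φ => ?_⟩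
  · have : 0 < 1 - √lam := by linarith
    positivity
  · have hlim := (u.tendsto_apply_transport hl hrη hl0 hl1 hc1 hc hχ0 φ).norm.const_add
      (C * (√K * (1 - √lam)⁻¹) * ‖toL2 φ‖)
    rw [norm_zero, add_zero] at hlim
    refine ge_of_tendsto' hlim fun M => ?_
    rw [hexp φ M]
    refine (norm_add_le _ _).trans (add_le_add_left ?_ _)
    refine (norm_sum_le _ _).trans ?_
    have hgeom : ∑ n ∈ Finset.range M, √lam ^ n ≤ (1 - √lam)⁻¹ := by
      rw [← tsum_geometric_of_lt_one (Real.sqrt_nonneg _) hsq1]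
      exact (summable_geometric_of_lt_one (Real.sqrt_nonneg _) hsq1).sum_le_tsum _
        (fun i _ => by positivity)
    calc _ ≤ ∑ n ∈ Finset.range M, C * (√K * √lam ^ n * ‖toL2 φ‖) :=
          Finset.sum_le_sum fun n _ => (hC _).trans (mul_le_mul_of_nonneg_left (hint φ n) hC0)
      _ = C * (√K * ∑ n ∈ Finset.range M, √lam ^ n) * ‖toL2 φ‖ := by
          rw [Finset.mul_sum, Finset.mul_sum, Finset.sum_mul]
          exact Finset.sum_congr rfl fun n _ => by ring
      _ ≤ _ := by gcongr

/-! ### Microlocal regularity of the Szegő components -/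

lemma exists_lipschitz_of_hasSum {c : ℤ → ℂ} {W : UnitAddCircle → ℂ}
    (hc : Summable fun k : ℤ => (1 + |(k : ℝ)|) * ‖c k‖)
    (hW : ∀ x, HasSum (fun k => c k * expo k x) (W x)) :
    ∃ L : ℝ, 0 ≤ L ∧ ∀ x y, ‖W x - W y‖ ≤ L * ‖x - y‖ := by
  refine ⟨2 * Real.pi * ∑' k : ℤ, (1 + |(k : ℝ)|) * ‖c k‖,
    mul_nonneg (by positivity) (tsum_nonneg fun k => by positivity), fun x y => ?_⟩
  have h1 := ((hW x).sub (hW y)).tsum_eq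
  rw [← h1]
  have h2 := tsum_of_norm_bounded ((hc.mul_left (2 * Real.pi * ‖x - y‖)).hasSum)
    (f := fun k => c k * expo k x - c k * expo k y) (fun k => by
      rw [← mul_sub, norm_mul]
      have h3 := norm_expo_sub_le k x y
      calc ‖c k‖ * ‖expo k x - expo k y‖ ≤ ‖c k‖ * (2 * Real.pi * |(k : ℝ)| * ‖x - y‖) := by gcongr
        _ = 2 * Real.pi * ‖x - y‖ * (|(k : ℝ)| * ‖c k‖) := by ring
        _ ≤ _ := by gcongr; linarith)
  refine h2.trans (le_of_eq ?_)
  rw [tsum_mul_left]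
  ring

/-- Square integrable functions with summable Fourier coefficients. -/
lemma exists_ae_eq_fourierSum {w : L2} (hw : Summable fun k : ℤ => ‖⟪basis k, w⟫_ℂ‖) :
    ∃ W : UnitAddCircle → ℂ, Continuous W ∧ w =ᵐ[mu] W ∧
      ∀ x, HasSum (fun k => ⟪basis k, w⟫_ℂ * expo k x) (W x) := by
  have hs : Summable fun k : ℤ => ⟪basis k, w⟫_ℂ • (fourier k : C(UnitAddCircle, ℂ)) := by
    refine Summable.of_norm ?_
    simpa only [norm_smul, fourier_norm, mul_one] using hw
  refine ⟨⇑(∑' k : ℤ, ⟪basis k, w⟫_ℂ • (fourier k : C(UnitAddCircle, ℂ))), ContinuousMap.continuous _,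
    ?_, fun x => ?_⟩
  · have h1 := (ContinuousMap.toLp 2 mu ℂ).hasSum hs.hasSum
    have h2 := basis.hasSum_repr w
    have h3 : (fun k => ContinuousMap.toLp (E := ℂ) 2 mu ℂ
        (⟪basis k, w⟫_ℂ • (fourier k : C(UnitAddCircle, ℂ)))) = fun k => basis.repr w k • basis k := by
      funext k
      rw [map_smul, basis.repr_apply_apply]
      congr 1
      exact Lp.ext ((ContinuousMap.coeFn_toLp mu _).trans (coeFn_basis k).symm)
    rw [← h3] at h2
    have h4 := h2.unique h1
    conv_lhs => rw [h4]
    exact ContinuousMap.coeFn_toLp mu _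
  · exact (ContinuousMap.evalCLM ℂ x).hasSum hs.hasSum

/-- Where `|χ| > c`, divide in `χ(X) (v(X) - v(Y)) = (W(X) - W(Y)) - (χ(X) - χ(Y)) v(Y)`; there `|v|
≤ B / c`. -/
lemma lipschitzNear_of_mul {χ W v : UnitAddCircle → ℂ} (hχ : Continuous χ) {x : UnitAddCircle}
    (hx : χ x ≠ 0) {A L B : ℝ} (hA0 : 0 ≤ A) (hB0 : 0 ≤ B)
    (hA : ∀ x y, ‖χ x - χ y‖ ≤ A * ‖x - y‖)
    (hL : ∀ x y, ‖W x - W y‖ ≤ L * ‖x - y‖) (hB : ∀ x, ‖W x‖ ≤ B)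
    (hv : (fun y => χ y * v y) =ᵐ[mu] W) : LipschitzNear v x := by
  set c := ‖χ x‖ / 2 with hc
  have hc0 : 0 < c := by positivity
  have hU : {y | c < ‖χ y‖} ∈ 𝓝 x :=
    hχ.norm.continuousAt.eventually (lt_mem_nhds (by
      have : 0 < ‖χ x‖ := norm_pos_iff.2 hx
      rw [hc]; linarith))
  refine ⟨_, hU, ((L + A * (B / c)) / c) ^ 2, by positivity, ?_⟩
  filter_upwards [measurePreserving_fst'.quasiMeasurePreserving.ae hv,
    measurePreserving_snd'.quasiMeasurePreserving.ae hv] with z h1 h2 hz1 hz2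
  have hz1' : c < ‖χ z.1‖ := hz1
  have hz2' : c < ‖χ z.2‖ := hz2
  have hb : ‖v z.2‖ ≤ B / c := by
    rw [le_div_iff₀ hc0]
    have := hB z.2
    rw [← h2, norm_mul] at this
    nlinarith [norm_nonneg (v z.2)]
  have e : χ z.1 * (v z.1 - v z.2) = (W z.1 - W z.2) - (χ z.1 - χ z.2) * v z.2 := by
    rw [← h1, ← h2]
    ring
  have h3 : c * ‖v z.1 - v z.2‖ ≤ (L + A * (B / c)) * ‖z.1 - z.2‖ := by
    calc c * ‖v z.1 - v z.2‖ ≤ ‖χ z.1‖ * ‖v z.1 - v z.2‖ := by gcongr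
      _ = ‖(W z.1 - W z.2) - (χ z.1 - χ z.2) * v z.2‖ := by rw [← norm_mul, e]
      _ ≤ ‖W z.1 - W z.2‖ + ‖(χ z.1 - χ z.2) * v z.2‖ := norm_sub_le _ _
      _ ≤ L * ‖z.1 - z.2‖ + A * ‖z.1 - z.2‖ * (B / c) := by
          rw [norm_mul]
          exact add_le_add (hL _ _) (mul_le_mul (hA _ _) hb (norm_nonneg _) (by positivity))
      _ = _ := by ring
  have h4 : ‖diff v z‖ ≤ (L + A * (B / c)) / c * ‖z.1 - z.2‖ := by
    rw [div_mul_eq_mul_div, le_div_iff₀ hc0, mul_comm]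
    exact h3
  calc ‖diff v z‖ ^ 2 ≤ ((L + A * (B / c)) / c * ‖z.1 - z.2‖) ^ 2 := by gcongr
    _ = ((L + A * (B / c)) / c) ^ 2 * ‖z.1 - z.2‖ ^ 2 := mul_pow _ _ _
    _ ≤ _ := by
      refine mul_le_mul_of_nonneg_left ?_ (by positivity)
      have := four_mul_norm_sq_le_sinSq (z.1 - z.2)
      nlinarith [sq_nonneg ‖z.1 - z.2‖]

/-- One sided decay of the Fourier coefficients of `χ (p + q)` gives regularity of `p` when the
frequencies of `p` and `q` are separated by the sign `σ`. -/
lemma CircleDistribution.lipschitzNear_of_rapidDecay {u : CircleDistribution} {p q : L2}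
    (hf : ∀ φ : SmoothFun, u.toLin φ = ∫ x, (p + q : L2) x * (φ : UnitAddCircle → ℂ) x ∂mu)
    {χ : SmoothFun} {x : UnitAddCircle} (hx : (χ : UnitAddCircle → ℂ) x ≠ 0) {σ : ℤ}
    (hd : (u.mul χ).RapidDecay σ)
    (hp : ∀ k j : ℤ, ¬ 0 < σ * k → ⟪basis j, p⟫_ℂ ≠ 0 → |k - j| = |k| + |j|)
    (hq : ∀ k j : ℤ, 0 < σ * k → ⟪basis j, q⟫_ℂ ≠ 0 → |k - j| = |k| + |j|) :
    LipschitzNear p x := by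
  obtain ⟨M, hM0, hM⟩ := exists_norm_le_smooth χ
  obtain ⟨T, hT, -⟩ := exists_mulL2 (ν := mu) (continuous_smooth χ).aestronglyMeasurable hM
  have hTb : ∀ k j, ⟪basis k, T (basis j)⟫_ℂ = ⟪basis (k - j), toL2 χ⟫_ℂ := fun k j => by
    rw [inner_basis, inner_basis]
    refine integral_congr_ae ?_
    filter_upwards [hT (basis j), coeFn_basis j, coeFn_toL2 χ] with y h1 h2 h3
    rw [h1, h2, h3, conj_expo, conj_expo, show -(k - j) = -k + j by ring, expo_add_index]
    ring
  have hTf : ∀ k, ⟪basis k, T (p + q)⟫_ℂ = (u.mul χ).toLin (expoSmooth (-k)) := fun k => by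
    rw [inner_basis, mul_apply, hf]
    refine integral_congr_ae ?_
    filter_upwards [hT (p + q)] with y h1
    rw [h1, mulSmooth_apply, expoSmooth_apply, conj_expo]
    ring
  obtain ⟨c₀, hc₀, hc⟩ := exists_norm_inner_basis_apply_le
  -- The exponents: decay of order `3` gives `∑ (1 + |k|) |w_k| < ∞`, hence a Lipschitz function;
  -- one more power of decay for `χ` is spent on the sum over `j`.
  obtain ⟨D, hD0, hD⟩ := exists_coeff_le χ 4
  obtain ⟨E, hE0, hE⟩ := hd 3
  -- The matrix of multiplication by `χ` depends on `k - j`; when `|k - j| = |k| + |j|` its entries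
  -- decay in `k` and `j` at the same time.
  have hsep : ∀ (k : ℤ) (v : L2), (∀ j, ⟪basis j, v⟫_ℂ ≠ 0 → |k - j| = |k| + |j|) →
      (1 + |(k : ℝ)|) ^ 3 * ‖⟪basis k, T v⟫_ℂ‖ ≤ D * (c₀ * ‖v‖) := fun k v hv => by
    have h1 := hc T k (D / (1 + |(k : ℝ)|) ^ 3) v (by positivity) fun j hj => by
      rw [hTb, div_div, le_div_iff₀ (by positivity), mul_comm]
      refine le_trans (mul_le_mul_of_nonneg_right ?_ (norm_nonneg _)) (hD (k - j))
      have h2 : |((k - j : ℤ) : ℝ)| = |(k : ℝ)| + |(j : ℝ)| := by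
        have := hv j hj
        exact_mod_cast this
      rw [h2, pow_succ _ 3]
      have := abs_nonneg (k : ℝ)
      have := abs_nonneg (j : ℝ)
      gcongr <;> linarith
    rwa [div_mul_eq_mul_div, le_div_iff₀ (by positivity), mul_comm] at h1
  -- For `σ k > 0` the coefficient of `χ p` is that of `χ (p + q)`, small by hypothesis, minus that
  -- of `χ q`, small by separation. For the other `k`, `χ p` is itself small by separation.
  have hw : ∀ k : ℤ, (1 + |(k : ℝ)|) ^ 3 * ‖⟪basis k, T p⟫_ℂ‖
      ≤ E + D * (c₀ * ‖q‖) + D * (c₀ * ‖p‖) := fun k => by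
    have n1 : 0 ≤ D * (c₀ * ‖q‖) := by positivity
    have n2 : 0 ≤ D * (c₀ * ‖p‖) := by positivity
    by_cases hk : 0 < σ * k
    · have h1 := hsep k q fun j => hq k j hk
      have h2 := hE k hk
      rw [← hTf, map_add, inner_add_right] at h2
      have h3 : ‖⟪basis k, T p⟫_ℂ‖ ≤ ‖⟪basis k, T p⟫_ℂ + ⟪basis k, T q⟫_ℂ‖ + ‖⟪basis k, T q⟫_ℂ‖ := by
        have := norm_sub_le (⟪basis k, T p⟫_ℂ + ⟪basis k, T q⟫_ℂ) ⟪basis k, T q⟫_ℂ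
        rwa [add_sub_cancel_right] at this
      have h4 := mul_le_mul_of_nonneg_left h3 (show 0 ≤ (1 + |(k : ℝ)|) ^ 3 by positivity)
      rw [mul_add] at h4
      linarith
    · have h1 := hsep k p fun j => hp k j hk
      linarith
  have hw1 : Summable fun k : ℤ => (1 + |(k : ℝ)|) * ‖⟪basis k, T p⟫_ℂ‖ :=
    summable_of_le_inv_sq (fun k => by positivity) fun k => by
      rw [← mul_assoc, ← pow_succ]
      exact hw k
  have hw2 : Summable fun k : ℤ => ‖⟪basis k, T p⟫_ℂ‖ :=
    hw1.of_nonneg_of_le (fun k => norm_nonneg _) fun k =>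
      le_mul_of_one_le_left (norm_nonneg _) (by linarith [abs_nonneg (k : ℝ)])
  obtain ⟨W, hWc, hWae, hWs⟩ := exists_ae_eq_fourierSum hw2
  obtain ⟨L, -, hL⟩ := exists_lipschitz_of_hasSum hw1 hWs
  obtain ⟨A, hA0, hA⟩ := exists_lipschitz_of_hasSum (by simpa using summable_coeff χ 1)
    (hasSum_smooth χ)
  obtain ⟨B, hB⟩ := isCompact_univ.exists_bound_of_continuousOn hWc.continuousOn
  exact lipschitzNear_of_mul (continuous_smooth χ) hx hA0
    ((norm_nonneg _).trans (hB 0 trivial)) hA hL (fun y => hB y trivial)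
    ((hT p).symm.trans hWae)

lemma CircleDistribution.lipschitzNear_szego {u : CircleDistribution} {f : L2}
    (hf : ∀ φ : SmoothFun, u.toLin φ = ∫ x, f x * (φ : UnitAddCircle → ℂ) x ∂mu)
    {x : UnitAddCircle} (h : (x, (1 : ℝ)) ∉ u.WF) : LipschitzNear (szego f) x := by
  obtain ⟨χ, hx, hd⟩ := u.exists_rapidDecay (σ := 1) one_ne_zero (by exact_mod_cast h)
  refine lipschitzNear_of_rapidDecay (q := f - szego f) (by simpa using hf) hx hd ?_ ?_
  · intro k j hk hj
    rw [inner_basis_szego] at hj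
    have hj0 : 0 ≤ j := by
      by_contra hcon
      exact hj (if_neg hcon)
    rw [abs_of_nonneg hj0, abs_of_nonpos (by omega), abs_of_nonpos (by omega)]
    ring
  · intro k j hk hj
    rw [inner_sub_right, inner_basis_szego] at hj
    have hj0 : j < 0 := by
      by_contra hcon
      rw [if_pos (not_lt.1 hcon), sub_self] at hj
      exact hj rfl
    rw [abs_of_neg hj0, abs_of_pos (by omega : 0 < k), abs_of_pos (by omega)]
    ring

lemma CircleDistribution.lipschitzNear_sub_szego {u : CircleDistribution} {f : L2}
    (hf : ∀ φ : SmoothFun, u.toLin φ = ∫ x, f x * (φ : UnitAddCircle → ℂ) x ∂mu)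
    {x : UnitAddCircle} (h : (x, (-1 : ℝ)) ∉ u.WF) : LipschitzNear (f - szego f : L2) x := by
  obtain ⟨χ, hx, hd⟩ := u.exists_rapidDecay (σ := -1) (by norm_num) (by exact_mod_cast h)
  refine lipschitzNear_of_rapidDecay (q := szego f) (by simpa using hf) hx hd ?_ ?_
  · intro k j hk hj
    rw [inner_sub_right, inner_basis_szego] at hj
    have hj0 : j < 0 := by
      by_contra hcon
      rw [if_pos (not_lt.1 hcon), sub_self] at hj
      exact hj rfl
    rw [abs_of_neg hj0, abs_of_nonneg (by omega : 0 ≤ k), abs_of_pos (by omega)]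
    ring
  · intro k j hk hj
    rw [inner_basis_szego] at hj
    have hj0 : 0 ≤ j := by
      by_contra hcon
      exact hj (if_neg hcon)
    rw [abs_of_nonneg hj0, abs_of_neg (by omega), abs_of_neg (by omega)]
    ring

/-! ### Diffeomorphisms with a fixed point -/

/-- A lift fixing `x` also fixes all `x + m`. The orbit of `t` is monotone and cannot cross these
points, so it converges, and its limit is fixed. -/
lemma exists_tendsto_iterate (c : CircleDiffeo) {x : UnitAddCircle} (hx : c.toEquiv x = x)
    (y : UnitAddCircle) : ∃ z, c.toEquiv z = z ∧
      Filter.Tendsto (fun n => c.toEquiv^[n] y) Filter.atTop (𝓝 z) := by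
  obtain ⟨x, rfl⟩ := exists_coe x
  obtain ⟨t, rfl⟩ := exists_coe y
  obtain ⟨F, G, h, hFx⟩ := exists_isLift_fixed c hx
  have hmono : Monotone F := h.strictMono.monotone
  have hfix : ∀ m : ℤ, F (x + m) = x + m := fun m => by rw [h.add_int, hFx]
  have hcoe : ∀ n, ((F^[n] t : ℝ) : UnitAddCircle) = c.toEquiv^[n] t := fun n => by
    rw [(isLift_iter h n).coe_eq, CircleDiffeo.iter_apply]
  have hlim : ∃ z, Filter.Tendsto (fun n => F^[n] t) Filter.atTop (𝓝 z) := by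
    rcases le_total t (F t) with ht | ht
    · refine ⟨_, tendsto_atTop_ciSup (hmono.monotone_iterate_of_le_map ht) ?_⟩
      refine ⟨x + ⌈t - x⌉, ?_⟩
      rintro _ ⟨n, rfl⟩
      have h1 : t ≤ x + ⌈t - x⌉ := by linarith [Int.le_ceil (t - x)]
      have h2 := hmono.iterate n h1
      rwa [Function.iterate_fixed (hfix _) n] at h2
    · refine ⟨_, tendsto_atTop_ciInf (hmono.antitone_iterate_of_map_le ht) ?_⟩
      refine ⟨x + ⌊t - x⌋, ?_⟩
      rintro _ ⟨n, rfl⟩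
      have h1 : x + ⌊t - x⌋ ≤ t := by linarith [Int.floor_le (t - x)]
      have h2 := hmono.iterate n h1
      rwa [Function.iterate_fixed (hfix _) n] at h2
  obtain ⟨z, hz⟩ := hlim
  have hFz : F z = z :=
    isFixedPt_of_tendsto_iterate hz h.smooth.continuous.continuousAt
  refine ⟨(z : UnitAddCircle), by rw [← h.coe_eq, hFz], ?_⟩
  simp only [← hcoe]
  exact (continuous_coe.tendsto z).comp hz

/-- When there are fixed points, every periodic point is fixed. -/
lemma fixed_of_periodic (c : CircleDiffeo) {x : UnitAddCircle} (hx : c.toEquiv x = x)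
    {y : UnitAddCircle} {d : ℕ} (hd : 0 < d) (hy : c.toEquiv^[d] y = y) : c.toEquiv y = y := by
  obtain ⟨z, hz, hlim⟩ := exists_tendsto_iterate c hx y
  have h1 : Filter.Tendsto (fun k => c.toEquiv^[d * k] y) Filter.atTop (𝓝 z) :=
    hlim.comp (Filter.tendsto_id.const_mul_atTop' hd)
  have h2 : ∀ k, c.toEquiv^[d * k] y = y := fun k => by
    rw [Function.iterate_mul]
    exact Function.iterate_fixed hy k
  simp only [h2] at h1
  rw [tendsto_nhds_unique tendsto_const_nhds h1, hz]

/-- Functions which are locally almost everywhere constant are almost everywhere constant. -/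
lemma exists_ae_const_of_local {f : UnitAddCircle → ℂ}
    (h : ∀ x, ∃ V ∈ 𝓝 x, ∃ c : ℂ, ∀ᵐ y ∂mu, y ∈ V → f y = c) :
    ∃ c : ℂ, ∀ᵐ y ∂mu, f y = c := by
  choose V hV c hc using h
  have hloc : IsLocallyConstant c := by
    rw [IsLocallyConstant.iff_eventually_eq]
    intro x
    filter_upwards [eventually_mem_nhds_iff.2 (hV x)] with y hy
    have h1 : 0 < mu (V x ∩ V y) := Measure.measure_pos_of_mem_nhds mu (Filter.inter_mem hy (hV y))
    by_contra hne
    have h2 : mu (V x ∩ V y) = 0 := by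
      refine measure_mono_null (t := {z | ¬ ((z ∈ V x → f z = c x) ∧ (z ∈ V y → f z = c y))})
        (fun z hz hcon => hne ?_) ?_
      · rw [← hcon.1 hz.1, ← hcon.2 hz.2]
      · exact ae_iff.1 ((hc x).and (hc y))
    exact h1.ne' h2
  obtain ⟨t, ht⟩ := CompactSpace.elim_nhds_subcover V hV
  refine ⟨c 0, ?_⟩
  have hall : ∀ᵐ y ∂mu, ∀ x ∈ t, y ∈ V x → f y = c x :=
    (Finset.eventually_all t).2 fun x _ => hc x
  filter_upwards [hall] with y hy
  have : y ∈ ⋃ x ∈ t, V x := by rw [ht]; trivial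
  simp only [Set.mem_iUnion, exists_prop] at this
  obtain ⟨x, hx, hyx⟩ := this
  rw [hy x hx hyx, hloc.apply_eq_of_isPreconnected isPreconnected_univ (Set.mem_univ x)
    (Set.mem_univ 0)]

/-! ### Invariance under inverses and iterates -/

lemma circleDeriv_eq_one {g : UnitAddCircle → UnitAddCircle} (h : ∀ y, g y = y)
    (y : UnitAddCircle) : circleDeriv g y = 1 := by
  obtain ⟨t, rfl⟩ := exists_coe y
  rw [circleDeriv_eq (F := id) (fun s => (h s).symm) continuousAt_id, deriv_id]

lemma transport_eq_self {b : CircleDiffeo} (h : ∀ y, b.toEquiv y = y) (φ : SmoothFun) :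
    transport b φ = φ := by
  ext y
  rw [transport_apply, circleDeriv_eq_one h, Complex.ofReal_one, mul_one, h]

lemma CircleDistribution.Invariant.symm {u : CircleDistribution} {b : CircleDiffeo}
    (h : u.Invariant b) : u.Invariant b.symm := fun φ => by
  rw [← h (transport b.symm φ), transport_transport,
    transport_eq_self fun y => b.toEquiv.symm_apply_apply y]

lemma CircleDistribution.Invariant.iter {u : CircleDistribution} {b : CircleDiffeo}
    (h : u.Invariant b) (n : ℕ) : u.Invariant (b.iter n) := by
  induction n with
  | zero => exact fun φ => by rw [transport_eq_self fun y => b.iter_apply 0 y]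
  | succ n ih =>
    intro φ
    have : transport (b.iter (n + 1)) φ = transport b (transport (b.iter n) φ) :=
      (transport_transport b (b.iter n) φ).symm
    rw [this, h, ih]

lemma CircleDistribution.invariant_of_pullback {u : CircleDistribution} {b : CircleDiffeo}
    (h : b.pullback u = u) : u.Invariant b := by
  have h1 : u.Invariant b.symm := fun φ =>
    congrArg (fun v : CircleDistribution => v.toLin φ) h
  exact h1.symm

/-- The theorem for diffeomorphisms whose periodic points are hyperbolic fixed points. -/
lemma CircleDistribution.isConstant_of_fixed {u : CircleDistribution} {c : CircleDiffeo}
    (hu : u.Invariant c) {x₀ : UnitAddCircle} (hx₀ : c.toEquiv x₀ = x₀)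
    (hyp : ∀ x, c.toEquiv x = x → circleDeriv c.toEquiv x ≠ 1)
    (hpos : ∀ x, (x, (1 : ℝ)) ∈ u.WF → c.toEquiv x = x ∧ circleDeriv c.toEquiv x < 1)
    (hneg : ∀ x, (x, (-1 : ℝ)) ∈ u.WF → c.toEquiv x = x ∧ 1 < circleDeriv c.toEquiv x) :
    u.IsConstant := by
  have hnf : ∀ x, c.toEquiv x ≠ x → u.SqIntegrableNear x := fun x hx =>
    u.sqIntegrableNear_of_not_mem_WF (fun h => hx (hpos x h).1) fun h => hx (hneg x h).1
  have hsq : ∀ x, u.SqIntegrableNear x := fun x => by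
    by_cases hx : c.toEquiv x = x
    · rcases lt_or_gt_of_ne (hyp x hx) with h | h
      · exact sqIntegrableNear_of_attracting hu hx h hnf
      · have hs : c.symm.toEquiv x = x := c.toEquiv.symm_apply_eq.2 hx.symm
        refine sqIntegrableNear_of_attracting hu.symm hs ?_ fun y hy => hnf y fun h => hy ?_
        · have h2 := circleDeriv_symm_of_fixed c hx
          have h3 := c.symm.circleDeriv_pos x
          nlinarith
        · exact c.toEquiv.symm_apply_eq.2 h.symm
    · exact hnf x hx
  obtain ⟨f, hf⟩ := u.exists_L2 hsq
  have hinv : compL2 c f = f := compL2_eq_of_invariant hu.symm hf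
  have hfix : ∀ x, c.toEquiv x = x → ∃ V ∈ 𝓝 x, ∃ a : ℂ, ∀ᵐ y ∂mu, y ∈ V → f y = a :=
    fun x hx => exists_ae_const_near_fixed c hinv
      (fun y hy => lipschitzNear_szego hf fun h => hy (hpos y h))
      (fun y hy => lipschitzNear_sub_szego hf fun h => hy (hneg y h)) hx (hyp x hx)
  -- Some iterate carries a given point into a neighborhood of a fixed point where `f` is constant,
  -- and invariance pulls this back to a neighborhood of the point itself.
  obtain ⟨a, ha⟩ := exists_ae_const_of_local (f := f) fun y => by
    obtain ⟨z, hz, hlim⟩ := exists_tendsto_iterate c hx₀ y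
    obtain ⟨V, hV, a, ha⟩ := hfix z hz
    obtain ⟨n, hn⟩ := (hlim.eventually (eventually_mem_nhds_iff.2 hV)).exists
    rw [← CircleDiffeo.iter_apply] at hn
    refine ⟨_, (c.iter n).continuous.continuousAt.preimage_mem_nhds hn, a, ?_⟩
    filter_upwards [(quasiMeasurePreserving (c.iter n)).ae ha, compL2_iter hinv n] with w h1 h2 h3
    rw [← h2]
    exact h1 h3
  refine ⟨a, fun φ => ?_⟩
  rw [hf, ← integral_mu (fun x => a * (φ : UnitAddCircle → ℂ) x)]
  refine integral_congr_ae ?_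
  filter_upwards [ha] with x hx
  rw [hx]

/-! ### Reduction to fixed points -/

lemma circleDeriv_iter_of_fixed (g : CircleDiffeo) {y : UnitAddCircle} (hy : g.toEquiv y = y)
    (m : ℕ) : circleDeriv (g.iter m).toEquiv y = circleDeriv g.toEquiv y ^ m := by
  induction m with
  | zero => rw [pow_zero]; exact circleDeriv_eq_one (fun y => g.iter_apply 0 y) y
  | succ m ih =>
    have := circleDeriv_trans g (g.iter m) y
    rw [hy, ih, ← pow_succ] at this
    exact this

lemma coe_iter (b : CircleDiffeo) (n : ℕ) : ⇑(b.iter n).toEquiv = b.toEquiv^[n] :=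
  funext fun y => b.iter_apply n y

/-- At a point fixed by `b ^ n`, the derivative of `b ^ n` is a power of the multiplier. -/
lemma exists_circleDeriv_iter_eq (b : CircleDiffeo) {n : ℕ} (hn : 0 < n) {y : UnitAddCircle}
    (hy : b.toEquiv^[n] y = y) :
    ∃ m, m ≠ 0 ∧ circleDeriv (b.iter n).toEquiv y = b.multiplier y ^ m := by
  have hper : Function.IsPeriodicPt b.toEquiv n y := hy
  obtain ⟨m, hm⟩ := hper.minimalPeriod_dvd
  refine ⟨m, fun h => by rw [h] at hm; omega, ?_⟩
  set d := Function.minimalPeriod b.toEquiv y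
  have hd : (b.iter d).toEquiv y = y := by
    rw [b.iter_apply]
    exact Function.iterate_minimalPeriod
  have h1 := circleDeriv_iter_of_fixed (b.iter d) hd m
  rw [coe_iter, coe_iter, ← Function.iterate_mul, ← hm, ← coe_iter] at h1
  exact h1

lemma CircleDiffeo.multiplier_pos (b : CircleDiffeo) (y : UnitAddCircle) : 0 < b.multiplier y := by
  rw [CircleDiffeo.multiplier, ← coe_iter]
  exact (b.iter _).circleDeriv_pos y

end CircleDynamics

end

/-! ### Proof of the theorem -/

theorem propositionp (b : CircleDynamics.CircleDiffeo) (hb : b.IsMorseSmale)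
    (u : CircleDynamics.CircleDistribution) (hu : b.pullback u = u)
    (hWF : u.WF ⊆ CircleDynamics.conormalPos b.attracting ∪
      CircleDynamics.conormalNeg b.repelling) :
    u.IsConstant := by
  -- Here `n` is any positive period of one periodic point. The fixed points of `bⁿ` are then all
  -- the periodic points of `b`, and the derivatives of `bⁿ` there are positive powers of the
  -- multipliers, hence on the same side of `1`.
  obtain ⟨⟨x₀, n, hn, hx₀⟩, hhyp⟩ := hb
  have hfix : ∀ y, (b.iter n).toEquiv y = y ↔ y ∈ b.periodicSet := fun y => by
    refine ⟨fun hy => ⟨n, hn, by rwa [b.iter_apply] at hy⟩, fun ⟨d, hd, hy⟩ => ?_⟩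
    refine CircleDynamics.fixed_of_periodic (b.iter n) (x := x₀) ?_ hd ?_
    · rw [b.iter_apply]
      exact hx₀
    · rw [CircleDynamics.coe_iter, ← Function.iterate_mul, mul_comm, Function.iterate_mul]
      exact Function.iterate_fixed hy n
  have hder : ∀ y ∈ b.periodicSet, ∃ m, m ≠ 0 ∧
      CircleDynamics.circleDeriv (b.iter n).toEquiv y = b.multiplier y ^ m := fun y hy => by
    refine CircleDynamics.exists_circleDeriv_iter_eq b hn ?_
    rw [← b.iter_apply]
    exact (hfix y).2 hy
  refine CircleDynamics.CircleDistribution.isConstant_of_fixed (c := b.iter n) (x₀ := x₀)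
    ((CircleDynamics.CircleDistribution.invariant_of_pullback hu).iter n)
    ((hfix x₀).2 ⟨n, hn, hx₀⟩) (fun x hx => ?_) (fun x hx => ?_) (fun x hx => ?_)
  · have hp := (hfix x).1 hx
    obtain ⟨m, hm, h⟩ := hder x hp
    rw [h]
    exact fun hcon => hhyp x hp ((pow_eq_one_iff_of_nonneg (b.multiplier_pos x).le hm).1 hcon)
  · rcases hWF hx with h | h
    · obtain ⟨m, hm, he⟩ := hder x h.1.1
      exact ⟨(hfix x).2 h.1.1, he ▸ pow_lt_one₀ (b.multiplier_pos x).le h.1.2 hm⟩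
    · exact absurd h.2 (by norm_num)
  · rcases hWF hx with h | h
    · exact absurd h.2 (by norm_num)
    · obtain ⟨m, hm, he⟩ := hder x h.1.1
      exact ⟨(hfix x).2 h.1.1, he ▸ one_lt_pow₀ h.1.2 hm⟩
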